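/- **Setting.** Consider $15$ symbols, in this order, $$O_1,O_2,O_3,O_4,O_5,O_6,\;O_{12},O_{23},O_{34},O_{45},O_{56},O_{61},\;O_{123},O_{234},O_{345},$$ with weights $\deg O_i=2$, $\deg O_{i,i+1}=3$, $\deg O_{i,i+1,i+2}=4$. Indices are read modulo $6$ in $\{1,\dots,6\}$, and $O_{456}=O_{123}$, $O_{561}=O_{234}$, $O_{612}=O_{345}$. Write $\mathbf k_t=\mathbb C(t^{1/4})$ and $\tau=t^{1/2}+t^{-1/2}$. Commutative monomials in the $15$ symbols are ordered by weighted degree reverse lexicographic order with $O_1>O_2>\dots>O_{345}$: compare weighted degrees first; among different monomials of the same weighted degree, the larger one has the smaller exponent at the last symbol (in the above order) at which their exponents differ. $\mathcal A_{q=1,t}$ is the quotient of the commutative polynomial ring $\mathbf k_t[O_1,\dots,O_{345}]$ by the ideal $\mathcal I_{q=1,t}$ generated by the left hand sides of the $18$ $J$-relations ($1\le i\le 6$) \begin{align*} &O_{i+2}O_{i+4}+O_{i+3}O_{i+2,i+3,i+4}-O_{i+2,i+3}O_{i+3,i+4}-\tau O_i=0,\\ &-O_{i+3}O_{i+5,i}-O_{i+4}O_{i+1,i+2}+O_{i+3,i+4}O_{i+1,i+2,i+3}-\tau\big(O_{i,i+1}-O_iO_{i+1}\big)=0,\\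 &-O_{i+1,i+2}O_{i+4,i+5}+O_{i,i+1,i+2}O_{i+1,i+2,i+3}-O_iO_{i+3}-\tau\big(-O_{i+2,i+3,i+4}+O_{i+1}O_{i+5,i}+O_{i+5}O_{i,i+1}-O_iO_{i+1}O_{i+5}\big)=0 \end{align*} and of the Casimir relation \begin{align*} &O_{123}O_{234}O_{345}-\big(O_1O_4O_{345}+O_2O_5O_{123}+O_3O_6O_{234}\big)\\ &+\tfrac12\tau\big(O_1O_6O_{61}+O_2O_1O_{12}+O_3O_2O_{23}+O_4O_3O_{34}+O_5O_4O_{45}+O_6O_5O_{56}\big)-\big(O_1O_3O_5+O_2O_4O_6\big)\\ &-\tfrac12\tau\big(O_{12}^2+O_{23}^2+O_{34}^2+O_{45}^2+O_{56}^2+O_{61}^2\big)+\tau^3=0. \end{align*} $\mathcal A_{q=t=1}$ is the quotient of $\mathbb C[O_1,\dots,O_{345}]$ by the ideal $\mathcal I_{q=t=1}$ generated by the same $19$ left hand sides with $t^{1/4}=1$. Let $g_1,\dots,g_{61}$ be the noncommutative polynomials in the $15$ symbols over $\mathbb C[q^{\pm1/4},t^{\pm1/4}]$ listed at the end. Let $g_i|_{q=1}$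 be the commutative polynomial over $\mathbb C[t^{\pm1/4}]$ obtained from $g_i$ by putting $q^{1/4}=1$ and letting the symbols commute, and let $g_i|_{q=t=1}$ be obtained from it by putting $t^{1/4}=1$. **Theorem.** The algebra $\mathcal A_{q=1,t}$ is a flat deformation of $\mathcal A_{q=t=1}$. In detail: 1. All $g_i|_{q=1}$ and all $g_i|_{q=t=1}$ have leading coefficient $1$. The set $\{g_i|_{q=1}\}_{1\le i\le 61}$ is a Groebner basis of $\mathcal I_{q=1,t}$, and the set $\{g_i|_{q=t=1}\}_{1\le i\le 61}$ is a Groebner basis of $\mathcal I_{q=t=1}$. 2. For each $i$, the polynomials $g_i|_{q=1}$ and $g_i|_{q=t=1}$ have the same leading monomial. 3. Let $B$ be the set of commutative monomials that are divisible by none of these leading monomials. The images of the elements of $B$ form a $\mathbf k_t$-basis of $\mathcal A_{q=1,t}$ and a $\mathbb C$-basis of $\mathcal A_{q=t=1}$. There are Laurent polynomials $C_{b_1b_2}^{b_3}\in\mathbb C[t^{\pm1/4}]$, $b_1,b_2,b_3\in B$, that are the structure constants of $\mathcal A_{q=1,t}$ in the basis $B$ and whose values at $t^{1/4}=1$ are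 the structure constants of $\mathcal A_{q=t=1}$ in the basis $B$. 4. There is a flat commutative $\mathbb C[t^{\pm1/4}]$-algebra, generated by $15$ elements, whose base change to $\mathbf k_t$ is isomorphic to $\mathcal A_{q=1,t}$ and whose base change along $t^{1/4}\mapsto1$ is isomorphic to $\mathcal A_{q=t=1}$, by isomorphisms of $\mathbf k_t$-algebras and of $\mathbb C$-algebras that take the $15$ elements to $O_1,\dots,O_{345}$. **The elements $g_i$.** \begin{align*} g_{1}&=O_{56}O_{61} -q^{\frac{1}{2}}O_6O_{234} -q^{-\frac{1}{2}}O_1O_5 +q^{-\frac{1}{2}}t^{-\frac{1}{2}}(q+t)O_3,\\ g_{2}&=O_{12}O_{61} -q^{-\frac{1}{2}}O_1O_{345} -q^{\frac{1}{2}}O_2O_6 +q^{-\frac{1}{2}}t^{-\frac{1}{2}}(q+t)O_4,\\ g_{3}&=O_{45}O_{56} -q^{\frac{1}{2}}O_5O_{123} -q^{-\frac{1}{2}}O_4O_6 +q^{-\frac{1}{2}}t^{-\frac{1}{2}}(q+t)O_2,\\ g_{4}&=O_{34}O_{45} -q^{\frac{1}{2}}O_4O_{345} -q^{-\frac{1}{2}}O_3O_5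 +q^{-\frac{1}{2}}t^{-\frac{1}{2}}(q+t)O_1,\\ g_{5}&=O_{23}O_{34} -q^{\frac{1}{2}}O_3O_{234} -q^{-\frac{1}{2}}O_2O_4 +q^{-\frac{1}{2}}t^{-\frac{1}{2}}(q+t)O_6,\\ g_{6}&=O_{12}O_{23} -q^{\frac{1}{2}}O_2O_{123} -q^{-\frac{1}{2}}O_1O_3 +q^{-\frac{1}{2}}t^{-\frac{1}{2}}(q+t)O_5,\\ g_{7}&=O_3O_4O_5 -q^{-\frac{1}{2}}O_1O_2O_6 +q^{\frac{1}{4}}O_6O_{12} -q^{-\frac{1}{4}}O_5O_{34} -q^{\frac{1}{4}}O_3O_{45} +q^{-\frac{5}{4}}O_2O_{61} -q^{-\frac{3}{2}}(q-1)^2O_{345},\\ g_{8}&=O_2O_3O_4 -q^{-\frac{1}{2}}O_1O_5O_6 -q^{-\frac{1}{4}}O_4O_{23} -q^{\frac{1}{4}}O_2O_{34} +q^{-\frac{1}{4}}O_1O_{56} +q^{-\frac{3}{4}}O_5O_{61},\\ g_{9}&=O_1O_2O_3 -O_4O_5O_6 -q^{-\frac{1}{4}}O_3O_{12} -q^{\frac{1}{4}}O_1O_{23}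 +q^{-\frac{1}{4}}O_6O_{45} +q^{\frac{1}{4}}O_4O_{56},\\ g_{10}&=O_{56}O_{345} -q^{-\frac{1}{2}}O_5O_{12} -q^{\frac{1}{2}}O_6O_{34} +q^{-\frac{1}{4}}t^{-\frac{1}{2}}(q+t)O_2O_3 -t^{-\frac{1}{2}}(q+t)O_{23},\\ g_{11}&=O_{23}O_{345} -q^{-\frac{1}{2}}O_2O_{45} -q^{\frac{1}{2}}O_3O_{61} +q^{-\frac{1}{4}}t^{-\frac{1}{2}}(q+t)O_5O_6 -t^{-\frac{1}{2}}(q+t)O_{56},\\ g_{12}&=O_{45}O_{234} -q^{\frac{1}{2}}O_5O_{23} -q^{-\frac{1}{2}}O_4O_{61} +q^{-\frac{1}{4}}t^{-\frac{1}{2}}(q+t)O_1O_2 -t^{-\frac{1}{2}}(q+t)O_{12},\\ g_{13}&=O_{12}O_{234} -q^{-\frac{1}{2}}O_1O_{34} -q^{\frac{1}{2}}O_2O_{56} +q^{-\frac{1}{4}}t^{-\frac{1}{2}}(q+t)O_4O_5 -t^{-\frac{1}{2}}(q+t)O_{45},\\ g_{14}&=O_{61}O_{123} -q^{-\frac{1}{2}}O_6O_{23}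 -q^{\frac{1}{2}}O_1O_{45} +q^{-\frac{1}{4}}t^{-\frac{1}{2}}(q+t)O_3O_4 -t^{-\frac{1}{2}}(q+t)O_{34},\\ g_{15}&=O_{34}O_{123} -q^{\frac{1}{2}}O_4O_{12} -q^{-\frac{1}{2}}O_3O_{56} +q^{-\frac{3}{4}}t^{-\frac{1}{2}}(q+t)O_1O_6 -q^{-1}t^{-\frac{1}{2}}(q+t)O_{61},\\ g_{16}&=O_3O_4O_{34} -q^{-\frac{1}{2}}O_1O_6O_{61} -q^{\frac{1}{4}}O_{34}^2 +q^{-\frac{3}{4}}O_{61}^2 +q^{-\frac{3}{4}}O_1^2 -q^{\frac{1}{4}}O_3^2 -q^{-\frac{3}{4}}O_4^2 +q^{\frac{1}{4}}O_6^2,\\ g_{17}&=O_2O_3O_{23} -O_5O_6O_{56} -q^{\frac{1}{4}}O_{23}^2 +q^{\frac{1}{4}}O_{56}^2 -q^{\frac{1}{4}}O_2^2 -q^{-\frac{3}{4}}O_3^2 +q^{\frac{1}{4}}O_5^2 +q^{-\frac{3}{4}}O_6^2,\\ g_{18}&=O_1O_2O_{12} -O_4O_5O_{45} -q^{\frac{1}{4}}O_{12}^2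 +q^{\frac{1}{4}}O_{45}^2 -q^{\frac{1}{4}}O_1^2 -q^{-\frac{3}{4}}O_2^2 +q^{\frac{1}{4}}O_4^2 +q^{-\frac{3}{4}}O_5^2,\\ g_{19}&=O_{234}O_{345} +t^{-\frac{1}{2}}(q+t)O_4O_5O_6 -q^{\frac{1}{2}}O_{34}O_{61} -q^{-\frac{1}{4}}t^{-\frac{1}{2}}(q+t)O_6O_{45} -q^{\frac{1}{4}}t^{-\frac{1}{2}}(q+t)O_4O_{56} -q^{-\frac{1}{2}}O_2O_5 +q^{-\frac{1}{2}}t^{-\frac{1}{2}}(q+t)O_{123},\\ g_{20}&=O_{123}O_{345} +q^{-\frac{1}{2}}t^{-\frac{1}{2}}(q+t)O_1O_5O_6 -q^{-\frac{1}{2}}O_{12}O_{45} -q^{-\frac{1}{4}}t^{-\frac{1}{2}}(q+t)O_1O_{56} -q^{-\frac{3}{4}}t^{-\frac{1}{2}}(q+t)O_5O_{61} -q^{\frac{1}{2}}O_3O_6 +q^{-\frac{1}{2}}t^{-\frac{1}{2}}(q+t)O_{234},\\ g_{21}&=O_{123}O_{234} +q^{-\frac{1}{2}}t^{-\frac{1}{2}}(q+t)O_1O_2O_6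 -q^{\frac{1}{2}}O_{23}O_{56} -q^{\frac{1}{4}}t^{-\frac{1}{2}}(q+t)O_6O_{12} -q^{-\frac{5}{4}}t^{-\frac{1}{2}}(q+t)O_2O_{61} -q^{-\frac{1}{2}}O_1O_4 +q^{-\frac{3}{2}}t^{-\frac{1}{2}}(q^2-q+1) (q+t)O_{345},\\ g_{22}&=O_4O_5O_6^2 -q^{-\frac{3}{4}}O_6^2O_{45} -q^{\frac{3}{4}}O_4O_6O_{56} -q^{-\frac{3}{4}}O_2O_3O_{61} +q^{-\frac{1}{2}}O_{23}O_{61} +q^{-1}O_6O_{123} +q^{-\frac{3}{2}}O_3O_{345} +(q-2)O_4O_5 +q^{-\frac{7}{4}}(q-1)O_{45},\\ g_{23}&=O_1O_2O_6^2 -q^{\frac{5}{4}}O_6^2O_{12} -q^{\frac{3}{4}}O_3O_4O_{56} -q^{-\frac{5}{4}}O_2O_6O_{61} +qO_{34}O_{56} +qO_3O_{123} +q^{-\frac{3}{2}}(q^3-q+1)O_6O_{345} -q^{-1}(2 q-1)O_1O_2,\\ g_{24}&=O_1O_5^2O_6 -q^{\frac{1}{4}}O_2O_3O_{45} -q^{\frac{1}{4}}O_1O_5O_{56}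 -q^{-\frac{1}{4}}O_5^2O_{61} +q^{\frac{1}{2}}O_{23}O_{45} +O_5O_{234} +q^{\frac{1}{2}}O_2O_{345} -O_1O_6 -q^{-\frac{1}{4}}(q-1)O_{61},\\ g_{25}&=O_4^2O_5O_6 -q^{-\frac{1}{4}}O_1O_2O_{34} -q^{-\frac{1}{4}}O_4O_6O_{45} -q^{\frac{1}{4}}O_4^2O_{56} +O_{12}O_{34} +q^{-\frac{1}{2}}O_4O_{123} +O_1O_{234} -O_5O_6,\\ g_{26}&=O_1O_4O_5O_6 -q^{-\frac{1}{4}}O_1O_6O_{45} -q^{\frac{1}{4}}O_1O_4O_{56} -q^{-\frac{1}{4}}O_4O_5O_{61} +O_{45}O_{61} +q^{-\frac{1}{2}}O_1O_{123} +O_4O_{234} -O_2O_3,\\ g_{27}&=O_1O_2O_5O_6 -q^{\frac{3}{4}}O_5O_6O_{12} -q^{\frac{1}{4}}O_1O_2O_{56} -q^{-\frac{3}{4}}O_2O_5O_{61} +q^{\frac{1}{2}}O_{12}O_{56} +q^{-\frac{1}{2}}O_2O_{234} +q^{-1}(q^2-q+1)O_5O_{345} -O_3O_4 +q^{-\frac{3}{4}}(q-1)O_{34},\\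 g_{28}&=O_1^2O_5O_6 -q^{\frac{1}{4}}O_3O_4O_{12} -q^{\frac{1}{4}}O_1^2O_{56} -q^{-\frac{1}{4}}O_1O_5O_{61} +qO_{12}O_{34} +q^{-\frac{1}{2}}O_4O_{123} +O_1O_{234} -O_5O_6 -q^{-\frac{3}{4}}(q-1)^2O_{56},\\ g_{29}&=O_1O_2^2O_6 -q^{\frac{5}{4}}O_2O_6O_{12} -q^{-\frac{1}{4}}O_4O_5O_{23} -q^{-\frac{5}{4}}O_2^2O_{61} +q^{\frac{1}{2}}O_{23}O_{45} +q^{-1}O_5O_{234} +q^{-\frac{3}{2}}(q^3-q^2+1)O_2O_{345} +(q-2)O_1O_6 -q^{-\frac{1}{4}}(q-1)O_{61},\\ g_{30}&=O_1O_5O_6O_{61} -q^{-\frac{1}{4}}O_5O_{61}^2 -q^{\frac{3}{4}}O_1O_6O_{234} -q^{-\frac{1}{4}}O_3O_4O_{345} +q^{\frac{1}{2}}O_{61}O_{234} +O_{34}O_{345} -q^{-\frac{1}{4}}O_1^2O_5 -q^{\frac{3}{4}}O_5O_6^2 +q^{-1}O_4O_{45} +q^{\frac{3}{2}}O_6O_{56}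 +q^{-\frac{1}{4}}t^{-\frac{1}{2}}(q+t)O_1O_3 -q^{-\frac{5}{4}}(q-1)^2 (q+1)O_5,\\ g_{31}&=O_1O_2O_6O_{61} -q^{-\frac{3}{4}}O_2O_{61}^2 -q^{\frac{3}{4}}O_3O_4O_{234} -q^{-\frac{1}{4}}O_1O_6O_{345} +qO_{34}O_{234} +q^{-\frac{3}{2}}O_{61}O_{345} -q^{\frac{1}{4}}O_1^2O_2 -q^{\frac{5}{4}}O_2O_6^2 +q^{\frac{1}{2}}O_1O_{12} +qO_3O_{23} +q^{\frac{1}{4}}t^{-\frac{1}{2}}(q+t)O_4O_6 -q^{-\frac{7}{4}}(q-1)^2O_2,\\ g_{32}&=O_4O_5O_6O_{56} -q^{\frac{1}{4}}O_4O_{56}^2 -q^{\frac{3}{4}}O_5O_6O_{123} -q^{-\frac{3}{4}}O_2O_3O_{234} +qO_{56}O_{123} +q^{-\frac{1}{2}}O_{23}O_{234} -q^{\frac{1}{4}}O_4O_5^2 -q^{-\frac{3}{4}}O_4O_6^2 +q^{-\frac{3}{2}}O_3O_{34} +qO_5O_{45} +q^{-\frac{3}{4}}t^{-\frac{1}{2}}(q+t)O_2O_6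 -q^{-\frac{7}{4}}(q-1)^2 (q+1)O_4,\\ g_{33}&=O_1O_5O_6O_{56} -q^{\frac{1}{4}}O_1O_{56}^2 -q^{\frac{3}{4}}O_2O_3O_{123} -q^{-\frac{3}{4}}O_5O_6O_{234} +qO_{23}O_{123} +q^{-\frac{1}{2}}O_{56}O_{234} -q^{\frac{1}{4}}O_1O_5^2 -q^{-\frac{3}{4}}O_1O_6^2 +qO_2O_{12} +q^{-\frac{3}{2}}O_6O_{61} +q^{-\frac{3}{4}}t^{-\frac{1}{2}}(q+t)O_3O_5 -q^{-\frac{7}{4}}(q-1)^2 (q+1)O_1,\\ g_{34}&=O_4O_5O_6O_{45} -q^{-\frac{1}{4}}O_6O_{45}^2 -q^{-\frac{1}{4}}O_4O_5O_{123} -q^{\frac{1}{4}}O_1O_2O_{345} +q^{-1}O_{45}O_{123} +q^{\frac{1}{2}}O_{12}O_{345} -q^{\frac{3}{4}}O_4^2O_6 -q^{-\frac{1}{4}}O_5^2O_6 +O_5O_{56} +q^{\frac{1}{2}}O_1O_{61} +q^{-\frac{1}{4}}t^{-\frac{1}{2}}(q+t)O_2O_4 -q^{-\frac{5}{4}}(q-1)^2O_6,\\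 g_{35}&=O_1O_2O_6O_{45} -q^{\frac{3}{4}}O_6O_{12}O_{45} -q^{-\frac{1}{4}}O_2O_{45}O_{61} -q^{-\frac{1}{4}}O_1O_2O_{123} +O_{12}O_{123} +q^{-\frac{1}{2}}(q^2-q+1)O_{45}O_{345} -q^{\frac{3}{4}}O_3O_4^2+O_2O_{23} +q^{\frac{3}{2}}O_4O_{34} -2q^{-\frac{1}{4}}(q-1)^2O_3,\\ g_{36}&=O_5O_6^2O_{34} -O_2O_3^2O_{61} -q^{\frac{5}{4}}O_6O_{34}O_{56} +q^{\frac{3}{4}}O_3O_{23}O_{61} +q^{-\frac{5}{4}}O_3^2O_{345} -q^{-\frac{5}{4}}O_6^2O_{345} +q^{-\frac{3}{2}}(q^3-q^2+1)O_6O_{12} +(q-2)O_5O_{34} -q^{-\frac{3}{2}}O_3O_{45} -(q-2)O_2O_{61},\\ g_{37}&=O_1O_5O_6O_{34} -q^{\frac{3}{4}}O_1O_{34}O_{56} -q^{-\frac{1}{4}}O_5O_{34}O_{61} -q^{-\frac{3}{4}}O_1O_6O_{345} +q^{\frac{1}{2}}O_{34}O_{234} +q^{-1}O_{61}O_{345}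 -q^{\frac{3}{4}}O_2O_3^2 +q^{-1}(q^2-q+1)O_1O_{12} +q^{\frac{3}{2}}O_3O_{23} -q^{-\frac{5}{4}}(q-1)^2 (q+1)O_2,\\ g_{38}&=O_1O_2O_6O_{34} -q^{\frac{3}{4}}O_6O_{12}O_{34} -q^{-\frac{3}{4}}O_2O_{34}O_{61} -q^{\frac{1}{4}}O_1O_6O_{234} +O_{61}O_{234} +q^{-\frac{3}{2}}(q^2-q+1)O_{34}O_{345} -q^{\frac{1}{4}}O_4^2O_5+q^{\frac{1}{2}}O_4O_{45} +qO_6O_{56} -q^{-\frac{7}{4}}(q-1)^2O_5,\\ g_{39}&=O_1^2O_2O_{34} -O_4^2O_5O_{61} -q^{\frac{1}{4}}O_1O_{12}O_{34} +q^{\frac{1}{4}}O_4O_{45}O_{61} -q^{\frac{1}{4}}O_1^2O_{234} +q^{\frac{1}{4}}O_4^2O_{234} -q^{\frac{1}{2}}O_4O_{23} -O_2O_{34} +q^{\frac{1}{2}}O_1O_{56} +O_5O_{61},\\ g_{40}&=O_1O_6^2O_{23} -qO_3^2O_4O_{56} +q^{\frac{5}{4}}O_3O_{34}O_{56} -q^{-\frac{5}{4}}O_6O_{23}O_{61}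 +q^{\frac{5}{4}}O_3^2O_{123} -q^{\frac{5}{4}}O_6^2O_{123} -q^{\frac{3}{2}}O_3O_{12} -q^{-1}(2 q-1)O_1O_{23} +q^{-\frac{3}{2}}(q^3-q+1)O_6O_{45} +qO_4O_{56},\\ g_{41}&=O_4O_5O_6O_{23} -q^{\frac{1}{4}}O_6O_{23}O_{45} -q^{\frac{1}{4}}O_4O_{23}O_{56} -q^{-\frac{3}{4}}O_5O_6O_{234} +O_{23}O_{123} +q^{-\frac{1}{2}}O_{56}O_{234} -q^{\frac{1}{4}}O_1O_2^2 +qO_2O_{12} +q^{-\frac{3}{2}}(q^2-q+1)O_6O_{61} -q^{-\frac{7}{4}}(q-1)^2 (q+1)O_1,\\ g_{42}&=O_1O_5O_6O_{23} -q^{\frac{1}{4}}O_1O_{23}O_{56} -q^{-\frac{3}{4}}O_5O_{23}O_{61} -q^{\frac{3}{4}}O_5O_6O_{123} +qO_{56}O_{123} +q^{-\frac{1}{2}}O_{23}O_{234} -q^{\frac{1}{4}}O_3^2O_4 +q^{\frac{1}{2}}O_3O_{34} +q^{-1}(q^2-q+1)O_5O_{45} -q^{-\frac{3}{4}}(q-1)^2O_4,\\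 g_{43}&=O_4O_5^2O_{23} -O_1O_2^2O_{56} -q^{\frac{5}{4}}O_5O_{23}O_{45} +q^{\frac{3}{4}}O_2O_{12}O_{56} +q^{-\frac{5}{4}}O_2^2O_{234} -q^{-\frac{5}{4}}O_5^2O_{234} +(q-2)O_4O_{23} -q^{-\frac{3}{2}}O_2O_{34} -(q-2)O_1O_{56} +q^{-\frac{3}{2}}(q^3-q^2+1)O_5O_{61},\\ g_{44}&=O_5^2O_6O_{12} -O_2^2O_3O_{45} +q^{\frac{1}{4}}O_2O_{23}O_{45} -q^{-\frac{1}{4}}O_5O_{12}O_{56} +q^{\frac{1}{4}}O_2^2O_{345} -q^{\frac{1}{4}}O_5^2O_{345} -O_6O_{12} +q^{-\frac{1}{2}}O_5O_{34} +O_3O_{45} -q^{\frac{1}{2}}O_2O_{61},\\ g_{45}&=O_4O_5O_6O_{12} -q^{-\frac{1}{4}}O_6O_{12}O_{45} -q^{-\frac{1}{4}}O_4O_{12}O_{56} -q^{\frac{1}{4}}O_4O_5O_{345} +q^{-1}O_{12}O_{123} +q^{\frac{1}{2}}O_{45}O_{345} -q^{-\frac{1}{4}}O_2^2O_3 +O_2O_{23}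 +q^{-\frac{1}{2}}O_4O_{34} -q^{-\frac{5}{4}}(q-1)^2O_3,\\ g_{46}&=O_3O_4^2O_{12} -q^{-1}O_1^2O_6O_{45} -q^{\frac{5}{4}}O_4O_{12}O_{34} +q^{-\frac{3}{4}}O_1O_{45}O_{61} +q^{-\frac{5}{4}}O_1^2O_{123} -q^{-\frac{5}{4}}O_4^2O_{123} +(q-2)O_3O_{12} -q^{-\frac{1}{2}}O_1O_{23} +q^{-1}O_6O_{45} +q^{-\frac{3}{2}}(q^3-q^2+1)O_4O_{56},\\ g_{47}&=O_1O_2O_6O_{345} -q^{\frac{3}{4}}O_6O_{12}O_{345} -q^{-\frac{3}{4}}O_2O_{61}O_{345} +q^{-1}(q^2-q+1)O_{345}^2 -q^{-\frac{1}{4}}O_4O_5O_{45} -q^{\frac{1}{4}}O_1O_6O_{61} +O_{45}^2 +O_{61}^2 +q^{-1}O_5^2 +qO_6^2 -q^{-1}t^{-1}(t+1) (q^2+t),\\ g_{48}&=O_1O_5O_6O_{234} -q^{\frac{1}{4}}O_1O_{56}O_{234} -q^{-\frac{1}{4}}O_5O_{61}O_{234} +O_{234}^2 -q^{\frac{3}{4}}O_5O_6O_{56}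 -q^{-\frac{3}{4}}O_1O_6O_{61} +qO_{56}^2 +q^{-1}O_{61}^2 +q^{-1}O_1^2 -O_3^2 +qO_5^2 +O_6^2 -q^{-1}t^{-1}(t+1) (q^2+t),\\ g_{49}&=O_4O_5O_6O_{123} -q^{-\frac{1}{4}}O_6O_{45}O_{123} -q^{\frac{1}{4}}O_4O_{56}O_{123} +q^{-\frac{1}{2}}O_{123}^2 -q^{\frac{1}{4}}O_4O_5O_{45} -q^{-\frac{3}{4}}O_5O_6O_{56} +q^{\frac{1}{2}}O_{45}^2 +q^{-\frac{1}{2}}O_{56}^2 -q^{-\frac{1}{2}}O_2^2 +q^{\frac{1}{2}}O_4^2 +q^{-\frac{1}{2}}O_5^2 +q^{-\frac{3}{2}}O_6^2 -q^{-\frac{3}{2}}t^{-1}(t+1) (q^2+t),\\ g_{50}&=O_1O_6O_{45}O_{61} -q^{\frac{1}{2}}O_3O_4^2O_{345} -q^{\frac{1}{4}}O_{45}O_{61}^2 +q^{\frac{5}{4}}O_4O_{34}O_{345} -q^{\frac{1}{4}}O_1O_6O_{23} -q^{-\frac{3}{4}}O_1^2O_{45} +q^{-\frac{3}{4}}O_4^2O_{45}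 -q^{\frac{1}{4}}O_6^2O_{45} +q^{-\frac{1}{2}}t^{-\frac{1}{2}}(q+t)O_1O_3O_4 +q^{\frac{1}{2}}O_{23}O_{61} +O_6O_{123} -q^{\frac{1}{2}}(q-2)O_3O_{345} -q^{-\frac{1}{4}}t^{-\frac{1}{2}}(q+t)O_1O_{34} -q^{-1}O_4O_5 +q^{-\frac{3}{4}}(q-1)O_{45},\\ g_{51}&=O_4O_5O_{45}O_{61} -O_1^2O_2O_{345} -q^{\frac{1}{4}}O_{45}^2O_{61} +q^{\frac{1}{4}}O_1O_{12}O_{345} -q^{\frac{1}{4}}O_4O_5O_{23} +q^{\frac{1}{4}}O_1^2O_{61} -q^{\frac{1}{4}}O_4^2O_{61} -q^{-\frac{3}{4}}O_5^2O_{61} +q^{-\frac{1}{2}}t^{-\frac{1}{2}}(q+t)O_1O_2O_4 +qO_{23}O_{45} +q^{-\frac{1}{2}}O_5O_{234} +O_2O_{345} -q^{-\frac{1}{4}}t^{-\frac{1}{2}}(q+t)O_4O_{12} -q^{\frac{1}{2}}O_1O_6 -q^{\frac{1}{4}}(q-1)O_{61},\\ g_{52}&=O_2O_3O_{45}O_{61}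 -q^{\frac{1}{4}}O_{23}O_{45}O_{61} -q^{-\frac{3}{4}}O_3O_{45}O_{345} -q^{-\frac{1}{4}}O_2O_{61}O_{345} -q^{\frac{1}{2}}O_5^2O_6^2 +q^{-\frac{1}{2}}O_{345}^2 +q^{\frac{5}{4}}O_5O_6O_{56} +q^{-\frac{3}{2}}O_{45}^2 +q^{\frac{1}{2}}O_{61}^2 -q^{-\frac{1}{2}}(q-1)O_2^2 -q^{\frac{1}{2}}(q-2)O_5^2 +q^{\frac{1}{2}}O_6^2 -q^{-\frac{3}{2}}t^{-1}(t+1) (q^2+t),\\ g_{53}&=O_1O_6O_{23}O_{61} -qO_3^2O_4O_{234} -q^{-\frac{3}{4}}O_{23}O_{61}^2 +q^{\frac{5}{4}}O_3O_{34}O_{234} -q^{\frac{1}{4}}O_1^2O_{23} +q^{\frac{5}{4}}O_3^2O_{23} -q^{\frac{5}{4}}O_6^2O_{23} -q^{-\frac{1}{4}}O_1O_6O_{45} +q^{\frac{1}{2}}t^{-\frac{1}{2}}(q+t)O_3O_4O_6 +q^{-1}O_{45}O_{61} +q^{\frac{1}{2}}O_1O_{123} +qO_4O_{234} -q^{\frac{3}{4}}t^{-\frac{1}{2}}(q+t)O_6O_{34}-q^{2}O_2O_3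 +q^{-\frac{3}{4}}(q-1)^2 (q+1)O_{23},\\ g_{54}&=O_4O_5O_{23}O_{61} -q^{\frac{3}{4}}O_{23}O_{45}O_{61} -q^{\frac{1}{4}}O_4O_{23}O_{234} -q^{-\frac{1}{4}}O_5O_{61}O_{234} -qO_1^2O_2^2 +O_{234}^2 +q^{-\frac{1}{4}}(q^2+q-1)O_4O_5O_{45} +q^{2}O_{12}^2 +qO_{23}^2 -(q^2+q-1)O_{45}^2 +q^{-1}(q^2-q+1)O_{61}^2 +2qO_1^2 +2qO_2^2 -(q^2+q-1)O_4^2 -qO_5^2 -q^{-1}t^{-1}(t+1) (q^2+t),\\ g_{55}&=O_5O_6O_{34}O_{56} -O_2O_3^2O_{234} -q^{\frac{3}{4}}O_{34}O_{56}^2 +q^{\frac{3}{4}}O_3O_{23}O_{234} -q^{\frac{1}{4}}O_5O_6O_{12} +q^{-\frac{5}{4}}O_3^2O_{34} -q^{-\frac{1}{4}}O_5^2O_{34} -q^{-\frac{5}{4}}O_6^2O_{34} +q^{-1}t^{-\frac{1}{2}}(q+t)O_2O_3O_6 +qO_{12}O_{56} -(q-2)O_2O_{234} +q^{-\frac{1}{2}}O_5O_{345}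 -q^{-\frac{3}{4}}t^{-\frac{1}{2}}(q+t)O_6O_{23} -q^{-\frac{3}{2}}O_3O_4 +q^{-\frac{1}{4}}(q-1)O_{34},\\ g_{56}&=O_1O_2O_{34}O_{56} -q^{\frac{1}{4}}O_{12}O_{34}O_{56} -q^{-\frac{3}{4}}O_2O_{34}O_{234} -q^{-\frac{1}{4}}O_1O_{56}O_{234} -q^{\frac{1}{2}}O_4^2O_5^2 +q^{-\frac{1}{2}}O_{234}^2 +q^{\frac{5}{4}}O_4O_5O_{45} +q^{-\frac{3}{2}}O_{34}^2 +q^{\frac{1}{2}}O_{56}^2 -q^{-\frac{1}{2}}(q-1)O_1^2 -q^{\frac{1}{2}}(q-2)O_4^2 +q^{\frac{1}{2}}O_5^2 -q^{-\frac{3}{2}}t^{-1}(t+1) (q^2+t),\\ g_{57}&=O_5O_6O_{12}O_{56} -q^{\frac{1}{2}}O_2^2O_3O_{123} -q^{-\frac{1}{4}}O_{12}O_{56}^2 +q^{\frac{3}{4}}O_2O_{23}O_{123} +q^{\frac{3}{4}}O_2^2O_{12} -q^{\frac{3}{4}}O_5^2O_{12} -q^{-\frac{1}{4}}O_6^2O_{12}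 -q^{-\frac{1}{4}}O_5O_6O_{34} +t^{-\frac{1}{2}}(q+t)O_2O_3O_5 +q^{-\frac{1}{2}}O_{34}O_{56} +q^{\frac{1}{2}}O_3O_{123} +O_6O_{345} -q^{\frac{1}{4}}t^{-\frac{1}{2}}(q+t)O_5O_{23} -q^{\frac{3}{2}}O_1O_2 +q^{-\frac{1}{4}}(q-1)^2O_{12},\\ g_{58}&=O_3O_4O_{12}O_{56} -q^{\frac{3}{4}}O_{12}O_{34}O_{56} -q^{\frac{1}{4}}O_3O_{12}O_{123} -q^{-\frac{1}{4}}O_4O_{56}O_{123} -q^{-1}O_1^2O_6^2 +O_{123}^2 +q^{-\frac{7}{4}}O_1O_6O_{61} +qO_{12}^2 +q^{-1}(q^2-q+1)O_{56}^2 +q^{-2}(2 q-1)O_1^2 +q^{-1}(q-1)O_4^2 +q^{-1}O_6^2 -q^{-1}t^{-1}(t+1) (q^2+t),\\ g_{59}&=O_1O_6O_{23}O_{45} -q^{-\frac{1}{4}}O_{23}O_{45}O_{61} -q^{-\frac{1}{4}}O_1O_{23}O_{123} -q^{\frac{1}{4}}O_6O_{45}O_{123} -qO_3^2O_4^2 +O_{123}^2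 +q^{\frac{5}{4}}O_1O_6O_{61} +O_{23}^2 +q^{2}O_{34}^2 +q^{-1}(q^2-q+1)O_{45}^2 -qO_{61}^2 -qO_1^2 +2qO_3^2 +2qO_4^2 -(q^2+q-1)O_6^2 -q^{-1}t^{-1}(t+1) (q^2+t),\\ g_{60}&=O_4O_5O_{23}O_{45} -O_1O_2^2O_{123} -q^{\frac{3}{4}}O_{23}O_{45}^2 +q^{\frac{3}{4}}O_2O_{12}O_{123} +q^{-\frac{5}{4}}O_2^2O_{23} -q^{-\frac{1}{4}}O_4^2O_{23} -q^{-\frac{5}{4}}O_5^2O_{23} -q^{\frac{1}{4}}O_4O_5O_{61} +q^{-1}t^{-\frac{1}{2}}(q+t)O_1O_2O_5 +q^{\frac{3}{2}}O_{45}O_{61} -(q-2)O_1O_{123} +q^{-\frac{1}{2}}O_4O_{234} -q^{-\frac{3}{4}}t^{-\frac{1}{2}}(q+t)O_5O_{12} -q^{-\frac{3}{2}}O_2O_3 -q^{-\frac{1}{4}}(q-1)^2O_{23},\\ g_{61}&=O_5O_6O_{12}O_{34} -q^{\frac{1}{4}}O_{12}O_{34}O_{56} -q^{-\frac{3}{4}}O_6O_{12}O_{345}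 -q^{-\frac{1}{4}}O_5O_{34}O_{345} -q^{\frac{1}{2}}O_2^2O_3^2 +q^{-\frac{1}{2}}O_{345}^2 +q^{\frac{5}{4}}O_5O_6O_{56} +q^{-\frac{3}{2}}(q^2-q+1)O_{12}^2 +q^{\frac{3}{2}}O_{23}^2 +q^{-\frac{1}{2}}O_{34}^2 -q^{\frac{3}{2}}O_{56}^2 +2q^{\frac{1}{2}}O_2^2 +2q^{\frac{1}{2}}O_3^2 -q^{-\frac{1}{2}}(q^2+q-1)O_5^2 -q^{\frac{1}{2}}O_6^2 -q^{-\frac{3}{2}}t^{-1}(t+1) (q^2+t). \end{align*} -/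

import Mathlib

open scoped TensorProduct

namespace GenusTwo

/-! ### Generators and the monomial order -/

/-- Index set of the 15 generators, listed in the order
`O₁, …, O₆, O₁₂, O₂₃, O₃₄, O₄₅, O₅₆, O₆₁, O₁₂₃, O₂₃₄, O₃₄₅`. -/
abbrev Gen : Type := Fin 15

/-- `deg O_i = 2`, `deg O_{i,i+1} = 3`, `deg O_{i,i+1,i+2} = 4`. -/
def weight (i : Gen) : ℕ := if i.val < 6 then 2 else if i.val < 12 then 3 else 4

/-- Weighted degree of a commutative monomial, given by its exponent vector. -/
def wdeg (m : Gen →₀ ℕ) : ℕ := ∑ i, m i * weight i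

/-- Type synonym carrying the weighted degree reverse lexicographic order
with `O₁ > O₂ > … > O₃₄₅`. -/
def WRevLex : Type := Gen →₀ ℕ

noncomputable instance : AddCommMonoid WRevLex := inferInstanceAs (AddCommMonoid (Gen →₀ ℕ))

/-- The identity map into the synonym. -/
noncomputable def toWRevLex : (Gen →₀ ℕ) ≃+ WRevLex := AddEquiv.refl _

/-- Sort key: first the weighted degree; among monomials of equal weighted degree the larger one
has the smaller exponent at the last generator where the two exponent vectors differ. -/
noncomputable def WRevLex.key (m : WRevLex) : ℕ ×ₗ Lex (Gen → ℕᵒᵈ) :=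
  toLex (wdeg (toWRevLex.symm m),
    toLex fun i : Gen => OrderDual.toDual (toWRevLex.symm m (Fin.rev i)))

theorem WRevLex.key_injective : Function.Injective WRevLex.key := by
  intro a b h
  have h2 : (fun i : Gen => OrderDual.toDual (toWRevLex.symm a (Fin.rev i)))
      = fun i : Gen => OrderDual.toDual (toWRevLex.symm b (Fin.rev i)) :=
    congrArg (fun x : ℕ ×ₗ Lex (Gen → ℕᵒᵈ) => ofLex (ofLex x).2) h
  apply toWRevLex.symm.injective
  ext i
  have h3 := congrFun h2 (Fin.rev i)
  simpa using h3

noncomputable instance : LinearOrder WRevLex :=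
  LinearOrder.lift' WRevLex.key WRevLex.key_injective

theorem WRevLex.le_iff_key {a b : WRevLex} : a ≤ b ↔ a.key ≤ b.key := Iff.rfl

theorem wdeg_add (a b : Gen →₀ ℕ) : wdeg (a + b) = wdeg a + wdeg b := by
  simp [wdeg, add_mul, Finset.sum_add_distrib]

theorem WRevLex.key_add (a b : WRevLex) : (a + b).key = a.key + b.key := by
  simp only [WRevLex.key, map_add, wdeg_add]
  rfl

instance : IsOrderedAddMonoid WRevLex where
  add_le_add_left a b h c := by
    rw [WRevLex.le_iff_key] at h ⊢
    rw [WRevLex.key_add, WRevLex.key_add]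
    exact add_le_add_left h _

theorem wdeg_pos {c : Gen →₀ ℕ} (h : c ≠ 0) : 0 < wdeg c := by
  obtain ⟨i, hi⟩ := Finsupp.ne_iff.mp h
  refine Finset.sum_pos' (fun _ _ => Nat.zero_le _) ⟨i, Finset.mem_univ _, ?_⟩
  refine Nat.mul_pos (Nat.pos_of_ne_zero (by simpa using hi)) ?_
  unfold weight
  split_ifs <;> norm_num

theorem toWRevLex_monotone : Monotone toWRevLex := by
  intro a b h
  obtain ⟨c, rfl⟩ := exists_add_of_le h
  rw [map_add]
  rcases eq_or_ne c 0 with rfl | hc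
  · simp
  · rw [WRevLex.le_iff_key]
    apply le_of_lt
    rw [Prod.Lex.lt_iff]
    left
    change wdeg a < wdeg (a + c)
    rw [wdeg_add]
    exact Nat.lt_add_of_pos_right (wdeg_pos hc)

instance : WellFoundedLT WRevLex := by
  constructor
  rw [RelEmbedding.wellFounded_iff_isEmpty]
  refine ⟨fun f => ?_⟩
  obtain ⟨m, n, hmn, hle⟩ := wellQuasiOrdered_le (fun k => toWRevLex.symm (f k))
  have h1 : f m ≤ f n := by simpa using toWRevLex_monotone hle
  exact absurd (f.map_rel_iff.2 hmn) (not_lt.2 h1)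

/-- Weighted degree reverse lexicographic monomial order. -/
noncomputable def wRevLex : MonomialOrder Gen where
  syn := WRevLex
  addCommMonoidSyn := inferInstance
  linearOrderSyn := inferInstance
  isOrderedAddMonoid_syn := inferInstance
  wellFoundedLT_syn := inferInstance
  toSyn := toWRevLex
  toSyn_monotone := toWRevLex_monotone

/-! ### Coefficient rings -/

/-- `ℂ[t^{±1/4}]`; the variable `T` is `t^{1/4}`. -/
abbrev Rt : Type := LaurentPolynomial ℂ

/-- `ℂ[q^{±1/4}, t^{±1/4}]`; the outer variable `T` is `q^{1/4}`. -/
abbrev Rqt : Type := LaurentPolynomial Rt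

/-- `k_t = ℂ(t^{1/4})`; the variable `X` is `t^{1/4}`. -/
abbrev Kt : Type := RatFunc ℂ

/-- The inclusion `ℂ[t^{±1/4}] → ℂ(t^{1/4})`. -/
noncomputable def toKt : Rt →+* Kt :=
  LaurentPolynomial.eval₂ RatFunc.C (Units.mk0 RatFunc.X RatFunc.X_ne_zero)

/-- The specialization `t^{1/4} = 1`. -/
noncomputable def atOne : Rt →+* ℂ := LaurentPolynomial.eval₂ (RingHom.id ℂ) 1

/-- The specialization `q^{1/4} = 1`. -/
noncomputable def atQOne : Rqt →+* Rt := LaurentPolynomial.eval₂ (RingHom.id Rt) 1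

/-! ### The algebras -/

/-- `O_{i+1}`, for `i` modulo 6. -/
def gen1 (i : Fin 6) : Gen := ⟨i.val, by omega⟩

/-- `O_{i+1,i+2}`, for `i` modulo 6. -/
def gen2 (i : Fin 6) : Gen := ⟨6 + i.val, by omega⟩

/-- `O_{i+1,i+2,i+3}`, for `i` modulo 6, where
`O₄₅₆ = O₁₂₃`, `O₅₆₁ = O₂₃₄`, `O₆₁₂ = O₃₄₅`. -/
def gen3 (i : Fin 6) : Gen := ⟨12 + i.val % 3, by omega⟩

section Relators

open MvPolynomial

/-- `O_{i+1}` as a commuting variable. -/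
noncomputable def v1 (i : Fin 6) : MvPolynomial Gen Rt := X (gen1 i)

/-- `O_{i+1,i+2}` as a commuting variable. -/
noncomputable def v2 (i : Fin 6) : MvPolynomial Gen Rt := X (gen2 i)

/-- `O_{i+1,i+2,i+3}` as a commuting variable. -/
noncomputable def v3 (i : Fin 6) : MvPolynomial Gen Rt := X (gen3 i)

/-- The scalar `t^{1/2} + t^{-1/2}`. -/
noncomputable def tau : MvPolynomial Gen Rt :=
  C (LaurentPolynomial.T 2 + LaurentPolynomial.T (-2))

/-- The scalar `1/2`. -/
noncomputable def half : MvPolynomial Gen Rt := C (LaurentPolynomial.C (1 / 2))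

noncomputable def jRelatorA (i : Fin 6) : MvPolynomial Gen Rt :=
  v1 (i + 2) * v1 (i + 4) + v1 (i + 3) * v3 (i + 2) - v2 (i + 2) * v2 (i + 3) - tau * v1 i

noncomputable def jRelatorB (i : Fin 6) : MvPolynomial Gen Rt :=
  -(v1 (i + 3) * v2 (i + 5)) - v1 (i + 4) * v2 (i + 1) + v2 (i + 3) * v3 (i + 1)
    - tau * (v2 i - v1 i * v1 (i + 1))

noncomputable def jRelatorC (i : Fin 6) : MvPolynomial Gen Rt :=
  -(v2 (i + 1) * v2 (i + 4)) + v3 i * v3 (i + 1) - v1 i * v1 (i + 3)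
    - tau * (-v3 (i + 2) + v1 (i + 1) * v2 (i + 5) + v1 (i + 5) * v2 i
      - v1 i * v1 (i + 1) * v1 (i + 5))

noncomputable def casimirRelator : MvPolynomial Gen Rt :=
  v3 0 * v3 1 * v3 2 - (v1 0 * v1 3 * v3 2 + v1 1 * v1 4 * v3 0 + v1 2 * v1 5 * v3 1)
    + half * tau * (v1 0 * v1 5 * v2 5 + v1 1 * v1 0 * v2 0 + v1 2 * v1 1 * v2 1
      + v1 3 * v1 2 * v2 2 + v1 4 * v1 3 * v2 3 + v1 5 * v1 4 * v2 4)
    - (v1 0 * v1 2 * v1 4 + v1 1 * v1 3 * v1 5)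
    - half * tau * (v2 0 ^ 2 + v2 1 ^ 2 + v2 2 ^ 2 + v2 3 ^ 2 + v2 4 ^ 2 + v2 5 ^ 2)
    + tau ^ 3

/-- The 18 `J`-relators and the Casimir relator; all coefficients lie in `ℂ[t^{±1/4}]`. -/
noncomputable def relators : Set (MvPolynomial Gen Rt) :=
  Set.range jRelatorA ∪ Set.range jRelatorB ∪ Set.range jRelatorC ∪ {casimirRelator}

/-- The defining ideal of `A_{q=1,t}`. -/
noncomputable def idealT : Ideal (MvPolynomial Gen Kt) := Ideal.span (map toKt '' relators)

/-- The defining ideal of `A_{q=t=1}`. -/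
noncomputable def idealOne : Ideal (MvPolynomial Gen ℂ) := Ideal.span (map atOne '' relators)

/-- The commutative algebra `A_{q=1,t}` over `ℂ(t^{1/4})`. -/
abbrev AlgT : Type := MvPolynomial Gen Kt ⧸ idealT

/-- The commutative algebra `A_{q=t=1}` over `ℂ`. -/
abbrev AlgOne : Type := MvPolynomial Gen ℂ ⧸ idealOne

end Relators

/-! ### The 61 `q`-Groebner elements -/

/-- Noncommutative polynomials in the 15 generators over `ℂ[q^{±1/4}, t^{±1/4}]`. -/
abbrev FreeAlg : Type := FreeAlgebra Rqt Gen

section QGroebner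

/-- `q n` is `q^{n/4}`. -/
noncomputable def q (n : ℤ) : Rqt := LaurentPolynomial.T n

/-- `t n` is `t^{n/4}`. -/
noncomputable def t (n : ℤ) : Rqt := LaurentPolynomial.C (LaurentPolynomial.T n)

noncomputable def O1 : FreeAlg := FreeAlgebra.ι Rqt (0 : Gen)
noncomputable def O2 : FreeAlg := FreeAlgebra.ι Rqt (1 : Gen)
noncomputable def O3 : FreeAlg := FreeAlgebra.ι Rqt (2 : Gen)
noncomputable def O4 : FreeAlg := FreeAlgebra.ι Rqt (3 : Gen)
noncomputable def O5 : FreeAlg := FreeAlgebra.ι Rqt (4 : Gen)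
noncomputable def O6 : FreeAlg := FreeAlgebra.ι Rqt (5 : Gen)
noncomputable def O12 : FreeAlg := FreeAlgebra.ι Rqt (6 : Gen)
noncomputable def O23 : FreeAlg := FreeAlgebra.ι Rqt (7 : Gen)
noncomputable def O34 : FreeAlg := FreeAlgebra.ι Rqt (8 : Gen)
noncomputable def O45 : FreeAlg := FreeAlgebra.ι Rqt (9 : Gen)
noncomputable def O56 : FreeAlg := FreeAlgebra.ι Rqt (10 : Gen)
noncomputable def O61 : FreeAlg := FreeAlgebra.ι Rqt (11 : Gen)
noncomputable def O123 : FreeAlg := FreeAlgebra.ι Rqt (12 : Gen)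
noncomputable def O234 : FreeAlg := FreeAlgebra.ι Rqt (13 : Gen)
noncomputable def O345 : FreeAlg := FreeAlgebra.ι Rqt (14 : Gen)

noncomputable def g1 : FreeAlg :=
    O56 * O61 - (q 2) • (O6 * O234) - (q (-2)) • (O1 * O5) + (q (-2) * t (-2) * (q 4 + t 4)) • O3

noncomputable def g2 : FreeAlg :=
    O12 * O61 - (q (-2)) • (O1 * O345) - (q 2) • (O2 * O6) + (q (-2) * t (-2) * (q 4 + t 4)) • O4

noncomputable def g3 : FreeAlg :=
    O45 * O56 - (q 2) • (O5 * O123) - (q (-2)) • (O4 * O6) + (q (-2) * t (-2) * (q 4 + t 4)) • O2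

noncomputable def g4 : FreeAlg :=
    O34 * O45 - (q 2) • (O4 * O345) - (q (-2)) • (O3 * O5) + (q (-2) * t (-2) * (q 4 + t 4)) • O1

noncomputable def g5 : FreeAlg :=
    O23 * O34 - (q 2) • (O3 * O234) - (q (-2)) • (O2 * O4) + (q (-2) * t (-2) * (q 4 + t 4)) • O6

noncomputable def g6 : FreeAlg :=
    O12 * O23 - (q 2) • (O2 * O123) - (q (-2)) • (O1 * O3) + (q (-2) * t (-2) * (q 4 + t 4)) • O5

noncomputable def g7 : FreeAlg :=
    O3 * O4 * O5 - (q (-2)) • (O1 * O2 * O6) + (q 1) • (O6 * O12) - (q (-1)) • (O5 * O34)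
      - (q 1) • (O3 * O45) + (q (-5)) • (O2 * O61) - (q (-6) * (q 4 - 1) ^ 2) • O345

noncomputable def g8 : FreeAlg :=
    O2 * O3 * O4 - (q (-2)) • (O1 * O5 * O6) - (q (-1)) • (O4 * O23) - (q 1) • (O2 * O34)
      + (q (-1)) • (O1 * O56) + (q (-3)) • (O5 * O61)

noncomputable def g9 : FreeAlg :=
    O1 * O2 * O3 - O4 * O5 * O6 - (q (-1)) • (O3 * O12) - (q 1) • (O1 * O23)
      + (q (-1)) • (O6 * O45) + (q 1) • (O4 * O56)

noncomputable def g10 : FreeAlg :=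
    O56 * O345 - (q (-2)) • (O5 * O12) - (q 2) • (O6 * O34)
      + (q (-1) * t (-2) * (q 4 + t 4)) • (O2 * O3) - (t (-2) * (q 4 + t 4)) • O23

noncomputable def g11 : FreeAlg :=
    O23 * O345 - (q (-2)) • (O2 * O45) - (q 2) • (O3 * O61)
      + (q (-1) * t (-2) * (q 4 + t 4)) • (O5 * O6) - (t (-2) * (q 4 + t 4)) • O56

noncomputable def g12 : FreeAlg :=
    O45 * O234 - (q 2) • (O5 * O23) - (q (-2)) • (O4 * O61)
      + (q (-1) * t (-2) * (q 4 + t 4)) • (O1 * O2) - (t (-2) * (q 4 + t 4)) • O12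

noncomputable def g13 : FreeAlg :=
    O12 * O234 - (q (-2)) • (O1 * O34) - (q 2) • (O2 * O56)
      + (q (-1) * t (-2) * (q 4 + t 4)) • (O4 * O5) - (t (-2) * (q 4 + t 4)) • O45

noncomputable def g14 : FreeAlg :=
    O61 * O123 - (q (-2)) • (O6 * O23) - (q 2) • (O1 * O45)
      + (q (-1) * t (-2) * (q 4 + t 4)) • (O3 * O4) - (t (-2) * (q 4 + t 4)) • O34

noncomputable def g15 : FreeAlg :=
    O34 * O123 - (q 2) • (O4 * O12) - (q (-2)) • (O3 * O56)
      + (q (-3) * t (-2) * (q 4 + t 4)) • (O1 * O6) - (q (-4) * t (-2) * (q 4 + t 4)) • O61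

noncomputable def g16 : FreeAlg :=
    O3 * O4 * O34 - (q (-2)) • (O1 * O6 * O61) - (q 1) • (O34 ^ 2) + (q (-3)) • (O61 ^ 2)
      + (q (-3)) • (O1 ^ 2) - (q 1) • (O3 ^ 2) - (q (-3)) • (O4 ^ 2) + (q 1) • (O6 ^ 2)

noncomputable def g17 : FreeAlg :=
    O2 * O3 * O23 - O5 * O6 * O56 - (q 1) • (O23 ^ 2) + (q 1) • (O56 ^ 2) - (q 1) • (O2 ^ 2)
      - (q (-3)) • (O3 ^ 2) + (q 1) • (O5 ^ 2) + (q (-3)) • (O6 ^ 2)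

noncomputable def g18 : FreeAlg :=
    O1 * O2 * O12 - O4 * O5 * O45 - (q 1) • (O12 ^ 2) + (q 1) • (O45 ^ 2) - (q 1) • (O1 ^ 2)
      - (q (-3)) • (O2 ^ 2) + (q 1) • (O4 ^ 2) + (q (-3)) • (O5 ^ 2)

noncomputable def g19 : FreeAlg :=
    O234 * O345 + (t (-2) * (q 4 + t 4)) • (O4 * O5 * O6) - (q 2) • (O34 * O61)
      - (q (-1) * t (-2) * (q 4 + t 4)) • (O6 * O45) - (q 1 * t (-2) * (q 4 + t 4)) • (O4 * O56)
      - (q (-2)) • (O2 * O5) + (q (-2) * t (-2) * (q 4 + t 4)) • O123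

noncomputable def g20 : FreeAlg :=
    O123 * O345 + (q (-2) * t (-2) * (q 4 + t 4)) • (O1 * O5 * O6) - (q (-2)) • (O12 * O45)
      - (q (-1) * t (-2) * (q 4 + t 4)) • (O1 * O56)
      - (q (-3) * t (-2) * (q 4 + t 4)) • (O5 * O61) - (q 2) • (O3 * O6)
      + (q (-2) * t (-2) * (q 4 + t 4)) • O234

noncomputable def g21 : FreeAlg :=
    O123 * O234 + (q (-2) * t (-2) * (q 4 + t 4)) • (O1 * O2 * O6) - (q 2) • (O23 * O56)
      - (q 1 * t (-2) * (q 4 + t 4)) • (O6 * O12) - (q (-5) * t (-2) * (q 4 + t 4)) • (O2 * O61)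
      - (q (-2)) • (O1 * O4) + (q (-6) * t (-2) * (q 8 - q 4 + 1) * (q 4 + t 4)) • O345

noncomputable def g22 : FreeAlg :=
    O4 * O5 * O6 ^ 2 - (q (-3)) • (O6 ^ 2 * O45) - (q 3) • (O4 * O6 * O56)
      - (q (-3)) • (O2 * O3 * O61) + (q (-2)) • (O23 * O61) + (q (-4)) • (O6 * O123)
      + (q (-6)) • (O3 * O345) + (q 4 - 2) • (O4 * O5) + (q (-7) * (q 4 - 1)) • O45

noncomputable def g23 : FreeAlg :=
    O1 * O2 * O6 ^ 2 - (q 5) • (O6 ^ 2 * O12) - (q 3) • (O3 * O4 * O56)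
      - (q (-5)) • (O2 * O6 * O61) + (q 4) • (O34 * O56) + (q 4) • (O3 * O123)
      + (q (-6) * (q 12 - q 4 + 1)) • (O6 * O345) - (q (-4) * (2 * q 4 - 1)) • (O1 * O2)

noncomputable def g24 : FreeAlg :=
    O1 * O5 ^ 2 * O6 - (q 1) • (O2 * O3 * O45) - (q 1) • (O1 * O5 * O56)
      - (q (-1)) • (O5 ^ 2 * O61) + (q 2) • (O23 * O45) + O5 * O234 + (q 2) • (O2 * O345)
      - O1 * O6 - (q (-1) * (q 4 - 1)) • O61

noncomputable def g25 : FreeAlg :=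
    O4 ^ 2 * O5 * O6 - (q (-1)) • (O1 * O2 * O34) - (q (-1)) • (O4 * O6 * O45)
      - (q 1) • (O4 ^ 2 * O56) + O12 * O34 + (q (-2)) • (O4 * O123) + O1 * O234 - O5 * O6

noncomputable def g26 : FreeAlg :=
    O1 * O4 * O5 * O6 - (q (-1)) • (O1 * O6 * O45) - (q 1) • (O1 * O4 * O56)
      - (q (-1)) • (O4 * O5 * O61) + O45 * O61 + (q (-2)) • (O1 * O123) + O4 * O234 - O2 * O3

noncomputable def g27 : FreeAlg :=
    O1 * O2 * O5 * O6 - (q 3) • (O5 * O6 * O12) - (q 1) • (O1 * O2 * O56)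
      - (q (-3)) • (O2 * O5 * O61) + (q 2) • (O12 * O56) + (q (-2)) • (O2 * O234)
      + (q (-4) * (q 8 - q 4 + 1)) • (O5 * O345) - O3 * O4 + (q (-3) * (q 4 - 1)) • O34

noncomputable def g28 : FreeAlg :=
    O1 ^ 2 * O5 * O6 - (q 1) • (O3 * O4 * O12) - (q 1) • (O1 ^ 2 * O56)
      - (q (-1)) • (O1 * O5 * O61) + (q 4) • (O12 * O34) + (q (-2)) • (O4 * O123) + O1 * O234
      - O5 * O6 - (q (-3) * (q 4 - 1) ^ 2) • O56

noncomputable def g29 : FreeAlg :=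
    O1 * O2 ^ 2 * O6 - (q 5) • (O2 * O6 * O12) - (q (-1)) • (O4 * O5 * O23)
      - (q (-5)) • (O2 ^ 2 * O61) + (q 2) • (O23 * O45) + (q (-4)) • (O5 * O234)
      + (q (-6) * (q 12 - q 8 + 1)) • (O2 * O345) + (q 4 - 2) • (O1 * O6)
      - (q (-1) * (q 4 - 1)) • O61

noncomputable def g30 : FreeAlg :=
    O1 * O5 * O6 * O61 - (q (-1)) • (O5 * O61 ^ 2) - (q 3) • (O1 * O6 * O234)
      - (q (-1)) • (O3 * O4 * O345) + (q 2) • (O61 * O234) + O34 * O345 - (q (-1)) • (O1 ^ 2 * O5)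
      - (q 3) • (O5 * O6 ^ 2) + (q (-4)) • (O4 * O45) + (q 6) • (O6 * O56)
      + (q (-1) * t (-2) * (q 4 + t 4)) • (O1 * O3) - (q (-5) * (q 4 - 1) ^ 2 * (q 4 + 1)) • O5

noncomputable def g31 : FreeAlg :=
    O1 * O2 * O6 * O61 - (q (-3)) • (O2 * O61 ^ 2) - (q 3) • (O3 * O4 * O234)
      - (q (-1)) • (O1 * O6 * O345) + (q 4) • (O34 * O234) + (q (-6)) • (O61 * O345)
      - (q 1) • (O1 ^ 2 * O2) - (q 5) • (O2 * O6 ^ 2) + (q 2) • (O1 * O12) + (q 4) • (O3 * O23)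
      + (q 1 * t (-2) * (q 4 + t 4)) • (O4 * O6) - (q (-7) * (q 4 - 1) ^ 2) • O2

noncomputable def g32 : FreeAlg :=
    O4 * O5 * O6 * O56 - (q 1) • (O4 * O56 ^ 2) - (q 3) • (O5 * O6 * O123)
      - (q (-3)) • (O2 * O3 * O234) + (q 4) • (O56 * O123) + (q (-2)) • (O23 * O234)
      - (q 1) • (O4 * O5 ^ 2) - (q (-3)) • (O4 * O6 ^ 2) + (q (-6)) • (O3 * O34)
      + (q 4) • (O5 * O45) + (q (-3) * t (-2) * (q 4 + t 4)) • (O2 * O6)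
      - (q (-7) * (q 4 - 1) ^ 2 * (q 4 + 1)) • O4

noncomputable def g33 : FreeAlg :=
    O1 * O5 * O6 * O56 - (q 1) • (O1 * O56 ^ 2) - (q 3) • (O2 * O3 * O123)
      - (q (-3)) • (O5 * O6 * O234) + (q 4) • (O23 * O123) + (q (-2)) • (O56 * O234)
      - (q 1) • (O1 * O5 ^ 2) - (q (-3)) • (O1 * O6 ^ 2) + (q 4) • (O2 * O12)
      + (q (-6)) • (O6 * O61) + (q (-3) * t (-2) * (q 4 + t 4)) • (O3 * O5)
      - (q (-7) * (q 4 - 1) ^ 2 * (q 4 + 1)) • O1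

noncomputable def g34 : FreeAlg :=
    O4 * O5 * O6 * O45 - (q (-1)) • (O6 * O45 ^ 2) - (q (-1)) • (O4 * O5 * O123)
      - (q 1) • (O1 * O2 * O345) + (q (-4)) • (O45 * O123) + (q 2) • (O12 * O345)
      - (q 3) • (O4 ^ 2 * O6) - (q (-1)) • (O5 ^ 2 * O6) + O5 * O56 + (q 2) • (O1 * O61)
      + (q (-1) * t (-2) * (q 4 + t 4)) • (O2 * O4) - (q (-5) * (q 4 - 1) ^ 2) • O6

noncomputable def g35 : FreeAlg :=
    O1 * O2 * O6 * O45 - (q 3) • (O6 * O12 * O45) - (q (-1)) • (O2 * O45 * O61)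
      - (q (-1)) • (O1 * O2 * O123) + O12 * O123 + (q (-2) * (q 8 - q 4 + 1)) • (O45 * O345)
      - (q 3) • (O3 * O4 ^ 2) + O2 * O23 + (q 6) • (O4 * O34) - (2 * q (-1) * (q 4 - 1) ^ 2) • O3

noncomputable def g36 : FreeAlg :=
    O5 * O6 ^ 2 * O34 - O2 * O3 ^ 2 * O61 - (q 5) • (O6 * O34 * O56) + (q 3) • (O3 * O23 * O61)
      + (q (-5)) • (O3 ^ 2 * O345) - (q (-5)) • (O6 ^ 2 * O345)
      + (q (-6) * (q 12 - q 8 + 1)) • (O6 * O12) + (q 4 - 2) • (O5 * O34) - (q (-6)) • (O3 * O45)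
      - (q 4 - 2) • (O2 * O61)

noncomputable def g37 : FreeAlg :=
    O1 * O5 * O6 * O34 - (q 3) • (O1 * O34 * O56) - (q (-1)) • (O5 * O34 * O61)
      - (q (-3)) • (O1 * O6 * O345) + (q 2) • (O34 * O234) + (q (-4)) • (O61 * O345)
      - (q 3) • (O2 * O3 ^ 2) + (q (-4) * (q 8 - q 4 + 1)) • (O1 * O12) + (q 6) • (O3 * O23)
      - (q (-5) * (q 4 - 1) ^ 2 * (q 4 + 1)) • O2

noncomputable def g38 : FreeAlg :=
    O1 * O2 * O6 * O34 - (q 3) • (O6 * O12 * O34) - (q (-3)) • (O2 * O34 * O61)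
      - (q 1) • (O1 * O6 * O234) + O61 * O234 + (q (-6) * (q 8 - q 4 + 1)) • (O34 * O345)
      - (q 1) • (O4 ^ 2 * O5) + (q 2) • (O4 * O45) + (q 4) • (O6 * O56)
      - (q (-7) * (q 4 - 1) ^ 2) • O5

noncomputable def g39 : FreeAlg :=
    O1 ^ 2 * O2 * O34 - O4 ^ 2 * O5 * O61 - (q 1) • (O1 * O12 * O34) + (q 1) • (O4 * O45 * O61)
      - (q 1) • (O1 ^ 2 * O234) + (q 1) • (O4 ^ 2 * O234) - (q 2) • (O4 * O23) - O2 * O34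
      + (q 2) • (O1 * O56) + O5 * O61

noncomputable def g40 : FreeAlg :=
    O1 * O6 ^ 2 * O23 - (q 4) • (O3 ^ 2 * O4 * O56) + (q 5) • (O3 * O34 * O56)
      - (q (-5)) • (O6 * O23 * O61) + (q 5) • (O3 ^ 2 * O123) - (q 5) • (O6 ^ 2 * O123)
      - (q 6) • (O3 * O12) - (q (-4) * (2 * q 4 - 1)) • (O1 * O23)
      + (q (-6) * (q 12 - q 4 + 1)) • (O6 * O45) + (q 4) • (O4 * O56)

noncomputable def g41 : FreeAlg :=
    O4 * O5 * O6 * O23 - (q 1) • (O6 * O23 * O45) - (q 1) • (O4 * O23 * O56)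
      - (q (-3)) • (O5 * O6 * O234) + O23 * O123 + (q (-2)) • (O56 * O234) - (q 1) • (O1 * O2 ^ 2)
      + (q 4) • (O2 * O12) + (q (-6) * (q 8 - q 4 + 1)) • (O6 * O61)
      - (q (-7) * (q 4 - 1) ^ 2 * (q 4 + 1)) • O1

noncomputable def g42 : FreeAlg :=
    O1 * O5 * O6 * O23 - (q 1) • (O1 * O23 * O56) - (q (-3)) • (O5 * O23 * O61)
      - (q 3) • (O5 * O6 * O123) + (q 4) • (O56 * O123) + (q (-2)) • (O23 * O234)
      - (q 1) • (O3 ^ 2 * O4) + (q 2) • (O3 * O34) + (q (-4) * (q 8 - q 4 + 1)) • (O5 * O45)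
      - (q (-3) * (q 4 - 1) ^ 2) • O4

noncomputable def g43 : FreeAlg :=
    O4 * O5 ^ 2 * O23 - O1 * O2 ^ 2 * O56 - (q 5) • (O5 * O23 * O45) + (q 3) • (O2 * O12 * O56)
      + (q (-5)) • (O2 ^ 2 * O234) - (q (-5)) • (O5 ^ 2 * O234) + (q 4 - 2) • (O4 * O23)
      - (q (-6)) • (O2 * O34) - (q 4 - 2) • (O1 * O56) + (q (-6) * (q 12 - q 8 + 1)) • (O5 * O61)

noncomputable def g44 : FreeAlg :=
    O5 ^ 2 * O6 * O12 - O2 ^ 2 * O3 * O45 + (q 1) • (O2 * O23 * O45) - (q (-1)) • (O5 * O12 * O56)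
      + (q 1) • (O2 ^ 2 * O345) - (q 1) • (O5 ^ 2 * O345) - O6 * O12 + (q (-2)) • (O5 * O34)
      + O3 * O45 - (q 2) • (O2 * O61)

noncomputable def g45 : FreeAlg :=
    O4 * O5 * O6 * O12 - (q (-1)) • (O6 * O12 * O45) - (q (-1)) • (O4 * O12 * O56)
      - (q 1) • (O4 * O5 * O345) + (q (-4)) • (O12 * O123) + (q 2) • (O45 * O345)
      - (q (-1)) • (O2 ^ 2 * O3) + O2 * O23 + (q (-2)) • (O4 * O34)
      - (q (-5) * (q 4 - 1) ^ 2) • O3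

noncomputable def g46 : FreeAlg :=
    O3 * O4 ^ 2 * O12 - (q (-4)) • (O1 ^ 2 * O6 * O45) - (q 5) • (O4 * O12 * O34)
      + (q (-3)) • (O1 * O45 * O61) + (q (-5)) • (O1 ^ 2 * O123) - (q (-5)) • (O4 ^ 2 * O123)
      + (q 4 - 2) • (O3 * O12) - (q (-2)) • (O1 * O23) + (q (-4)) • (O6 * O45)
      + (q (-6) * (q 12 - q 8 + 1)) • (O4 * O56)

noncomputable def g47 : FreeAlg :=
    O1 * O2 * O6 * O345 - (q 3) • (O6 * O12 * O345) - (q (-3)) • (O2 * O61 * O345)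
      + (q (-4) * (q 8 - q 4 + 1)) • (O345 ^ 2) - (q (-1)) • (O4 * O5 * O45)
      - (q 1) • (O1 * O6 * O61) + O45 ^ 2 + O61 ^ 2 + (q (-4)) • (O5 ^ 2) + (q 4) • (O6 ^ 2)
      - (q (-4) * t (-4) * (t 4 + 1) * (q 8 + t 4)) • 1

noncomputable def g48 : FreeAlg :=
    O1 * O5 * O6 * O234 - (q 1) • (O1 * O56 * O234) - (q (-1)) • (O5 * O61 * O234) + O234 ^ 2
      - (q 3) • (O5 * O6 * O56) - (q (-3)) • (O1 * O6 * O61) + (q 4) • (O56 ^ 2)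
      + (q (-4)) • (O61 ^ 2) + (q (-4)) • (O1 ^ 2) - O3 ^ 2 + (q 4) • (O5 ^ 2) + O6 ^ 2
      - (q (-4) * t (-4) * (t 4 + 1) * (q 8 + t 4)) • 1

noncomputable def g49 : FreeAlg :=
    O4 * O5 * O6 * O123 - (q (-1)) • (O6 * O45 * O123) - (q 1) • (O4 * O56 * O123)
      + (q (-2)) • (O123 ^ 2) - (q 1) • (O4 * O5 * O45) - (q (-3)) • (O5 * O6 * O56)
      + (q 2) • (O45 ^ 2) + (q (-2)) • (O56 ^ 2) - (q (-2)) • (O2 ^ 2) + (q 2) • (O4 ^ 2)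
      + (q (-2)) • (O5 ^ 2) + (q (-6)) • (O6 ^ 2)
      - (q (-6) * t (-4) * (t 4 + 1) * (q 8 + t 4)) • 1

noncomputable def g50 : FreeAlg :=
    O1 * O6 * O45 * O61 - (q 2) • (O3 * O4 ^ 2 * O345) - (q 1) • (O45 * O61 ^ 2)
      + (q 5) • (O4 * O34 * O345) - (q 1) • (O1 * O6 * O23) - (q (-3)) • (O1 ^ 2 * O45)
      + (q (-3)) • (O4 ^ 2 * O45) - (q 1) • (O6 ^ 2 * O45)
      + (q (-2) * t (-2) * (q 4 + t 4)) • (O1 * O3 * O4) + (q 2) • (O23 * O61) + O6 * O123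
      - (q 2 * (q 4 - 2)) • (O3 * O345) - (q (-1) * t (-2) * (q 4 + t 4)) • (O1 * O34)
      - (q (-4)) • (O4 * O5) + (q (-3) * (q 4 - 1)) • O45

noncomputable def g51 : FreeAlg :=
    O4 * O5 * O45 * O61 - O1 ^ 2 * O2 * O345 - (q 1) • (O45 ^ 2 * O61) + (q 1) • (O1 * O12 * O345)
      - (q 1) • (O4 * O5 * O23) + (q 1) • (O1 ^ 2 * O61) - (q 1) • (O4 ^ 2 * O61)
      - (q (-3)) • (O5 ^ 2 * O61) + (q (-2) * t (-2) * (q 4 + t 4)) • (O1 * O2 * O4)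
      + (q 4) • (O23 * O45) + (q (-2)) • (O5 * O234) + O2 * O345
      - (q (-1) * t (-2) * (q 4 + t 4)) • (O4 * O12) - (q 2) • (O1 * O6) - (q 1 * (q 4 - 1)) • O61

noncomputable def g52 : FreeAlg :=
    O2 * O3 * O45 * O61 - (q 1) • (O23 * O45 * O61) - (q (-3)) • (O3 * O45 * O345)
      - (q (-1)) • (O2 * O61 * O345) - (q 2) • (O5 ^ 2 * O6 ^ 2) + (q (-2)) • (O345 ^ 2)
      + (q 5) • (O5 * O6 * O56) + (q (-6)) • (O45 ^ 2) + (q 2) • (O61 ^ 2)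
      - (q (-2) * (q 4 - 1)) • (O2 ^ 2) - (q 2 * (q 4 - 2)) • (O5 ^ 2) + (q 2) • (O6 ^ 2)
      - (q (-6) * t (-4) * (t 4 + 1) * (q 8 + t 4)) • 1

noncomputable def g53 : FreeAlg :=
    O1 * O6 * O23 * O61 - (q 4) • (O3 ^ 2 * O4 * O234) - (q (-3)) • (O23 * O61 ^ 2)
      + (q 5) • (O3 * O34 * O234) - (q 1) • (O1 ^ 2 * O23) + (q 5) • (O3 ^ 2 * O23)
      - (q 5) • (O6 ^ 2 * O23) - (q (-1)) • (O1 * O6 * O45)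
      + (q 2 * t (-2) * (q 4 + t 4)) • (O3 * O4 * O6) + (q (-4)) • (O45 * O61)
      + (q 2) • (O1 * O123) + (q 4) • (O4 * O234) - (q 3 * t (-2) * (q 4 + t 4)) • (O6 * O34)
      - (q 8) • (O2 * O3) + (q (-3) * (q 4 - 1) ^ 2 * (q 4 + 1)) • O23

noncomputable def g54 : FreeAlg :=
    O4 * O5 * O23 * O61 - (q 3) • (O23 * O45 * O61) - (q 1) • (O4 * O23 * O234)
      - (q (-1)) • (O5 * O61 * O234) - (q 4) • (O1 ^ 2 * O2 ^ 2) + O234 ^ 2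
      + (q (-1) * (q 8 + q 4 - 1)) • (O4 * O5 * O45) + (q 8) • (O12 ^ 2) + (q 4) • (O23 ^ 2)
      - (q 8 + q 4 - 1) • (O45 ^ 2) + (q (-4) * (q 8 - q 4 + 1)) • (O61 ^ 2)
      + (2 * q 4) • (O1 ^ 2) + (2 * q 4) • (O2 ^ 2) - (q 8 + q 4 - 1) • (O4 ^ 2)
      - (q 4) • (O5 ^ 2) - (q (-4) * t (-4) * (t 4 + 1) * (q 8 + t 4)) • 1

noncomputable def g55 : FreeAlg :=
    O5 * O6 * O34 * O56 - O2 * O3 ^ 2 * O234 - (q 3) • (O34 * O56 ^ 2) + (q 3) • (O3 * O23 * O234)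
      - (q 1) • (O5 * O6 * O12) + (q (-5)) • (O3 ^ 2 * O34) - (q (-1)) • (O5 ^ 2 * O34)
      - (q (-5)) • (O6 ^ 2 * O34) + (q (-4) * t (-2) * (q 4 + t 4)) • (O2 * O3 * O6)
      + (q 4) • (O12 * O56) - (q 4 - 2) • (O2 * O234) + (q (-2)) • (O5 * O345)
      - (q (-3) * t (-2) * (q 4 + t 4)) • (O6 * O23) - (q (-6)) • (O3 * O4)
      + (q (-1) * (q 4 - 1)) • O34

noncomputable def g56 : FreeAlg :=
    O1 * O2 * O34 * O56 - (q 1) • (O12 * O34 * O56) - (q (-3)) • (O2 * O34 * O234)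
      - (q (-1)) • (O1 * O56 * O234) - (q 2) • (O4 ^ 2 * O5 ^ 2) + (q (-2)) • (O234 ^ 2)
      + (q 5) • (O4 * O5 * O45) + (q (-6)) • (O34 ^ 2) + (q 2) • (O56 ^ 2)
      - (q (-2) * (q 4 - 1)) • (O1 ^ 2) - (q 2 * (q 4 - 2)) • (O4 ^ 2) + (q 2) • (O5 ^ 2)
      - (q (-6) * t (-4) * (t 4 + 1) * (q 8 + t 4)) • 1

noncomputable def g57 : FreeAlg :=
    O5 * O6 * O12 * O56 - (q 2) • (O2 ^ 2 * O3 * O123) - (q (-1)) • (O12 * O56 ^ 2)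
      + (q 3) • (O2 * O23 * O123) + (q 3) • (O2 ^ 2 * O12) - (q 3) • (O5 ^ 2 * O12)
      - (q (-1)) • (O6 ^ 2 * O12) - (q (-1)) • (O5 * O6 * O34)
      + (t (-2) * (q 4 + t 4)) • (O2 * O3 * O5) + (q (-2)) • (O34 * O56) + (q 2) • (O3 * O123)
      + O6 * O345 - (q 1 * t (-2) * (q 4 + t 4)) • (O5 * O23) - (q 6) • (O1 * O2)
      + (q (-1) * (q 4 - 1) ^ 2) • O12

noncomputable def g58 : FreeAlg :=
    O3 * O4 * O12 * O56 - (q 3) • (O12 * O34 * O56) - (q 1) • (O3 * O12 * O123)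
      - (q (-1)) • (O4 * O56 * O123) - (q (-4)) • (O1 ^ 2 * O6 ^ 2) + O123 ^ 2
      + (q (-7)) • (O1 * O6 * O61) + (q 4) • (O12 ^ 2) + (q (-4) * (q 8 - q 4 + 1)) • (O56 ^ 2)
      + (q (-8) * (2 * q 4 - 1)) • (O1 ^ 2) + (q (-4) * (q 4 - 1)) • (O4 ^ 2)
      + (q (-4)) • (O6 ^ 2) - (q (-4) * t (-4) * (t 4 + 1) * (q 8 + t 4)) • 1

noncomputable def g59 : FreeAlg :=
    O1 * O6 * O23 * O45 - (q (-1)) • (O23 * O45 * O61) - (q (-1)) • (O1 * O23 * O123)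
      - (q 1) • (O6 * O45 * O123) - (q 4) • (O3 ^ 2 * O4 ^ 2) + O123 ^ 2 + (q 5) • (O1 * O6 * O61)
      + O23 ^ 2 + (q 8) • (O34 ^ 2) + (q (-4) * (q 8 - q 4 + 1)) • (O45 ^ 2) - (q 4) • (O61 ^ 2)
      - (q 4) • (O1 ^ 2) + (2 * q 4) • (O3 ^ 2) + (2 * q 4) • (O4 ^ 2)
      - (q 8 + q 4 - 1) • (O6 ^ 2) - (q (-4) * t (-4) * (t 4 + 1) * (q 8 + t 4)) • 1

noncomputable def g60 : FreeAlg :=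
    O4 * O5 * O23 * O45 - O1 * O2 ^ 2 * O123 - (q 3) • (O23 * O45 ^ 2) + (q 3) • (O2 * O12 * O123)
      + (q (-5)) • (O2 ^ 2 * O23) - (q (-1)) • (O4 ^ 2 * O23) - (q (-5)) • (O5 ^ 2 * O23)
      - (q 1) • (O4 * O5 * O61) + (q (-4) * t (-2) * (q 4 + t 4)) • (O1 * O2 * O5)
      + (q 6) • (O45 * O61) - (q 4 - 2) • (O1 * O123) + (q (-2)) • (O4 * O234)
      - (q (-3) * t (-2) * (q 4 + t 4)) • (O5 * O12) - (q (-6)) • (O2 * O3)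
      - (q (-1) * (q 4 - 1) ^ 2) • O23

noncomputable def g61 : FreeAlg :=
    O5 * O6 * O12 * O34 - (q 1) • (O12 * O34 * O56) - (q (-3)) • (O6 * O12 * O345)
      - (q (-1)) • (O5 * O34 * O345) - (q 2) • (O2 ^ 2 * O3 ^ 2) + (q (-2)) • (O345 ^ 2)
      + (q 5) • (O5 * O6 * O56) + (q (-6) * (q 8 - q 4 + 1)) • (O12 ^ 2) + (q 6) • (O23 ^ 2)
      + (q (-2)) • (O34 ^ 2) - (q 6) • (O56 ^ 2) + (2 * q 2) • (O2 ^ 2) + (2 * q 2) • (O3 ^ 2)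
      - (q (-2) * (q 8 + q 4 - 1)) • (O5 ^ 2) - (q 2) • (O6 ^ 2)
      - (q (-6) * t (-4) * (t 4 + 1) * (q 8 + t 4)) • 1

/-- The `q`-Groebner elements `g₁, …, g₆₁`, with `g_k` at position `k - 1`. -/
noncomputable def qGroebner : Fin 61 → FreeAlg :=
  ![g1, g2, g3, g4, g5, g6, g7, g8, g9, g10, g11, g12, g13, g14, g15,
    g16, g17, g18, g19, g20, g21, g22, g23, g24, g25, g26, g27, g28, g29, g30,
    g31, g32, g33, g34, g35, g36, g37, g38, g39, g40, g41, g42, g43, g44, g45,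
    g46, g47, g48, g49, g50, g51, g52, g53, g54, g55, g56, g57, g58, g59, g60,
    g61]

end QGroebner

/-- The commutative image of `g_i` at `q = 1`, a polynomial over `ℂ[t^{±1/4}]`. -/
noncomputable def gQOne (i : Fin 61) : MvPolynomial Gen Rt :=
  MvPolynomial.map atQOne (FreeAlgebra.lift Rqt MvPolynomial.X (qGroebner i))

/-- `g_i` at `q = 1`, over the field `ℂ(t^{1/4})`. -/
noncomputable def gT (i : Fin 61) : MvPolynomial Gen Kt := MvPolynomial.map toKt (gQOne i)

/-- `g_i` at `q = t = 1`. -/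
noncomputable def gOne (i : Fin 61) : MvPolynomial Gen ℂ := MvPolynomial.map atOne (gQOne i)

/-! ### Groebner bases, the monomial basis, flat deformations -/

/-- `G` is a Groebner basis of the ideal `I`: it is contained in `I`, and the leading terms of its
elements generate the ideal of leading terms of `I`. -/
def IsGroebnerBasis {σ K : Type*} [Field K] (m : MonomialOrder σ)
    (G : Set (MvPolynomial σ K)) (I : Ideal (MvPolynomial σ K)) : Prop :=
  G ⊆ (I : Set (MvPolynomial σ K)) ∧
    Ideal.span (m.leadingTerm '' G) = Ideal.span (m.leadingTerm '' (I : Set (MvPolynomial σ K)))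

/-- Exponents of the monomials that are divisible by no leading monomial of the `g_i|_{q=1}`. -/
def standardMonomials : Set (Gen →₀ ℕ) := {m | ∀ i, ¬ wRevLex.degree (gT i) ≤ m}

/-- The `Kt`-algebra `A` with generators `x` is a flat deformation, over `ℂ[t^{±1/4}]`, of the
`ℂ`-algebra `A₁` with generators `x₁`: there is a flat `ℂ[t^{±1/4}]`-algebra generated by elements
`y`, with generic fibre `A` (base change along `toKt`) and fibre `A₁` at `t^{1/4} = 1` (base change
along `atOne`), in which `y` becomes `x` and `x₁` respectively. -/
def IsFlatDeformation {σ A A₁ : Type} [CommRing A] [Algebra Kt A] (x : σ → A)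
    [CommRing A₁] [Algebra ℂ A₁] (x₁ : σ → A₁) : Prop :=
  ∃ (𝒜 : Type) (_ : CommRing 𝒜) (_ : Algebra Rt 𝒜) (y : σ → 𝒜),
    Algebra.adjoin Rt (Set.range y) = ⊤ ∧
    Module.Flat Rt 𝒜 ∧
    (letI : Algebra Rt Kt := toKt.toAlgebra
      ∃ e : Kt ⊗[Rt] 𝒜 ≃ₐ[Kt] A, ∀ i, e (1 ⊗ₜ y i) = x i) ∧
    (letI : Algebra Rt ℂ := atOne.toAlgebra
      ∃ e₁ : ℂ ⊗[Rt] 𝒜 ≃ₐ[ℂ] A₁, ∀ i, e₁ (1 ⊗ₜ y i) = x₁ i)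

end GenusTwo

/-!
At `q = 1` the elements `g_i` have integer coefficients in the single parameter
`τ = t^{1/2} + t^{-1/2}`, and their leading coefficients are `1`. All assertions come from
Buchberger's criterion in a form that needs no field: if the S-polynomials of a list of monic
polynomials over a commutative ring reduce to `0`, then the monomials divisible by no leading
monomial form a basis of the quotient ring (`eq_zero_of_mem_span_of_standard`,
`exists_standard_basis`).

The S-polynomials of the `g_i` reduce to `0` over `ℤ[τ]`, hence at once over `ℂ[t^{±1/4}]`,
`ℂ(t^{1/4})` and `ℂ`. The quotient `𝒜` of the polynomial ring over `ℂ[t^{±1/4}]` by the `g_i` is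
therefore free on the standard monomials; so are its base changes, with the images of its structure
constants as structure constants (`repr_mul_eq_map`, `exists_baseChange_algEquiv`). Only the
equality of the ideal of the `g_i` with that of the `J`-relations and the Casimir relation needs
more: the `g_i` are obtained from the relations by S-polynomials, some of which have to be divided by
`τ`, and twice the Casimir relator is `-2 τ g₄₉` modulo those obtained from the `J`-relations. So the two
ideals agree wherever `τ` is a unit (`span_relators`), which it is in `ℂ(t^{1/4})` and at
`t^{1/4} = 1`, where `τ = 2`.

The S-polynomials are reduced by computation inside the kernel. A monomial in the 15 symbols and `τ`
is packed into one natural number in such a way that products become sums and the monomial order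
becomes the order of numbers; pairs are skipped when their leading monomials are coprime or when the
pair is redundant in view of others. The soundness of this computation for every value of `τ` in
every commutative ring is `evalPacked_mem_of_reduces` and `pairsResolve_of_pairsOk`.
-/

namespace GenusTwo

/-! ### Buchberger's criterion over a commutative ring -/

section Criterion

open MvPolynomial MonomialOrder

variable {σ R : Type*} [CommRing R] (m : MonomialOrder σ)

/-- The span of the monomial multiples `x^u * g`, `g ∈ A`, whose leading exponent `u + deg g`
satisfies `P`. -/
noncomputable def multiplesSpan (A : List (MvPolynomial σ R)) (P : (σ →₀ ℕ) → Prop) :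
    Submodule R (MvPolynomial σ R) :=
  Submodule.span R {p | ∃ g ∈ A, ∃ u, P (u + m.degree g) ∧ p = monomial u 1 * g}

variable {m} {A : List (MvPolynomial σ R)}

theorem multiplesSpan_mono {P Q : (σ →₀ ℕ) → Prop} (h : ∀ s, P s → Q s) :
    multiplesSpan m A P ≤ multiplesSpan m A Q := by
  refine Submodule.span_mono ?_
  rintro p ⟨g, hg, u, hu, rfl⟩
  exact ⟨g, hg, u, h _ hu, rfl⟩

theorem monomial_mul_mem_multiplesSpan {P Q : (σ →₀ ℕ) → Prop} (w : σ →₀ ℕ) (r : R)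
    (h : ∀ s, P s → Q (w + s)) {p : MvPolynomial σ R} (hp : p ∈ multiplesSpan m A P) :
    monomial w r * p ∈ multiplesSpan m A Q := by
  induction hp using Submodule.span_induction with
  | mem p hp =>
    obtain ⟨g, hg, u, hu, rfl⟩ := hp
    have : monomial w r * (monomial u 1 * g) = r • (monomial (w + u) 1 * g) := by
      rw [← mul_assoc, monomial_mul, mul_one, ← smul_mul_assoc, smul_monomial, smul_eq_mul,
        mul_one]
    rw [this]
    refine Submodule.smul_mem _ _ (Submodule.subset_span ⟨g, hg, _, ?_, rfl⟩)
    rw [add_assoc]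
    exact h _ hu
  | zero => simp
  | add x y _ _ hx hy => rw [mul_add]; exact add_mem hx hy
  | smul c x _ hx => rw [mul_smul_comm]; exact Submodule.smul_mem _ _ hx

theorem mul_mem_multiplesSpan {P : (σ →₀ ℕ) → Prop} {g : MvPolynomial σ R} (hg : g ∈ A)
    (q : MvPolynomial σ R) (h : ∀ s ∈ q.support, P (s + m.degree g)) :
    q * g ∈ multiplesSpan m A P := by
  rw [q.as_sum, Finset.sum_mul]
  refine Submodule.sum_mem _ fun s hs => ?_
  have : monomial s (coeff s q) * g = coeff s q • (monomial s 1 * g) := by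
    rw [← smul_mul_assoc, smul_monomial, smul_eq_mul, mul_one]
  rw [this]
  exact Submodule.smul_mem _ _ (Submodule.subset_span ⟨g, hg, s, h s hs, rfl⟩)

/-- The S-polynomial of two monic polynomials; over a ring it is only meaningful for these, since
no leading coefficients are divided out. -/
noncomputable def sPair (m : MonomialOrder σ) (g h : MvPolynomial σ R) : MvPolynomial σ R :=
  monomial (m.degree h - m.degree g) 1 * g - monomial (m.degree g - m.degree h) 1 * h

/-- The S-polynomial of `g` and `h` is a combination of multiples of elements of `A` whose leading
monomials are smaller than the least common multiple of those of `g` and `h`. -/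
def Resolves (m : MonomialOrder σ) (A : List (MvPolynomial σ R)) (g h : MvPolynomial σ R) :
    Prop :=
  sPair m g h ∈ multiplesSpan m A fun s => s ≺[m] m.degree h - m.degree g + m.degree g

/-- For every `g` in the list and every `h` after it there is some `k` after `g` such that the pair
`(g, k)` resolves and the monomial `lcm(g, k) / lm(g)` divides `lcm(g, h) / lm(g)`. So among the
pairs `(g, h)`, `h` after `g`, only those need to resolve whose `lcm(g, h) / lm(g)` are minimal for
divisibility. -/
def PairsResolve (m : MonomialOrder σ) (A : List (MvPolynomial σ R)) :
    List (MvPolynomial σ R) → Prop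
  | [] => True
  | g :: t => (∀ h ∈ t, ∃ k ∈ t, m.degree k - m.degree g ≤ m.degree h - m.degree g ∧
      Resolves m A g k) ∧ PairsResolve m A t

theorem Resolves.sub_mem {g k : MvPolynomial σ R} (h : Resolves m A g k) {s u v : σ →₀ ℕ}
    (hu : u + m.degree g = s) (hv : v + m.degree k = s) :
    monomial u 1 * g - monomial v 1 * k ∈ multiplesSpan m A fun a => a ≺[m] s := by
  -- `x^w` is the cofactor by which `x^s` exceeds the least common multiple
  obtain ⟨w, rfl⟩ : ∃ w, u = w + (m.degree k - m.degree g) := by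
    refine ⟨u - (m.degree k - m.degree g), (tsub_add_cancel_of_le ?_).symm⟩
    rw [tsub_le_iff_right, hu, ← hv]
    exact le_add_self
  have hv' : v = w + (m.degree g - m.degree k) := by
    have : v + m.degree k = w + (m.degree g - m.degree k) + m.degree k := by
      rw [hv, ← hu]
      ext i
      simp only [Finsupp.add_apply, Finsupp.tsub_apply]
      omega
    exact add_right_cancel this
  have hm : monomial (w + (m.degree k - m.degree g)) 1 * g - monomial v 1 * k
      = monomial w 1 * sPair m g k := by
    rw [hv', sPair, mul_sub, ← mul_assoc, ← mul_assoc, monomial_mul, monomial_mul, one_mul]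
  rw [hm]
  refine monomial_mul_mem_multiplesSpan w 1 (fun a ha => ?_) h
  rw [← hu, add_assoc, map_add, map_add m.toSyn w]
  gcongr

/-- Modulo multiples with smaller leading monomial, all multiples with leading exponent `s` of
elements of the list agree; if there are any, the common representative `p` is one of them, and
`p = 0` otherwise. -/
theorem PairsResolve.exists_representative {l : List (MvPolynomial σ R)} (hl : PairsResolve m A l)
    (s : σ →₀ ℕ) : ∃ p : MvPolynomial σ R,
      (p = 0 ∨ ∃ g ∈ l, ∃ u, u + m.degree g = s ∧ p = monomial u 1 * g) ∧
      ∀ g ∈ l, ∀ u, u + m.degree g = s →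
        monomial u 1 * g - p ∈ multiplesSpan m A fun a => a ≺[m] s := by
  induction l with
  | nil => exact ⟨0, Or.inl rfl, by simp⟩
  | cons g t ih =>
    obtain ⟨hg, ht⟩ := hl
    obtain ⟨p, hp, hpt⟩ := ih ht
    by_cases hgs : m.degree g ≤ s
    swap
    · refine ⟨p, hp.imp_right ?_, ?_⟩
      · rintro ⟨k, hk, u, hu⟩
        exact ⟨k, List.mem_cons_of_mem _ hk, u, hu⟩
      · intro k hk u hu
        rcases List.mem_cons.1 hk with rfl | hk
        · exact absurd (hu ▸ le_add_self) hgs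
        · exact hpt k hk u hu
    -- if some later element has a multiple at `s`, a pair `(g, k')` links the multiple of `g` to it
    by_cases hts : ∃ h ∈ t, m.degree h ≤ s
    · refine ⟨p, hp.imp_right ?_, ?_⟩
      · rintro ⟨k, hk, u, hu⟩
        exact ⟨k, List.mem_cons_of_mem _ hk, u, hu⟩
      · intro k hk u hu
        rcases List.mem_cons.1 hk with rfl | hk
        swap
        · exact hpt k hk u hu
        obtain ⟨h, hht, hhs⟩ := hts
        obtain ⟨k', hk', hle, hres⟩ := hg h hht
        have hk's : m.degree k' ≤ s := by
          have h1 : m.degree h - m.degree k ≤ u := by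
            rw [tsub_le_iff_right, hu]; exact hhs
          have h2 : m.degree k' ≤ u + m.degree k := tsub_le_iff_right.1 (hle.trans h1)
          rwa [hu] at h2
        have hv : s - m.degree k' + m.degree k' = s := tsub_add_cancel_of_le hk's
        have := add_mem (hres.sub_mem hu hv) (hpt k' hk' _ hv)
        simpa using this
    · refine ⟨monomial (s - m.degree g) 1 * g, Or.inr ⟨g, by simp, _,
        tsub_add_cancel_of_le hgs, rfl⟩, ?_⟩
      intro k hk u hu
      rcases List.mem_cons.1 hk with rfl | hk
      · have : u = s - m.degree k := by rw [← hu, add_tsub_cancel_right]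
        rw [this, sub_self]
        exact zero_mem _
      · exact absurd ⟨k, hk, hu ▸ le_add_self⟩ hts

theorem coeff_eq_zero_of_mem_multiplesSpan {s : σ →₀ ℕ} {f : MvPolynomial σ R}
    (hf : f ∈ multiplesSpan m A fun a => a ≺[m] s) : coeff s f = 0 := by
  induction hf using Submodule.span_induction with
  | mem p hp =>
    obtain ⟨g, hg, u, hu, rfl⟩ := hp
    refine m.coeff_eq_zero_of_lt (lt_of_le_of_lt ?_ hu)
    refine (degree_mul_le (m := m)).trans ?_
    rw [map_add, map_add]
    gcongr
    exact degree_monomial_le _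
  | zero => simp
  | add x y _ _ hx hy => rw [coeff_add, hx, hy, add_zero]
  | smul c x _ hx => rw [coeff_smul, hx, smul_zero]

/-- Only finitely many multiples occur in a combination, so the bound `P` can be replaced by a
largest leading exponent. -/
theorem exists_le_of_mem_multiplesSpan {P : (σ →₀ ℕ) → Prop} {f : MvPolynomial σ R}
    (hf : f ∈ multiplesSpan m A P) :
    f = 0 ∨ ∃ s, P s ∧ f ∈ multiplesSpan m A fun a => a ≼[m] s := by
  induction hf using Submodule.span_induction with
  | mem p hp =>
    obtain ⟨g, hg, u, hu, rfl⟩ := hp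
    exact Or.inr ⟨_, hu, Submodule.subset_span ⟨g, hg, u, le_rfl, rfl⟩⟩
  | zero => exact Or.inl rfl
  | add x y _ _ hx hy =>
    rcases hx with rfl | ⟨a, ha, hxa⟩
    · simpa using hy
    rcases hy with rfl | ⟨b, hb, hyb⟩
    · simpa using Or.inr ⟨a, ha, hxa⟩
    rcases le_total (m.toSyn a) (m.toSyn b) with hab | hab
    · exact Or.inr ⟨b, hb, add_mem (multiplesSpan_mono (fun _ h => le_trans h hab) hxa) hyb⟩
    · exact Or.inr ⟨a, ha, add_mem hxa (multiplesSpan_mono (fun _ h => le_trans h hab) hyb)⟩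
  | smul c x _ hx =>
    rcases hx with rfl | ⟨a, ha, hxa⟩
    · simp
    · exact Or.inr ⟨a, ha, Submodule.smul_mem _ _ hxa⟩

/-- Well-founded induction on the largest leading exponent `s` of the multiples of which `f` is a
combination: their sum is `c` times one multiple, plus smaller ones, and `c`, the coefficient of `f`
at the nonstandard monomial `x^s`, vanishes. -/
theorem eq_zero_of_mem_multiplesSpan_le (hA : ∀ g ∈ A, m.Monic g) (hl : PairsResolve m A A)
    (s : σ →₀ ℕ) {f : MvPolynomial σ R} (hf : f ∈ multiplesSpan m A fun a => a ≼[m] s)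
    (hstd : ∀ a ∈ f.support, ∀ g ∈ A, ¬ m.degree g ≤ a) : f = 0 := by
  induction hs : m.toSyn s using WellFoundedLT.induction generalizing s f with
  | ind b ih =>
  subst hs
  obtain ⟨p, hp, hpA⟩ := hl.exists_representative s
  have key : ∃ c : R, f - c • p ∈ multiplesSpan m A fun a => a ≺[m] s := by
    clear hstd ih
    induction hf using Submodule.span_induction with
    | mem f hf =>
      obtain ⟨g, hg, u, hu, rfl⟩ := hf
      rcases hu.lt_or_eq with hu | hu
      · refine ⟨0, ?_⟩
        rw [zero_smul, sub_zero]
        exact Submodule.subset_span ⟨g, hg, u, hu, rfl⟩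
      · exact ⟨1, by simpa using hpA g hg u (m.toSyn.injective hu)⟩
    | zero => exact ⟨0, by simp⟩
    | add x y _ _ hx hy =>
      obtain ⟨c, hc⟩ := hx
      obtain ⟨e, he⟩ := hy
      refine ⟨c + e, ?_⟩
      have := add_mem hc he
      rwa [sub_add_sub_comm, ← add_smul] at this
    | smul r x _ hx =>
      obtain ⟨c, hc⟩ := hx
      refine ⟨r * c, ?_⟩
      rw [mul_smul, ← smul_sub]
      exact Submodule.smul_mem _ _ hc
  obtain ⟨c, hc⟩ := key
  have hfs : f ∈ multiplesSpan m A fun a => a ≺[m] s := by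
    rcases hp with rfl | ⟨g, hg, u, hu, rfl⟩
    · simpa using hc
    -- `g` is monic, so that `c` is the coefficient of `x^s` in `f`
    have h1 : coeff s (monomial u 1 * g) = 1 := by
      rw [← hu, coeff_monomial_mul, one_mul]
      exact hA g hg
    have h2 := coeff_eq_zero_of_mem_multiplesSpan hc
    rw [coeff_sub, coeff_smul, h1, smul_eq_mul, mul_one, sub_eq_zero] at h2
    have h3 : coeff s f = 0 := by
      by_contra hne
      exact hstd s (mem_support_iff.2 hne) g hg (hu ▸ le_add_self)
    rw [← h2, h3] at hc
    simpa using hc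
  rcases exists_le_of_mem_multiplesSpan hfs with h0 | ⟨s', hs', hf'⟩
  · exact h0
  · exact ih _ hs' s' hf' hstd rfl

/-- Diamond lemma: if enough S-polynomials resolve, the zero polynomial is the only element of the
ideal all of whose monomials are standard. -/
theorem eq_zero_of_mem_span_of_standard (hA : ∀ g ∈ A, m.Monic g) (hl : PairsResolve m A A)
    {f : MvPolynomial σ R} (hf : f ∈ Ideal.span {g | g ∈ A})
    (hstd : ∀ a ∈ f.support, ∀ g ∈ A, ¬ m.degree g ≤ a) : f = 0 := by
  have h1 : f ∈ multiplesSpan m A fun _ => True := by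
    clear hstd
    induction hf using Submodule.span_induction with
    | mem g hg =>
      exact Submodule.subset_span ⟨g, hg, 0, trivial, by
        rw [← C_apply, C_1, one_mul]⟩
    | zero => exact zero_mem _
    | add x y _ _ hx hy => exact add_mem hx hy
    | smul q x _ hx =>
      rw [smul_eq_mul, q.as_sum, Finset.sum_mul]
      exact Submodule.sum_mem _ fun w _ =>
        monomial_mul_mem_multiplesSpan w _ (fun _ _ => trivial) hx
  rcases exists_le_of_mem_multiplesSpan h1 with h0 | ⟨s, -, hs⟩
  · exact h0
  · exact eq_zero_of_mem_multiplesSpan_le hA hl s hs hstd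

theorem lt_degree_of_mem_support_tail {g : MvPolynomial σ R} (hg : m.Monic g) {s : σ →₀ ℕ}
    (hs : s ∈ (g - monomial (m.degree g) 1).support) : s ≺[m] m.degree g := by
  classical
  have hne : s ≠ m.degree g := by
    rintro rfl
    rw [mem_support_iff, coeff_sub, coeff_monomial, if_pos rfl, hg.coeff_degree, sub_self] at hs
    exact hs rfl
  rw [mem_support_iff, coeff_sub, coeff_monomial, if_neg hne.symm, sub_zero] at hs
  exact lt_of_le_of_ne (m.le_degree (mem_support_iff.2 hs)) fun h => hne (m.toSyn.injective h)

/-- A pair with coprime leading monomials resolves: with `g = x^a + g'` and `h = x^b + h'`, its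
S-polynomial is `g' h - h' g`. -/
theorem resolves_of_coprime {g h : MvPolynomial σ R} (hg : g ∈ A) (hh : h ∈ A)
    (hgm : m.Monic g) (hhm : m.Monic h) (hco : m.degree h - m.degree g = m.degree h) :
    Resolves m A g h := by
  have hco' : m.degree g - m.degree h = m.degree g := by
    ext i
    have := DFunLike.congr_fun hco i
    simp only [Finsupp.tsub_apply] at this ⊢
    omega
  have key : sPair m g h
      = (g - monomial (m.degree g) 1) * h - (h - monomial (m.degree h) 1) * g := by
    rw [sPair, hco, hco']
    ring
  rw [Resolves, key, hco]
  refine sub_mem (mul_mem_multiplesSpan hh _ fun s hs => ?_)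
    (mul_mem_multiplesSpan hg _ fun s hs => ?_)
  · rw [add_comm (m.degree h), map_add, map_add]
    exact add_lt_add_left (lt_degree_of_mem_support_tail hgm hs) _
  · rw [map_add, map_add]
    exact add_lt_add_left (lt_degree_of_mem_support_tail hhm hs) _

end Criterion

/-! ### Bases of standard monomials, structure constants, base change -/

section Consequences

open MvPolynomial MonomialOrder

variable {σ R : Type*} [CommRing R] {m : MonomialOrder σ} {A : List (MvPolynomial σ R)}

/-- The monomials divisible by no leading monomial of `A` form a basis of the quotient, over any
commutative ring: they span by division with remainder by the monic elements of `A`, and are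
independent by the diamond lemma. -/
theorem exists_standard_basis (hA : ∀ g ∈ A, m.Monic g) (hl : PairsResolve m A A)
    {S : Set (σ →₀ ℕ)} (hS : ∀ s, s ∈ S ↔ ∀ g ∈ A, ¬ m.degree g ≤ s)
    {I : Ideal (MvPolynomial σ R)} (hI : I = Ideal.span {g | g ∈ A}) :
    ∃ b : Module.Basis S R (MvPolynomial σ R ⧸ I),
      ∀ s, b s = Ideal.Quotient.mk I (monomial s.1 1) := by
  have hmk (c : S →₀ R) : Finsupp.linearCombination R
      (fun s : S => Ideal.Quotient.mk I (monomial s.1 (1 : R))) c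
      = Ideal.Quotient.mk I (c.sum fun s r => monomial s.1 r) := by
    rw [Finsupp.linearCombination_apply, map_finsuppSum]
    refine Finsupp.sum_congr fun s _ => ?_
    rw [← Ideal.Quotient.mkₐ_eq_mk R, ← map_smul, smul_monomial, smul_eq_mul, mul_one]
  have hli : LinearIndependent R fun s : S => Ideal.Quotient.mk I (monomial s.1 (1 : R)) := by
    classical
    rw [linearIndependent_iff]
    intro c hc
    rw [hmk, Ideal.Quotient.eq_zero_iff_mem, hI] at hc
    have hcoeff (s : S) : coeff s.1 (c.sum fun s r => monomial s.1 r) = c s := by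
      rw [Finsupp.sum, coeff_sum, Finset.sum_eq_single s]
      · rw [coeff_monomial, if_pos rfl]
      · intro t _ hts
        rw [coeff_monomial, if_neg fun h => hts (Subtype.ext h)]
      · intro h
        rw [coeff_monomial, if_pos rfl, Finsupp.notMem_support_iff.1 h]
    have h0 := eq_zero_of_mem_span_of_standard hA hl hc (fun a ha => by
      have ha' := support_sum ha
      rw [Finset.mem_biUnion] at ha'
      obtain ⟨s, -, hs⟩ := ha'
      have := support_monomial_subset hs
      rw [Finset.mem_singleton] at this
      exact this ▸ (hS s.1).1 s.2)
    ext s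
    rw [← hcoeff, h0, coeff_zero, Finsupp.zero_apply]
  refine ⟨Module.Basis.mk hli ?_, fun s => by rw [Module.Basis.mk_apply]⟩
  intro x _
  obtain ⟨f, rfl⟩ := Ideal.Quotient.mk_surjective x
  obtain ⟨q, r, hf, -, hr⟩ := m.div_set (B := {g | g ∈ A})
    (fun g hg => by rw [(hA g hg).leadingCoeff_eq_one]; exact isUnit_one) f
  have hq : Finsupp.linearCombination _ (fun b : {g | g ∈ A} => (b : MvPolynomial σ R)) q ∈ I := by
    rw [hI, Finsupp.linearCombination_apply]
    refine Submodule.sum_mem _ fun g _ => ?_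
    exact Ideal.mul_mem_left _ _ (Ideal.subset_span g.2)
  rw [hf, map_add, Ideal.Quotient.eq_zero_iff_mem.2 hq, zero_add, r.as_sum, map_sum]
  refine Submodule.sum_mem _ fun s hs => ?_
  have : Ideal.Quotient.mk I (monomial s (coeff s r))
      = coeff s r • Ideal.Quotient.mk I (monomial s 1) := by
    rw [← Ideal.Quotient.mkₐ_eq_mk R, ← map_smul, smul_monomial, smul_eq_mul, mul_one]
  rw [this]
  exact Submodule.smul_mem _ _ (Submodule.subset_span
    ⟨⟨s, (hS s).2 fun g hg => hr s hs g hg⟩, rfl⟩)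

/-- Structure constants in bases of monomials are compatible with change of coefficients. -/
theorem repr_mul_eq_map {R' : Type*} [CommRing R'] (φ : R →+* R') {S : Set (σ →₀ ℕ)}
    {I : Ideal (MvPolynomial σ R)} {I' : Ideal (MvPolynomial σ R')} (hI : I.map (map φ) ≤ I')
    (b : Module.Basis S R (MvPolynomial σ R ⧸ I))
    (hb : ∀ s, b s = Ideal.Quotient.mk I (monomial s.1 1))
    (b' : Module.Basis S R' (MvPolynomial σ R' ⧸ I'))
    (hb' : ∀ s, b' s = Ideal.Quotient.mk I' (monomial s.1 1)) (s₁ s₂ s₃ : S) :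
    b'.repr (b' s₁ * b' s₂) s₃ = φ (b.repr (b s₁ * b s₂) s₃) := by
  classical
  let Φ : MvPolynomial σ R ⧸ I →+* MvPolynomial σ R' ⧸ I' :=
    Ideal.quotientMap I' (map φ) (Ideal.map_le_iff_le_comap.1 hI)
  have hΦb (s : S) : Φ (b s) = b' s := by
    rw [hb, hb', Ideal.quotientMap_mk, map_monomial, map_one]
  have hΦs (r : R) (x : MvPolynomial σ R ⧸ I) : Φ (r • x) = φ r • Φ x := by
    obtain ⟨f, rfl⟩ := Ideal.Quotient.mk_surjective x
    rw [← Ideal.Quotient.mkₐ_eq_mk R, ← map_smul, Ideal.Quotient.mkₐ_eq_mk, Ideal.quotientMap_mk,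
      Ideal.quotientMap_mk, smul_eq_C_mul, map_mul, map_C, ← smul_eq_C_mul,
      ← Ideal.Quotient.mkₐ_eq_mk R', map_smul]
  have h1 : b' s₁ * b' s₂ = ∑ s ∈ (b.repr (b s₁ * b s₂)).support,
      φ (b.repr (b s₁ * b s₂) s) • b' s := by
    rw [← hΦb, ← hΦb, ← map_mul]
    conv_lhs => rw [← b.linearCombination_repr (b s₁ * b s₂), Finsupp.linearCombination_apply,
      Finsupp.sum, map_sum]
    simp only [hΦs, hΦb]
  rw [h1, map_sum, Finsupp.finsetSum_apply]
  simp only [map_smul, Finsupp.smul_apply, b'.repr_self, Finsupp.single_apply, smul_eq_mul,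
    mul_ite, mul_one, mul_zero]
  rw [Finset.sum_ite_eq']
  split_ifs with h
  · rfl
  · rw [Finsupp.notMem_support_iff.1 h, map_zero]

/-- Division of an element of the ideal leaves a standard remainder, which is `0` by the diamond
lemma; hence the leading monomial of the element is divisible by that of a divisor. -/
theorem isGroebnerBasis_of_pairsResolve {K : Type*} [Field K] {A : List (MvPolynomial σ K)}
    (hA : ∀ g ∈ A, m.Monic g) (hl : PairsResolve m A A) :
    IsGroebnerBasis m {g | g ∈ A} (Ideal.span {g | g ∈ A}) := by
  refine ⟨Ideal.subset_span, le_antisymm (Ideal.span_mono (Set.image_mono Ideal.subset_span)) ?_⟩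
  rw [Ideal.span_le]
  rintro _ ⟨f, hf, rfl⟩
  rcases eq_or_ne f 0 with rfl | hf0
  · rw [leadingTerm_zero]; exact zero_mem _
  obtain ⟨q, r, hfr, hdeg, hr⟩ := m.div_set (B := {g | g ∈ A})
    (fun g hg => by rw [(hA g hg).leadingCoeff_eq_one]; exact isUnit_one) f
  have hq : Finsupp.linearCombination _ (fun b : {g | g ∈ A} => (b : MvPolynomial σ K)) q
      ∈ Ideal.span {g | g ∈ A} := by
    rw [Finsupp.linearCombination_apply]
    exact Submodule.sum_mem _ fun g _ => Ideal.mul_mem_left _ _ (Ideal.subset_span g.2)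
  have hr0 : r = 0 := by
    refine eq_zero_of_mem_span_of_standard hA hl ?_ hr
    have : r = f - Finsupp.linearCombination _
        (fun b : {g | g ∈ A} => (b : MvPolynomial σ K)) q := by
      rw [hfr]; ring
    rw [this]
    exact sub_mem hf hq
  -- some summand of `f = ∑ g * q g` contains the leading monomial of `f`
  have hex : ∃ g : {g | g ∈ A}, coeff (m.degree f) (g.1 * q g) ≠ 0 := by
    by_contra! hall
    have hf' := m.coeff_degree_ne_zero_iff.2 hf0
    generalize m.degree f = d at hall hf'
    refine hf' ?_
    rw [hfr, hr0, add_zero, Finsupp.linearCombination_apply, Finsupp.sum, coeff_sum]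
    refine Finset.sum_eq_zero fun g _ => ?_
    rw [smul_eq_mul, mul_comm]
    exact hall g
  obtain ⟨g, hg⟩ := hex
  have heq : m.degree (g.1 * q g) = m.degree f :=
    m.toSyn.injective (le_antisymm (hdeg g) (m.le_degree (mem_support_iff.2 hg)))
  have hne : g.1 * q g ≠ 0 := fun h => hg (by rw [h, coeff_zero])
  have hle : m.degree g.1 ≤ m.degree f := by
    rw [← heq, degree_mul (left_ne_zero_of_mul hne) (right_ne_zero_of_mul hne)]
    exact le_self_add
  have : m.leadingTerm f = monomial (m.degree f - m.degree g.1) (m.leadingCoeff f)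
      * m.leadingTerm g.1 := by
    rw [leadingTerm, leadingTerm, (hA _ g.2).leadingCoeff_eq_one, monomial_mul,
      tsub_add_cancel_of_le hle, mul_one]
  rw [this]
  exact Ideal.mul_mem_left _ _ (Ideal.subset_span ⟨g.1, g.2, rfl⟩)

/-- Base change of a quotient of a polynomial ring is the quotient by the extended ideal. -/
theorem exists_baseChange_algEquiv {K : Type*} [CommRing K] [Algebra R K]
    (I : Ideal (MvPolynomial σ R)) {I' : Ideal (MvPolynomial σ K)}
    (hI : I.map (map (algebraMap R K)) = I') :
    ∃ e : K ⊗[R] (MvPolynomial σ R ⧸ I) ≃ₐ[K] MvPolynomial σ K ⧸ I',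
      ∀ i, e (1 ⊗ₜ Ideal.Quotient.mk I (X i)) = Ideal.Quotient.mk I' (X i) := by
  subst hI
  let J : Ideal (K ⊗[R] MvPolynomial σ R) :=
    I.map (Algebra.TensorProduct.includeRight : MvPolynomial σ R →ₐ[R] K ⊗[R] MvPolynomial σ R)
  let e₁ : K ⊗[R] (MvPolynomial σ R ⧸ I) ≃ₐ[K] (K ⊗[R] MvPolynomial σ R) ⧸ J :=
    Algebra.TensorProduct.tensorQuotientEquiv (R := R) K (MvPolynomial σ R) K I
  let e₂ : K ⊗[R] MvPolynomial σ R ≃ₐ[K] MvPolynomial σ K := algebraTensorAlgEquiv R K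
  have hJ : I.map (map (algebraMap R K)) = J.map (e₂ : K ⊗[R] MvPolynomial σ R →+* _) := by
    have : map (algebraMap R K) = (e₂ : K ⊗[R] MvPolynomial σ R →+* MvPolynomial σ K).comp
        ((Algebra.TensorProduct.includeRight :
          MvPolynomial σ R →ₐ[R] K ⊗[R] MvPolynomial σ R) : MvPolynomial σ R →+* _) := by
      refine RingHom.ext fun p => ?_
      change _ = e₂ (1 ⊗ₜ p)
      rw [algebraTensorAlgEquiv_tmul, one_smul]
    rw [this, ← Ideal.map_map]
    rfl
  refine ⟨e₁.trans (Ideal.quotientEquivAlg J _ e₂ hJ), fun i => ?_⟩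
  change Ideal.Quotient.mk _ (e₂ (1 ⊗ₜ X i)) = _
  rw [algebraTensorAlgEquiv_tmul, one_smul, map_X]

end Consequences

/-! ### Arithmetic of polynomials with monomials packed into numbers -/

noncomputable section PackedArithmetic

/-- The exponents of `O₁, …, O₃₄₅` in the monomial with key `k`, as the base-256 digits of one
number `E`. The key of a monomial `τ^j O^e` of weighted degree `W` is `256 (2^120 W - E) + j`: keys
of monomials add up under multiplication, their order is the weighted degree reverse lexicographic
order, with powers of `τ` breaking ties, and multiplication of `2^120 W - E` by `-1` modulo `2^120`
recovers `E`. -/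
def expo (k : ℕ) : ℕ :=
  Nat.mod (Nat.mul (Nat.div k 256) 0xffffffffffffffffffffffffffffff)
    0x1000000000000000000000000000000

/-- Whether the first 15 base-256 digits of `e` are all less than 128. -/
def smallDigits (e : ℕ) : Bool := Nat.beq (Nat.land e 0x808080808080808080808080808080) 0

/-- Whether all exponents of the monomial with key `k`, that of `τ` included, are less than 128, so
that adding two such keys causes no carries between exponents. -/
def small (k : ℕ) : Bool := smallDigits (expo k) && Nat.blt (Nat.mod k 256) 128

/-- The key of the `i`-th symbol; the symbol with number 15 is `τ`. -/
def varKey (i : ℕ) : ℕ :=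
  bif Nat.blt i 15 then
    256 * ((bif Nat.blt i 6 then 2 else bif Nat.blt i 12 then 3 else 4)
      * 0x1000000000000000000000000000000 - Nat.pow 256 i)
  else 1

/-- The key of a product of symbols. -/
def monKey (l : List ℕ) : ℕ := List.rec 0 (fun i _ ih => Nat.add (varKey i) ih) l

/-- A polynomial with integer coefficients in the 15 symbols and `τ`: a list of pairs of a key and a
coefficient. The arithmetic below produces lists with strictly decreasing keys from such lists, but
its soundness does not depend on the order. -/
abbrev Packed : Type := List (ℕ × ℤ)

/-- A polynomial with leading coefficient `1`: the key of the leading monomial, and the tail. -/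
abbrev PackedElem : Type := ℕ × Packed

/-- Insert the term `x` into the list `s`, and continue with `f` on the part of `s` after it. The
eliminators of `List`, `Bool`, `Int` and `Nat` are used directly, here and below, because the kernel
evaluates them faster than compiled pattern matching. -/
def insertTerm (x : ℕ × ℤ) (f : Packed → Packed) (s : Packed) : Packed :=
  List.rec (x :: f [])
    (fun y t ih => Bool.rec
      (Bool.rec
        (Int.rec (fun n => Nat.rec (f t) (fun n _ => (x.1, Int.ofNat (Nat.succ n)) :: f t) n)
          (fun n => (x.1, Int.negSucc n) :: f t) (Int.add x.2 y.2))
        (x :: f (y :: t)) (Nat.blt y.1 x.1))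
      (y :: ih) (Nat.blt x.1 y.1)) s

/-- The sum of two packed polynomials. -/
def merge (s : Packed) : Packed → Packed := List.rec (fun t => t) (fun x _ ih => insertTerm x ih) s

/-- The product with the term `c` times the monomial with key `u`. -/
def scale (u : ℕ) (c : ℤ) (s : Packed) : Packed :=
  List.rec [] (fun x _ ih => (Nat.add u x.1, Int.mul c x.2) :: ih) s

/-- Search `gs` for an element whose leading monomial divides the monomial with key `k`, with
cofactor key `u` such that `ok u`, and such that `f u s` succeeds for its tail `s`. -/
def withDivisor (ok : ℕ → Bool) (k : ℕ) (f : ℕ → Packed → Bool) (gs : List PackedElem) : Bool :=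
  List.rec false (fun g _ ih =>
    Bool.rec ih (Bool.rec ih (f (Nat.sub k g.1) g.2) (ok (Nat.sub k g.1))) (Nat.ble g.1 k)) gs

/-- Whether `p` is reduced to `0` in at most `n - 1` steps that cancel the first term of the list by
a multiple of an element of `gs`. -/
def reduces (gs : List PackedElem) (n : ℕ) : Packed → Bool :=
  Nat.rec (fun _ => false)
    (fun _ ih p => List.rec true (fun x t _ =>
      withDivisor small x.1 (fun u s => ih (merge t (scale u (Int.neg x.2) s))) gs) p) n

/-- Truncated difference, digit by digit, of the first `n` base-256 digits of two numbers. -/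
def quotExpo (n : ℕ) : ℕ → ℕ → ℕ :=
  Nat.rec (fun _ _ => 0) (fun _ ih a b =>
    Nat.add (Nat.sub (Nat.mod a 256) (Nat.mod b 256))
      (Nat.mul 256 (ih (Nat.div a 256) (Nat.div b 256)))) n

/-- Sum of the base-256 digits of a number, with weights. -/
def digitSum (ws : List ℕ) : ℕ → ℕ :=
  List.rec (fun _ => 0) (fun w _ ih e =>
    Nat.add (Nat.mul w (Nat.mod e 256)) (ih (Nat.div e 256))) ws

/-- The weights of the 15 symbols. -/
def weights : List ℕ := [2, 2, 2, 2, 2, 2, 3, 3, 3, 3, 3, 3, 4, 4, 4]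

/-- The key of the monomial with digits `e`, free of `τ`. -/
def expoKey (e : ℕ) : ℕ :=
  Nat.mul 256 (Nat.sub (Nat.mul (digitSum weights e) 0x1000000000000000000000000000000) e)

/-- The key of `lcm(g, h) / lm(g)`. -/
def cofactorKey (g h : PackedElem) : ℕ := expoKey (quotExpo 15 (expo h.1) (expo g.1))

/-- The S-polynomial, formed from the tails since the leading terms cancel. -/
def spoly (g h : PackedElem) : Packed :=
  merge (scale (cofactorKey g h) 1 g.2) (scale (cofactorKey h g) (-1) h.2)

/-- Whether `cofactorKey g h` decodes to the exponents of `lcm(g, h) / lm(g)`. -/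
def cofactorOk (g h : PackedElem) : Bool :=
  Nat.beq (expo (cofactorKey g h)) (quotExpo 15 (expo h.1) (expo g.1)) && small (cofactorKey g h)

/-- Whether the monomial with key `k` is smaller than that with key `l`, powers of `τ` being
disregarded. -/
def keyLt (k l : ℕ) : Bool :=
  Nat.blt (digitSum weights (expo k)) (digitSum weights (expo l)) ||
    (Nat.beq (digitSum weights (expo k)) (digitSum weights (expo l)) && Nat.blt (expo l) (expo k))

/-- Whether all terms have small exponents and are smaller than the monomial with key `l`. -/
def termsOk (l : ℕ) (s : Packed) : Bool :=
  List.rec true (fun x _ ih => small x.1 && keyLt x.1 l && ih) s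

/-- Whether the first monomial of `g` is its leading monomial, and free of `τ`. -/
def elemOk (g : PackedElem) : Bool :=
  small g.1 && Nat.beq (Nat.mod g.1 256) 0 && termsOk g.1 g.2

/-- Whether the list `qs` of digits of cofactors `lcm(g, k) / lm(g)`, each with the key of `lm(k)`,
shows that the pair `(g, h)` may be left out: `q` are the digits of `lcm(g, h) / lm(g)`, `l` is the
key of `lm(h)`, and some member of `qs` divides `q` properly, or equals `q` and has a smaller key.
-/
def redundant (q l : ℕ) (qs : List (ℕ × ℕ)) : Bool :=
  List.rec false (fun x _ ih => (Nat.ble x.1 q && smallDigits (Nat.sub q x.1) &&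
    (Nat.blt x.1 q || Nat.blt x.2 l)) || ih) qs

/-- The digits of `lcm(g, h) / lm(g)` and the key of `lm(h)`, for all `h` in a list. -/
def quotients (g : PackedElem) (t : List PackedElem) : List (ℕ × ℕ) :=
  List.rec [] (fun h _ ih => (quotExpo 15 (expo h.1) (expo g.1), h.1) :: ih) t

/-- Whether the pair `(g, h)` is redundant in view of `qs`, has coprime leading monomials, or has an
S-polynomial that reduces to `0`. -/
def pairOk (gs : List PackedElem) (g h : PackedElem) (qs : List (ℕ × ℕ)) : Bool :=
  redundant (quotExpo 15 (expo h.1) (expo g.1)) h.1 qs ||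
    Nat.beq (quotExpo 15 (expo h.1) (expo g.1)) (expo h.1) ||
    (cofactorOk g h && cofactorOk h g && reduces gs 1000 (spoly g h))

/-- `pairOk` for `g` and all elements of `t`. -/
def pairsOkWith (gs : List PackedElem) (g : PackedElem) (qs : List (ℕ × ℕ))
    (t : List PackedElem) : Bool :=
  List.rec true (fun h _ ih => pairOk gs g h qs && ih) t

/-- Whether all pairs of elements of `t` satisfy `pairOk`, with redundancy judged by the elements
after the first member of the pair. -/
def pairsOk (gs : List PackedElem) (t : List PackedElem) : Bool :=
  List.rec true (fun g t ih => pairsOkWith gs g (quotients g t) t && ih) t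

/-- Pack a polynomial given by coefficients and words in the numbers of the symbols. -/
def packTerms : List (ℤ × List ℕ) → Packed
  | [] => []
  | (c, l) :: p => (monKey l, c) :: packTerms p

/-- Pack a polynomial whose first term is its leading term, with coefficient `1`. -/
def packElem : List (ℤ × List ℕ) → PackedElem
  | [] => (0, [])
  | (_, l) :: p => (monKey l, packTerms p)

end PackedArithmetic

/-! ### The specialized elements as data, and the computations -/

section Data

/-! The numbers of the 15 symbols and of `τ`. -/

abbrev o1 : ℕ := 0
abbrev o2 : ℕ := 1
abbrev o3 : ℕ := 2
abbrev o4 : ℕ := 3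
abbrev o5 : ℕ := 4
abbrev o6 : ℕ := 5
abbrev o12 : ℕ := 6
abbrev o23 : ℕ := 7
abbrev o34 : ℕ := 8
abbrev o45 : ℕ := 9
abbrev o56 : ℕ := 10
abbrev o61 : ℕ := 11
abbrev o123 : ℕ := 12
abbrev o234 : ℕ := 13
abbrev o345 : ℕ := 14
abbrev τ : ℕ := 15

set_option maxHeartbeats 2000000 in
/-- The polynomials `g_i` at `q = 1`, with `τ` for `t^{1/2} + t^{-1/2}`: each is a list of
coefficients and words, with decreasing monomials. -/
def gData : List (List (ℤ × List ℕ)) :=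
  [
   [(1, [o56, o61]), (-1, [o6, o234]), (-1, [o1, o5]), (1, [τ, o3])],
   [(1, [o12, o61]), (-1, [o1, o345]), (-1, [o2, o6]), (1, [τ, o4])],
   [(1, [o45, o56]), (-1, [o5, o123]), (-1, [o4, o6]), (1, [τ, o2])],
   [(1, [o34, o45]), (-1, [o4, o345]), (-1, [o3, o5]), (1, [τ, o1])],
   [(1, [o23, o34]), (-1, [o3, o234]), (-1, [o2, o4]), (1, [τ, o6])],
   [(1, [o12, o23]), (-1, [o2, o123]), (-1, [o1, o3]), (1, [τ, o5])],
   [(1, [o3, o4, o5]), (-1, [o1, o2, o6]), (1, [o6, o12]), (-1, [o5, o34]), (-1, [o3, o45]),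
     (1, [o2, o61])],
   [(1, [o2, o3, o4]), (-1, [o1, o5, o6]), (-1, [o4, o23]), (-1, [o2, o34]), (1, [o1, o56]),
     (1, [o5, o61])],
   [(1, [o1, o2, o3]), (-1, [o4, o5, o6]), (-1, [o3, o12]), (-1, [o1, o23]), (1, [o6, o45]),
     (1, [o4, o56])],
   [(1, [o56, o345]), (-1, [o5, o12]), (-1, [o6, o34]), (1, [τ, o2, o3]), (-1, [τ, o23])],
   [(1, [o23, o345]), (-1, [o2, o45]), (-1, [o3, o61]), (1, [τ, o5, o6]), (-1, [τ, o56])],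
   [(1, [o45, o234]), (-1, [o5, o23]), (-1, [o4, o61]), (1, [τ, o1, o2]), (-1, [τ, o12])],
   [(1, [o12, o234]), (-1, [o1, o34]), (-1, [o2, o56]), (1, [τ, o4, o5]), (-1, [τ, o45])],
   [(1, [o61, o123]), (-1, [o6, o23]), (-1, [o1, o45]), (1, [τ, o3, o4]), (-1, [τ, o34])],
   [(1, [o34, o123]), (-1, [o4, o12]), (-1, [o3, o56]), (1, [τ, o1, o6]), (-1, [τ, o61])],
   [(1, [o3, o4, o34]), (-1, [o1, o6, o61]), (-1, [o34, o34]), (1, [o61, o61]), (1, [o1, o1]),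
     (-1, [o3, o3]), (-1, [o4, o4]), (1, [o6, o6])],
   [(1, [o2, o3, o23]), (-1, [o5, o6, o56]), (-1, [o23, o23]), (1, [o56, o56]), (-1, [o2, o2]),
     (-1, [o3, o3]), (1, [o5, o5]), (1, [o6, o6])],
   [(1, [o1, o2, o12]), (-1, [o4, o5, o45]), (-1, [o12, o12]), (1, [o45, o45]), (-1, [o1, o1]),
     (-1, [o2, o2]), (1, [o4, o4]), (1, [o5, o5])],
   [(1, [o234, o345]), (1, [τ, o4, o5, o6]), (-1, [o34, o61]), (-1, [τ, o6, o45]), (-1, [τ, o4,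
     o56]), (-1, [o2, o5]), (1, [τ, o123])],
   [(1, [o123, o345]), (1, [τ, o1, o5, o6]), (-1, [o12, o45]), (-1, [τ, o1, o56]), (-1, [τ, o5,
     o61]), (-1, [o3, o6]), (1, [τ, o234])],
   [(1, [o123, o234]), (1, [τ, o1, o2, o6]), (-1, [o23, o56]), (-1, [τ, o6, o12]), (-1, [τ, o2,
     o61]), (-1, [o1, o4]), (1, [τ, o345])],
   [(1, [o4, o5, o6, o6]), (-1, [o6, o6, o45]), (-1, [o4, o6, o56]), (-1, [o2, o3, o61]), (1,
     [o23, o61]), (1, [o6, o123]), (1, [o3, o345]), (-1, [o4, o5])],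
   [(1, [o1, o2, o6, o6]), (-1, [o6, o6, o12]), (-1, [o3, o4, o56]), (-1, [o2, o6, o61]), (1,
     [o34, o56]), (1, [o3, o123]), (1, [o6, o345]), (-1, [o1, o2])],
   [(1, [o1, o5, o5, o6]), (-1, [o2, o3, o45]), (-1, [o1, o5, o56]), (-1, [o5, o5, o61]), (1,
     [o23, o45]), (1, [o5, o234]), (1, [o2, o345]), (-1, [o1, o6])],
   [(1, [o4, o4, o5, o6]), (-1, [o1, o2, o34]), (-1, [o4, o6, o45]), (-1, [o4, o4, o56]), (1,
     [o12, o34]), (1, [o4, o123]), (1, [o1, o234]), (-1, [o5, o6])],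
   [(1, [o1, o4, o5, o6]), (-1, [o1, o6, o45]), (-1, [o1, o4, o56]), (-1, [o4, o5, o61]), (1,
     [o45, o61]), (1, [o1, o123]), (1, [o4, o234]), (-1, [o2, o3])],
   [(1, [o1, o2, o5, o6]), (-1, [o5, o6, o12]), (-1, [o1, o2, o56]), (-1, [o2, o5, o61]), (1,
     [o12, o56]), (1, [o2, o234]), (1, [o5, o345]), (-1, [o3, o4])],
   [(1, [o1, o1, o5, o6]), (-1, [o3, o4, o12]), (-1, [o1, o1, o56]), (-1, [o1, o5, o61]), (1,
     [o12, o34]), (1, [o4, o123]), (1, [o1, o234]), (-1, [o5, o6])],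
   [(1, [o1, o2, o2, o6]), (-1, [o2, o6, o12]), (-1, [o4, o5, o23]), (-1, [o2, o2, o61]), (1,
     [o23, o45]), (1, [o5, o234]), (1, [o2, o345]), (-1, [o1, o6])],
   [(1, [o1, o5, o6, o61]), (-1, [o5, o61, o61]), (-1, [o1, o6, o234]), (-1, [o3, o4, o345]),
     (1, [o61, o234]), (1, [o34, o345]), (-1, [o1, o1, o5]), (-1, [o5, o6, o6]), (1, [o4, o45]),
     (1, [o6, o56]), (1, [τ, o1, o3])],
   [(1, [o1, o2, o6, o61]), (-1, [o2, o61, o61]), (-1, [o3, o4, o234]), (-1, [o1, o6, o345]),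
     (1, [o34, o234]), (1, [o61, o345]), (-1, [o1, o1, o2]), (-1, [o2, o6, o6]), (1, [o1, o12]),
     (1, [o3, o23]), (1, [τ, o4, o6])],
   [(1, [o4, o5, o6, o56]), (-1, [o4, o56, o56]), (-1, [o5, o6, o123]), (-1, [o2, o3, o234]),
     (1, [o56, o123]), (1, [o23, o234]), (-1, [o4, o5, o5]), (-1, [o4, o6, o6]), (1, [o3, o34]),
     (1, [o5, o45]), (1, [τ, o2, o6])],
   [(1, [o1, o5, o6, o56]), (-1, [o1, o56, o56]), (-1, [o2, o3, o123]), (-1, [o5, o6, o234]),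
     (1, [o23, o123]), (1, [o56, o234]), (-1, [o1, o5, o5]), (-1, [o1, o6, o6]), (1, [o2, o12]),
     (1, [o6, o61]), (1, [τ, o3, o5])],
   [(1, [o4, o5, o6, o45]), (-1, [o6, o45, o45]), (-1, [o4, o5, o123]), (-1, [o1, o2, o345]),
     (1, [o45, o123]), (1, [o12, o345]), (-1, [o4, o4, o6]), (-1, [o5, o5, o6]), (1, [o5, o56]),
     (1, [o1, o61]), (1, [τ, o2, o4])],
   [(1, [o1, o2, o6, o45]), (-1, [o6, o12, o45]), (-1, [o2, o45, o61]), (-1, [o1, o2, o123]),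
     (1, [o12, o123]), (1, [o45, o345]), (-1, [o3, o4, o4]), (1, [o2, o23]), (1, [o4, o34])],
   [(1, [o5, o6, o6, o34]), (-1, [o2, o3, o3, o61]), (-1, [o6, o34, o56]), (1, [o3, o23, o61]),
     (1, [o3, o3, o345]), (-1, [o6, o6, o345]), (1, [o6, o12]), (-1, [o5, o34]), (-1, [o3, o45]),
     (1, [o2, o61])],
   [(1, [o1, o5, o6, o34]), (-1, [o1, o34, o56]), (-1, [o5, o34, o61]), (-1, [o1, o6, o345]),
     (1, [o34, o234]), (1, [o61, o345]), (-1, [o2, o3, o3]), (1, [o1, o12]), (1, [o3, o23])],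
   [(1, [o1, o2, o6, o34]), (-1, [o6, o12, o34]), (-1, [o2, o34, o61]), (-1, [o1, o6, o234]),
     (1, [o61, o234]), (1, [o34, o345]), (-1, [o4, o4, o5]), (1, [o4, o45]), (1, [o6, o56])],
   [(1, [o1, o1, o2, o34]), (-1, [o4, o4, o5, o61]), (-1, [o1, o12, o34]), (1, [o4, o45, o61]),
     (-1, [o1, o1, o234]), (1, [o4, o4, o234]), (-1, [o4, o23]), (-1, [o2, o34]), (1, [o1, o56]),
     (1, [o5, o61])],
   [(1, [o1, o6, o6, o23]), (-1, [o3, o3, o4, o56]), (1, [o3, o34, o56]), (-1, [o6, o23, o61]),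
     (1, [o3, o3, o123]), (-1, [o6, o6, o123]), (-1, [o3, o12]), (-1, [o1, o23]), (1, [o6, o45]),
     (1, [o4, o56])],
   [(1, [o4, o5, o6, o23]), (-1, [o6, o23, o45]), (-1, [o4, o23, o56]), (-1, [o5, o6, o234]),
     (1, [o23, o123]), (1, [o56, o234]), (-1, [o1, o2, o2]), (1, [o2, o12]), (1, [o6, o61])],
   [(1, [o1, o5, o6, o23]), (-1, [o1, o23, o56]), (-1, [o5, o23, o61]), (-1, [o5, o6, o123]),
     (1, [o56, o123]), (1, [o23, o234]), (-1, [o3, o3, o4]), (1, [o3, o34]), (1, [o5, o45])],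
   [(1, [o4, o5, o5, o23]), (-1, [o1, o2, o2, o56]), (-1, [o5, o23, o45]), (1, [o2, o12, o56]),
     (1, [o2, o2, o234]), (-1, [o5, o5, o234]), (-1, [o4, o23]), (-1, [o2, o34]), (1, [o1, o56]),
     (1, [o5, o61])],
   [(1, [o5, o5, o6, o12]), (-1, [o2, o2, o3, o45]), (1, [o2, o23, o45]), (-1, [o5, o12, o56]),
     (1, [o2, o2, o345]), (-1, [o5, o5, o345]), (-1, [o6, o12]), (1, [o5, o34]), (1, [o3, o45]),
     (-1, [o2, o61])],
   [(1, [o4, o5, o6, o12]), (-1, [o6, o12, o45]), (-1, [o4, o12, o56]), (-1, [o4, o5, o345]),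
     (1, [o12, o123]), (1, [o45, o345]), (-1, [o2, o2, o3]), (1, [o2, o23]), (1, [o4, o34])],
   [(1, [o3, o4, o4, o12]), (-1, [o1, o1, o6, o45]), (-1, [o4, o12, o34]), (1, [o1, o45, o61]),
     (1, [o1, o1, o123]), (-1, [o4, o4, o123]), (-1, [o3, o12]), (-1, [o1, o23]), (1, [o6, o45]),
     (1, [o4, o56])],
   [(1, [o1, o2, o6, o345]), (-1, [o6, o12, o345]), (-1, [o2, o61, o345]), (1, [o345, o345]),
     (-1, [o4, o5, o45]), (-1, [o1, o6, o61]), (1, [o45, o45]), (1, [o61, o61]), (1, [o5, o5]),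
     (1, [o6, o6]), (-1, [τ, τ])],
   [(1, [o1, o5, o6, o234]), (-1, [o1, o56, o234]), (-1, [o5, o61, o234]), (1, [o234, o234]),
     (-1, [o5, o6, o56]), (-1, [o1, o6, o61]), (1, [o56, o56]), (1, [o61, o61]), (1, [o1, o1]),
     (-1, [o3, o3]), (1, [o5, o5]), (1, [o6, o6]), (-1, [τ, τ])],
   [(1, [o4, o5, o6, o123]), (-1, [o6, o45, o123]), (-1, [o4, o56, o123]), (1, [o123, o123]),
     (-1, [o4, o5, o45]), (-1, [o5, o6, o56]), (1, [o45, o45]), (1, [o56, o56]), (-1, [o2, o2]),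
     (1, [o4, o4]), (1, [o5, o5]), (1, [o6, o6]), (-1, [τ, τ])],
   [(1, [o1, o6, o45, o61]), (-1, [o3, o4, o4, o345]), (-1, [o45, o61, o61]), (1, [o4, o34,
     o345]), (-1, [o1, o6, o23]), (-1, [o1, o1, o45]), (1, [o4, o4, o45]), (-1, [o6, o6, o45]),
     (1, [τ, o1, o3, o4]), (1, [o23, o61]), (1, [o6, o123]), (1, [o3, o345]), (-1, [τ, o1, o34]),
     (-1, [o4, o5])],
   [(1, [o4, o5, o45, o61]), (-1, [o1, o1, o2, o345]), (-1, [o45, o45, o61]), (1, [o1, o12,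
     o345]), (-1, [o4, o5, o23]), (1, [o1, o1, o61]), (-1, [o4, o4, o61]), (-1, [o5, o5, o61]),
     (1, [τ, o1, o2, o4]), (1, [o23, o45]), (1, [o5, o234]), (1, [o2, o345]), (-1, [τ, o4, o12]),
     (-1, [o1, o6])],
   [(1, [o2, o3, o45, o61]), (-1, [o23, o45, o61]), (-1, [o3, o45, o345]), (-1, [o2, o61,
     o345]), (-1, [o5, o5, o6, o6]), (1, [o345, o345]), (1, [o5, o6, o56]), (1, [o45, o45]), (1,
     [o61, o61]), (1, [o5, o5]), (1, [o6, o6]), (-1, [τ, τ])],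
   [(1, [o1, o6, o23, o61]), (-1, [o3, o3, o4, o234]), (-1, [o23, o61, o61]), (1, [o3, o34,
     o234]), (-1, [o1, o1, o23]), (1, [o3, o3, o23]), (-1, [o6, o6, o23]), (-1, [o1, o6, o45]),
     (1, [τ, o3, o4, o6]), (1, [o45, o61]), (1, [o1, o123]), (1, [o4, o234]), (-1, [τ, o6, o34]),
     (-1, [o2, o3])],
   [(1, [o4, o5, o23, o61]), (-1, [o23, o45, o61]), (-1, [o4, o23, o234]), (-1, [o5, o61,
     o234]), (-1, [o1, o1, o2, o2]), (1, [o234, o234]), (1, [o4, o5, o45]), (1, [o12, o12]), (1,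
     [o23, o23]), (-1, [o45, o45]), (1, [o61, o61]), (2, [o1, o1]), (2, [o2, o2]), (-1, [o4,
     o4]), (-1, [o5, o5]), (-1, [τ, τ])],
   [(1, [o5, o6, o34, o56]), (-1, [o2, o3, o3, o234]), (-1, [o34, o56, o56]), (1, [o3, o23,
     o234]), (-1, [o5, o6, o12]), (1, [o3, o3, o34]), (-1, [o5, o5, o34]), (-1, [o6, o6, o34]),
     (1, [τ, o2, o3, o6]), (1, [o12, o56]), (1, [o2, o234]), (1, [o5, o345]), (-1, [τ, o6, o23]),
     (-1, [o3, o4])],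
   [(1, [o1, o2, o34, o56]), (-1, [o12, o34, o56]), (-1, [o2, o34, o234]), (-1, [o1, o56,
     o234]), (-1, [o4, o4, o5, o5]), (1, [o234, o234]), (1, [o4, o5, o45]), (1, [o34, o34]), (1,
     [o56, o56]), (1, [o4, o4]), (1, [o5, o5]), (-1, [τ, τ])],
   [(1, [o5, o6, o12, o56]), (-1, [o2, o2, o3, o123]), (-1, [o12, o56, o56]), (1, [o2, o23,
     o123]), (1, [o2, o2, o12]), (-1, [o5, o5, o12]), (-1, [o6, o6, o12]), (-1, [o5, o6, o34]),
     (1, [τ, o2, o3, o5]), (1, [o34, o56]), (1, [o3, o123]), (1, [o6, o345]), (-1, [τ, o5, o23]),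
     (-1, [o1, o2])],
   [(1, [o3, o4, o12, o56]), (-1, [o12, o34, o56]), (-1, [o3, o12, o123]), (-1, [o4, o56,
     o123]), (-1, [o1, o1, o6, o6]), (1, [o123, o123]), (1, [o1, o6, o61]), (1, [o12, o12]), (1,
     [o56, o56]), (1, [o1, o1]), (1, [o6, o6]), (-1, [τ, τ])],
   [(1, [o1, o6, o23, o45]), (-1, [o23, o45, o61]), (-1, [o1, o23, o123]), (-1, [o6, o45,
     o123]), (-1, [o3, o3, o4, o4]), (1, [o123, o123]), (1, [o1, o6, o61]), (1, [o23, o23]), (1,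
     [o34, o34]), (1, [o45, o45]), (-1, [o61, o61]), (-1, [o1, o1]), (2, [o3, o3]), (2, [o4,
     o4]), (-1, [o6, o6]), (-1, [τ, τ])],
   [(1, [o4, o5, o23, o45]), (-1, [o1, o2, o2, o123]), (-1, [o23, o45, o45]), (1, [o2, o12,
     o123]), (1, [o2, o2, o23]), (-1, [o4, o4, o23]), (-1, [o5, o5, o23]), (-1, [o4, o5, o61]),
     (1, [τ, o1, o2, o5]), (1, [o45, o61]), (1, [o1, o123]), (1, [o4, o234]), (-1, [τ, o5, o12]),
     (-1, [o2, o3])],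
   [(1, [o5, o6, o12, o34]), (-1, [o12, o34, o56]), (-1, [o6, o12, o345]), (-1, [o5, o34,
     o345]), (-1, [o2, o2, o3, o3]), (1, [o345, o345]), (1, [o5, o6, o56]), (1, [o12, o12]), (1,
     [o23, o23]), (1, [o34, o34]), (-1, [o56, o56]), (2, [o2, o2]), (2, [o3, o3]), (-1, [o5,
     o5]), (-1, [o6, o6]), (-1, [τ, τ])]]

/-- Twice the Casimir relator. -/
def casimirData : List (ℤ × List ℕ) :=
  [(2, [o123, o234, o345]), (-2, [o2, o5, o123]), (-2, [o3, o6, o234]), (-2, [o1, o4, o345]),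
   (1, [τ, o1, o2, o12]), (1, [τ, o2, o3, o23]), (1, [τ, o3, o4, o34]), (1, [τ, o4, o5, o45]),
   (1, [τ, o5, o6, o56]), (1, [τ, o1, o6, o61]), (-2, [o1, o3, o5]), (-2, [o2, o4, o6]), (-1, [τ,
   o12, o12]), (-1, [τ, o23, o23]), (-1, [τ, o34, o34]), (-1, [τ, o45, o45]), (-1, [τ, o56,
   o56]), (-1, [τ, o61, o61]), (2, [τ, τ, τ])]

/-- The packed forms of the `g_i`. -/
noncomputable def gElems : List PackedElem := gData.map packElem

/-- The packed form of `g_k`, counted from `1` as in the list of the `g_k`. -/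
noncomputable def nthElem (k : ℕ) : PackedElem := gElems.getD (k - 1) (0, [])

/-- A step `(k, a, b, e, c)` asserts that the S-polynomial of `g_a` and `g_b` is congruent to
`c τ^e g_k` modulo the `g_j` with `j` in `known`; here `e ≤ 1`, `c = ±1`, and `a`, `b` are `known`.
So an ideal that contains the known elements contains `g_k`, provided `τ` is a unit. -/
noncomputable def stepOk (known : List ℕ) (s : ℕ × ℕ × ℕ × ℕ × ℤ) : Bool :=
  known.elem s.2.1 && known.elem s.2.2.1 &&
  cofactorOk (nthElem s.2.1) (nthElem s.2.2.1) && cofactorOk (nthElem s.2.2.1) (nthElem s.2.1) &&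
  Nat.ble s.2.2.2.1 1 && Nat.beq (Int.natAbs s.2.2.2.2) 1 &&
  reduces (known.map nthElem) 1000 (merge (spoly (nthElem s.2.1) (nthElem s.2.2.1))
    (scale s.2.2.2.1 (-s.2.2.2.2) (((nthElem s.1).1, 1) :: (nthElem s.1).2)))

/-- Whether the steps of a list are valid one after the other, each adding its `g_k` to the known
elements. -/
noncomputable def stepsOk (known : List ℕ) : List (ℕ × ℕ × ℕ × ℕ × ℤ) → Bool
  | [] => true
  | s :: ss => stepOk known s && stepsOk (known ++ [s.1]) ss

/-- The `g_k` derived from the `J`-relations by S-polynomials. -/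
def steps₁ : List (ℕ × ℕ × ℕ × ℕ × ℤ) :=
  [(22, 10, 1, 1, -1), (24, 10, 3, 1, -1), (23, 11, 5, 1, -1), (27, 11, 6, 1, -1),
   (17, 11, 10, 1, -1), (25, 12, 4, 1, -1), (26, 13, 2, 1, -1), (29, 13, 6, 1, -1),
   (18, 13, 12, 1, -1), (28, 14, 2, 1, -1), (16, 15, 14, 1, -1)]

/-- The `g_k` derived from the previous ones and `g₄₉`. -/
def steps₂ : List (ℕ × ℕ × ℕ × ℕ × ℤ) :=
  [(32, 19, 10, 1, 1), (41, 19, 11, 1, 1), (34, 19, 12, 1, 1), (45, 19, 13, 1, 1),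
   (33, 20, 10, 1, 1), (42, 20, 11, 1, 1), (30, 20, 14, 1, 1), (37, 20, 15, 1, 1),
   (35, 21, 12, 1, 1), (31, 21, 14, 1, 1), (38, 21, 15, 1, 1),
   (50, 16, 4, 0, -1), (53, 16, 5, 0, -1), (55, 17, 5, 0, -1), (57, 17, 6, 0, -1),
   (51, 18, 2, 0, -1), (60, 18, 6, 0, -1), (36, 22, 7, 0, 1), (40, 23, 9, 0, 1),
   (46, 25, 16, 0, 1), (39, 26, 25, 0, 1), (43, 27, 17, 0, -1), (44, 27, 24, 0, -1),
   (48, 20, 19, 1, 1), (47, 21, 19, 1, 1), (52, 30, 24, 0, 1), (54, 31, 29, 0, 1),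
   (56, 32, 25, 0, 1), (59, 35, 9, 0, 1), (61, 37, 27, 0, 1), (58, 33, 28, 0, 1)]

/-- The `g_k` that are, up to sign, `J`-relators or differences of two `J`-relators divided
by `τ`. -/
def known₀ : List ℕ := [1, 2, 3, 4, 5, 6, 7, 8, 9, 10, 11, 12, 13, 14, 15, 19, 20, 21]

/-- The `g_k` obtained without the Casimir relation. -/
def known₁ : List ℕ := known₀ ++ steps₁.map Prod.fst

theorem gElems_ok : gElems.all elemOk = true := by decide +kernel

/-- In the reversed list fewer pairs are left once the redundant ones are discarded. -/
theorem pairsOk_gElems : pairsOk gElems gElems.reverse = true := by decide +kernel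

theorem steps₁_ok : stepsOk known₀ steps₁ = true := by decide +kernel

/-- Modulo the `g_k` obtained from the `J`-relations, twice the Casimir relator is `-2 τ g₄₉`. -/
theorem casimir_ok : reduces (known₁.map nthElem) 1000 (merge (packTerms casimirData)
    (scale 1 2 (((nthElem 49).1, 1) :: (nthElem 49).2))) = true := by decide +kernel

theorem steps₂_ok : stepsOk (known₁ ++ [49]) steps₂ = true := by decide +kernel

end Data

/-! ### Decoding of keys -/

section Soundness

open MvPolynomial MonomialOrder

theorem digit_lt_of_smallDigits (e : ℕ) (h : smallDigits e = true) (i : ℕ) (hi : i < 15) :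
    e / 256 ^ i % 256 < 128 := by
  have h0 : e &&& 0x808080808080808080808080808080 = 0 := Nat.eq_of_beq_eq_true h
  have h1 : (e &&& 0x808080808080808080808080808080).testBit (8 * i + 7) = false := by
    rw [h0, Nat.zero_testBit]
  have h2 : e.testBit (8 * i + 7) = false := by
    rw [Nat.testBit_and] at h1
    have : Nat.testBit 0x808080808080808080808080808080 (8 * i + 7) = true := by
      clear h0 h1 h e
      interval_cases i <;> decide
    simpa [this] using h1
  rw [Nat.testBit_eq_decide_div_mod_eq, decide_eq_false_iff_not] at h2
  have h3 : (2 : ℕ) ^ (8 * i + 7) = 256 ^ i * 128 := by rw [pow_add, pow_mul]; norm_num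
  rw [h3, ← Nat.div_div_eq_div_mul] at h2
  omega

theorem digit_add (n a b : ℕ) (ha : ∀ i < n, a / 256 ^ i % 256 < 128)
    (hb : ∀ i < n, b / 256 ^ i % 256 < 128) :
    ∀ i < n, (a + b) / 256 ^ i % 256 = a / 256 ^ i % 256 + b / 256 ^ i % 256 := by
  induction n generalizing a b with
  | zero => simp
  | succ n ih =>
    have ha0 := ha 0 n.succ_pos
    have hb0 := hb 0 n.succ_pos
    have hshift (c i : ℕ) : c / 256 ^ (i + 1) = c / 256 / 256 ^ i := by
      rw [Nat.div_div_eq_div_mul, pow_succ']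
    have hab : (a + b) / 256 = a / 256 + b / 256 := by omega
    intro i hi
    cases i with
    | zero => simp only [pow_zero, Nat.div_one] at *; omega
    | succ i =>
      rw [hshift, hshift, hshift, hab]
      exact ih _ _ (fun j hj => by rw [← hshift]; exact ha _ (by omega))
        (fun j hj => by rw [← hshift]; exact hb _ (by omega)) i (by omega)

/-- The order of two numbers is decided by the most significant digit at which they differ. -/
theorem exists_digit_lt (n a b : ℕ) (hb : b < 256 ^ n) (h : a < b) :
    ∃ i < n, a / 256 ^ i % 256 < b / 256 ^ i % 256 ∧
      ∀ j < n, i < j → a / 256 ^ j % 256 = b / 256 ^ j % 256 := by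
  induction n generalizing a b with
  | zero => simp at hb; omega
  | succ n ih =>
    have hshift (c i : ℕ) : c / 256 ^ (i + 1) = c / 256 / 256 ^ i := by
      rw [Nat.div_div_eq_div_mul, pow_succ']
    rcases Nat.lt_or_ge (a / 256) (b / 256) with hlt | hge
    · obtain ⟨i, hi, h1, h2⟩ := ih (a / 256) (b / 256)
        (Nat.div_lt_of_lt_mul (by rwa [← pow_succ'])) hlt
      refine ⟨i + 1, by omega, by rwa [hshift, hshift], fun j hj hij => ?_⟩
      obtain ⟨j, rfl⟩ : ∃ j', j = j' + 1 := ⟨j - 1, by omega⟩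
      rw [hshift, hshift]
      exact h2 j (by omega) (by omega)
    · refine ⟨0, n.succ_pos, by simp only [pow_zero, Nat.div_one]; omega, fun j hj h0j => ?_⟩
      obtain ⟨j, rfl⟩ : ∃ j', j = j' + 1 := ⟨j - 1, by omega⟩
      rw [hshift, hshift, show a / 256 = b / 256 by omega]

theorem expo_lt (k : ℕ) : expo k < 256 ^ 15 := by
  have : expo k < 0x1000000000000000000000000000000 := Nat.mod_lt _ (by norm_num)
  simpa using this

theorem expo_add {a b : ℕ} (ha : small a = true) (hb : small b = true) :
    (∀ i < 15, expo (a + b) / 256 ^ i % 256 = expo a / 256 ^ i % 256 + expo b / 256 ^ i % 256) ∧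
      (a + b) % 256 = a % 256 + b % 256 := by
  simp only [small, Bool.and_eq_true, Nat.blt_eq] at ha hb
  have ha1 := digit_lt_of_smallDigits _ ha.1
  have hb1 := digit_lt_of_smallDigits _ hb.1
  have ha2 : a % 256 < 128 := ha.2
  have hb2 : b % 256 < 128 := hb.2
  -- the last digit is small, so that the sum of the two numbers stays below the modulus
  have hlt (k : ℕ) (hk : expo k / 256 ^ 14 % 256 < 128) : expo k < 128 * 256 ^ 14 := by
    have h1 := expo_lt k
    generalize expo k = e at *
    norm_num at *
    omega
  have hexp : expo (a + b) = expo a + expo b := by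
    have e (k : ℕ) : expo k = k / 256 * 0xffffffffffffffffffffffffffffff %
      0x1000000000000000000000000000000 := rfl
    have hdiv : (a + b) / 256 = a / 256 + b / 256 := by omega
    have h1 := hlt a (ha1 14 (by norm_num))
    have h2 := hlt b (hb1 14 (by norm_num))
    rw [e (a + b), hdiv, add_mul, Nat.add_mod, ← e, ← e, Nat.mod_eq_of_lt]
    norm_num at h1 h2
    omega
  refine ⟨fun i hi => ?_, by omega⟩
  rw [hexp]
  exact digit_add 15 _ _ ha1 hb1 i hi

/-- The exponents of `O₁, …, O₃₄₅` in the monomial with key `k`. -/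
noncomputable def keyExp (k : ℕ) : Gen →₀ ℕ :=
  Finsupp.equivFunOnFinite.symm fun i => expo k / 256 ^ i.val % 256

theorem keyExp_apply (k : ℕ) (i : Gen) : keyExp k i = expo k / 256 ^ i.val % 256 := rfl

theorem keyExp_add {a b : ℕ} (ha : small a = true) (hb : small b = true) :
    keyExp (a + b) = keyExp a + keyExp b := by
  ext i
  exact (expo_add ha hb).1 i.val i.isLt

theorem wdeg_keyExp (k : ℕ) : wdeg (keyExp k) = digitSum weights (expo k) := by
  simp only [wdeg, keyExp_apply]
  generalize expo k = e
  have hd (w : ℕ) (ws : List ℕ) (e : ℕ) :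
    digitSum (w :: ws) e = w * (e % 256) + digitSum ws (e / 256) := rfl
  have hd0 (e : ℕ) : digitSum [] e = 0 := rfl
  have hw : ∀ i : Gen, weight i = weights.getD i.val 0 := by decide
  have hsum (ws : List ℕ) (e : ℕ) :
      digitSum ws e = ∑ i ∈ Finset.range ws.length, e / 256 ^ i % 256 * ws.getD i 0 := by
    induction ws generalizing e with
    | nil => simp [hd0]
    | cons w ws ih =>
      rw [hd, ih, List.length_cons, Finset.sum_range_succ']
      simp [Nat.div_div_eq_div_mul, pow_succ', mul_comm w, add_comm]
  rw [hsum]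
  simp only [hw]
  exact Fin.sum_univ_eq_sum_range (fun i => e / 256 ^ i % 256 * weights.getD i 0) 15

theorem wRevLex_lt {a b : Gen →₀ ℕ} (h : wdeg a < wdeg b ∨ wdeg a = wdeg b ∧
    ∃ i, b i < a i ∧ ∀ j, i < j → a j = b j) : a ≺[wRevLex] b := by
  change WRevLex.key a < WRevLex.key b
  rw [Prod.Lex.lt_iff]
  refine h.imp_right fun ⟨h0, i, hi, hj⟩ => ⟨h0, Fin.rev i, fun j hji => ?_, ?_⟩
  · change OrderDual.toDual (a (Fin.rev j)) = OrderDual.toDual (b (Fin.rev j))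
    rw [hj _ (by rwa [← Fin.rev_lt_rev, Fin.rev_rev])]
  · change OrderDual.toDual (a (Fin.rev (Fin.rev i))) < OrderDual.toDual (b (Fin.rev (Fin.rev i)))
    rw [Fin.rev_rev]
    exact hi

theorem keyExp_lt_of_keyLt {k l : ℕ} (h : keyLt k l = true) :
    keyExp k ≺[wRevLex] keyExp l := by
  apply wRevLex_lt
  rw [wdeg_keyExp, wdeg_keyExp]
  simp only [keyLt, Bool.or_eq_true, Bool.and_eq_true, Nat.blt_eq, Nat.beq_eq] at h
  refine h.imp_right fun h => ⟨h.1, ?_⟩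
  obtain ⟨i, hi, h1, h2⟩ := exists_digit_lt 15 _ _ (expo_lt k) h.2
  exact ⟨⟨i, hi⟩, h1, fun j hj => (h2 j.val j.isLt hj).symm⟩

end Soundness

/-! ### Soundness of the packed arithmetic -/

section Evaluation

open MvPolynomial MonomialOrder

variable {R : Type*} [CommRing R] (τ₀ : R)

/-- The monomial with key `k`, with `τ` specialized to `τ₀`. -/
noncomputable def evalKey (k : ℕ) : MvPolynomial Gen R := monomial (keyExp k) (τ₀ ^ (k % 256))

theorem evalKey_add {a b : ℕ} (ha : small a = true) (hb : small b = true) :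
    evalKey τ₀ (a + b) = evalKey τ₀ a * evalKey τ₀ b := by
  rw [evalKey, evalKey, evalKey, monomial_mul, keyExp_add ha hb, (expo_add ha hb).2, pow_add]

/-- The polynomial with the given terms, with `τ` specialized to `τ₀`. -/
noncomputable def evalPacked : Packed → MvPolynomial Gen R
  | [] => 0
  | x :: s => (x.2 : MvPolynomial Gen R) * evalKey τ₀ x.1 + evalPacked s

/-- The polynomial with the given leading monomial and tail, with `τ` specialized to `τ₀`. -/
noncomputable def evalElem (g : PackedElem) : MvPolynomial Gen R :=
  evalKey τ₀ g.1 + evalPacked τ₀ g.2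

theorem evalPacked_insertTerm (x : ℕ × ℤ) (f : Packed → Packed) (p : MvPolynomial Gen R)
    (hf : ∀ s, evalPacked τ₀ (f s) = p + evalPacked τ₀ s) (s : Packed) :
    evalPacked τ₀ (insertTerm x f s)
      = (x.2 : MvPolynomial Gen R) * evalKey τ₀ x.1 + p + evalPacked τ₀ s := by
  induction s with
  | nil =>
    change _ + evalPacked τ₀ (f []) = _
    rw [hf, add_assoc]
  | cons y t ih =>
    have hcons : insertTerm x f (y :: t) = Bool.rec
      (Bool.rec
        (Int.rec (fun n => Nat.rec (f t) (fun n _ => (x.1, Int.ofNat (Nat.succ n)) :: f t) n)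
          (fun n => (x.1, Int.negSucc n) :: f t) (x.2 + y.2))
        (x :: f (y :: t)) (Nat.blt y.1 x.1))
      (y :: insertTerm x f t) (Nat.blt x.1 y.1) := rfl
    rw [hcons]
    cases h1 : Nat.blt x.1 y.1 with
    | true =>
      change _ + evalPacked τ₀ (insertTerm x f t) = _ + (_ + _)
      rw [ih]
      ring
    | false =>
      cases h2 : Nat.blt y.1 x.1 with
      | true =>
        change _ + evalPacked τ₀ (f (y :: t)) = _
        rw [hf, add_assoc]
      | false =>
        have hxy : x.1 = y.1 := by
          have h1' : ¬ x.1 < y.1 := fun h => Bool.false_ne_true (h1.symm.trans (Nat.blt_eq.mpr h))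
          have h2' : ¬ y.1 < x.1 := fun h => Bool.false_ne_true (h2.symm.trans (Nat.blt_eq.mpr h))
          omega
        have hgoal : (x.2 : MvPolynomial Gen R) * evalKey τ₀ x.1 + p + evalPacked τ₀ (y :: t)
            = ((x.2 + y.2 : ℤ) : MvPolynomial Gen R) * evalKey τ₀ x.1
              + (p + evalPacked τ₀ t) := by
          change _ + (_ + _) = _
          rw [← hxy]
          push_cast
          ring
        rw [hgoal, ← hf]
        cases h3 : x.2 + y.2 with
        | ofNat n =>
          cases n with
          | zero => change evalPacked τ₀ (f t) = _; simp
          | succ n => rfl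
        | negSucc n => rfl

theorem evalPacked_merge (s t : Packed) :
    evalPacked τ₀ (merge s t) = evalPacked τ₀ s + evalPacked τ₀ t := by
  induction s generalizing t with
  | nil => exact (zero_add _).symm
  | cons x s ih => exact evalPacked_insertTerm τ₀ x _ _ ih t

theorem evalPacked_scale {u : ℕ} (hu : small u = true) (c : ℤ) (s : Packed)
    (hs : ∀ x ∈ s, small x.1 = true) :
    evalPacked τ₀ (scale u c s) = (c : MvPolynomial Gen R) * evalKey τ₀ u * evalPacked τ₀ s := by
  induction s with
  | nil => exact (mul_zero _).symm
  | cons x s ih =>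
    change ((c * x.2 : ℤ) : MvPolynomial Gen R) * evalKey τ₀ (u + x.1) + evalPacked τ₀ (scale u c s)
      = _ * (_ + _)
    rw [ih fun y hy => hs y (List.mem_cons_of_mem _ hy), evalKey_add τ₀ hu (hs x (by simp))]
    push_cast
    ring

theorem forall_mem_insertTerm {P : ℕ → Prop} {x : ℕ × ℤ} {f : Packed → Packed} (hx : P x.1)
    (hf : ∀ s, (∀ y ∈ s, P y.1) → ∀ y ∈ f s, P y.1) (s : Packed) (hs : ∀ y ∈ s, P y.1) :
    ∀ y ∈ insertTerm x f s, P y.1 := by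
  have hcons {z : ℕ × ℤ} {l : Packed} (hz : P z.1) (hl : ∀ y ∈ l, P y.1) : ∀ y ∈ z :: l, P y.1 :=
    List.forall_mem_cons.2 ⟨hz, hl⟩
  induction s with
  | nil => exact hcons hx (hf _ hs)
  | cons z t ih =>
    have ht := (List.forall_mem_cons.1 hs).2
    have hcons' : insertTerm x f (z :: t) = Bool.rec
      (Bool.rec
        (Int.rec (fun n => Nat.rec (f t) (fun n _ => (x.1, Int.ofNat (Nat.succ n)) :: f t) n)
          (fun n => (x.1, Int.negSucc n) :: f t) (x.2 + z.2))
        (x :: f (z :: t)) (Nat.blt z.1 x.1))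
      (z :: insertTerm x f t) (Nat.blt x.1 z.1) := rfl
    rw [hcons']
    cases Nat.blt x.1 z.1 with
    | true => exact hcons (List.forall_mem_cons.1 hs).1 (ih ht)
    | false =>
      cases Nat.blt z.1 x.1 with
      | true => exact hcons hx (hf _ hs)
      | false =>
        cases x.2 + z.2 with
        | ofNat n =>
          cases n with
          | zero => exact hf _ ht
          | succ n => exact hcons (z := (x.1, _)) hx (hf _ ht)
        | negSucc n => exact hcons (z := (x.1, _)) hx (hf _ ht)

theorem forall_mem_merge {P : ℕ → Prop} (s t : Packed) (hs : ∀ y ∈ s, P y.1)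
    (ht : ∀ y ∈ t, P y.1) : ∀ y ∈ merge s t, P y.1 := by
  induction s generalizing t with
  | nil => exact ht
  | cons x s ih =>
    rw [List.forall_mem_cons] at hs
    exact forall_mem_insertTerm hs.1 (fun s' hs' => ih s' hs.2 hs') t ht

theorem forall_mem_scale {P : ℕ → Prop} (u : ℕ) (c : ℤ) (s : Packed)
    (hs : ∀ y ∈ s, P (u + y.1)) : ∀ y ∈ scale u c s, P y.1 := by
  induction s with
  | nil => simp [scale]
  | cons x s ih =>
    rw [List.forall_mem_cons] at hs
    exact List.forall_mem_cons.2 ⟨hs.1, ih hs.2⟩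

theorem exists_of_withDivisor {ok : ℕ → Bool} {k : ℕ} {f : ℕ → Packed → Bool}
    {gs : List PackedElem}
    (h : withDivisor ok k f gs = true) :
    ∃ g ∈ gs, g.1 ≤ k ∧ ok (k - g.1) = true ∧ f (k - g.1) g.2 = true := by
  induction gs with
  | nil => exact absurd h Bool.false_ne_true
  | cons g gs ih =>
    have hcons : withDivisor ok k f (g :: gs) = Bool.rec (withDivisor ok k f gs)
      (Bool.rec (withDivisor ok k f gs) (f (k - g.1) g.2) (ok (k - g.1)))
      (Nat.ble g.1 k) := rfl
    rw [hcons] at h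
    have hrec (h' : withDivisor ok k f gs = true) :
        ∃ g' ∈ g :: gs, g'.1 ≤ k ∧ ok (k - g'.1) = true ∧ f (k - g'.1) g'.2 = true := by
      obtain ⟨g', hg', h'⟩ := ih h'
      exact ⟨g', List.mem_cons_of_mem _ hg', h'⟩
    cases h1 : Nat.ble g.1 k with
    | false => rw [h1] at h; exact hrec h
    | true =>
      rw [h1] at h
      cases h2 : ok (k - g.1) with
      | false => rw [h2] at h; exact hrec h
      | true => rw [h2] at h; exact ⟨g, by simp, Nat.le_of_ble_eq_true h1, h2, h⟩

/-- The first monomial of `g` is its leading monomial and free of `τ`; consequently `g` is monic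
with this leading monomial for every specialization of `τ`. -/
structure ElemOk (g : PackedElem) : Prop where
  small_lead : small g.1 = true
  lead_mod : g.1 % 256 = 0
  small_tail : ∀ x ∈ g.2, small x.1 = true
  tail_lt : ∀ x ∈ g.2, keyExp x.1 ≺[wRevLex] keyExp g.1

theorem ElemOk.of_elemOk {g : PackedElem} (h : elemOk g = true) : ElemOk g := by
  simp only [elemOk, Bool.and_eq_true] at h
  have key (l : ℕ) (s : Packed) (hs : termsOk l s = true) :
      ∀ x ∈ s, small x.1 = true ∧ keyLt x.1 l = true := by
    induction s with
    | nil => simp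
    | cons x s ih =>
      have hs' : (small x.1 && keyLt x.1 l && termsOk l s) = true := hs
      simp only [Bool.and_eq_true] at hs'
      exact List.forall_mem_cons.2 ⟨hs'.1, ih hs'.2⟩
  exact ⟨h.1.1, Nat.eq_of_beq_eq_true h.1.2, fun x hx => (key _ _ h.2 x hx).1,
    fun x hx => keyExp_lt_of_keyLt (key _ _ h.2 x hx).2⟩

theorem ElemOk.evalKey_lead {g : PackedElem} (h : ElemOk g) :
    evalKey τ₀ g.1 = monomial (keyExp g.1) 1 := by
  rw [evalKey, h.lead_mod, pow_zero]

theorem evalPacked_support (s : Packed) :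
    ∀ a ∈ (evalPacked τ₀ s).support, ∃ x ∈ s, a = keyExp x.1 := by
  classical
  induction s with
  | nil => intro a ha; simp [evalPacked] at ha
  | cons x s ih =>
    intro a ha
    rcases Finset.mem_union.1 (support_add ha) with ha | ha
    · have h1 : (x.2 : MvPolynomial Gen R) * evalKey τ₀ x.1
          = monomial (keyExp x.1) ((x.2 : R) * τ₀ ^ (x.1 % 256)) := by
        rw [evalKey, ← map_intCast (C : R →+* MvPolynomial Gen R), C_mul_monomial]
      rw [h1] at ha
      exact ⟨x, by simp, Finset.mem_singleton.1 (support_monomial_subset ha)⟩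
    · obtain ⟨y, hy, rfl⟩ := ih a ha
      exact ⟨y, List.mem_cons_of_mem _ hy, rfl⟩

theorem ElemOk.coeff_lead {g : PackedElem} (h : ElemOk g) :
    coeff (keyExp g.1) (evalElem τ₀ g) = 1 := by
  classical
  rw [evalElem, h.evalKey_lead, coeff_add, coeff_monomial, if_pos rfl]
  have : coeff (keyExp g.1) (evalPacked τ₀ g.2) = 0 := by
    by_contra hne
    obtain ⟨x, hx, hxe⟩ := evalPacked_support τ₀ _ _ (mem_support_iff.2 hne)
    exact (h.tail_lt x hx).ne (by rw [hxe])
  rw [this, add_zero]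

theorem ElemOk.degree_eq [Nontrivial R] {g : PackedElem} (h : ElemOk g) :
    wRevLex.degree (evalElem τ₀ g) = keyExp g.1 := by
  classical
  refine wRevLex.toSyn.injective (le_antisymm ?_ (wRevLex.le_degree ?_))
  · rw [degree_le_iff]
    intro a ha
    rcases Finset.mem_union.1 (support_add ha) with ha | ha
    · rw [Finset.mem_singleton.1 (support_monomial_subset ha)]
    · obtain ⟨x, hx, rfl⟩ := evalPacked_support τ₀ _ _ ha
      exact (h.tail_lt x hx).le
  · rw [mem_support_iff, h.coeff_lead]
    exact one_ne_zero

theorem ElemOk.monic [Nontrivial R] {g : PackedElem} (h : ElemOk g) :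
    wRevLex.Monic (evalElem τ₀ g) := by
  rw [Monic, leadingCoeff, h.degree_eq, h.coeff_lead]

variable {τ₀}

/-- A successful reduction of `p` exhibits it as a combination of multiples whose leading monomials
satisfy any condition `P` that is inherited by smaller monomials and holds for the terms of `p`. -/
theorem evalPacked_mem_of_reduces [Nontrivial R] {gs : List PackedElem}
    (hgs : ∀ g ∈ gs, ElemOk g) {A : List (MvPolynomial Gen R)}
    (hA : ∀ g ∈ gs, evalElem τ₀ g ∈ A) {P : (Gen →₀ ℕ) → Prop}
    (hP : ∀ a b, a ≺[wRevLex] b → P b → P a) (n : ℕ) {p : Packed}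
    (hp : ∀ x ∈ p, P (keyExp x.1)) (h : reduces gs n p = true) :
    evalPacked τ₀ p ∈ multiplesSpan wRevLex A P := by
  induction n generalizing p with
  | zero => exact absurd h Bool.false_ne_true
  | succ n ih =>
    cases p with
    | nil => exact zero_mem _
    | cons x t =>
      obtain ⟨g, hg, hle, hu, hred⟩ := exists_of_withDivisor
        (ok := small) (f := fun u s => reduces gs n (merge t (scale u (-x.2) s))) h
      rw [List.forall_mem_cons] at hp
      obtain ⟨u, hxu⟩ : ∃ u, x.1 = u + g.1 := ⟨x.1 - g.1, (Nat.sub_add_cancel hle).symm⟩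
      rw [hxu, Nat.add_sub_cancel] at hu hred
      have hok := hgs g hg
      have hkey := keyExp_add hu hok.small_lead
      have hp1 : P (keyExp u + keyExp g.1) := by rw [← hkey, ← hxu]; exact hp.1
      have hmem := ih (p := merge t (scale u (-x.2) g.2))
        (forall_mem_merge (P := fun k => P (keyExp k)) _ _ hp.2
          (forall_mem_scale (P := fun k => P (keyExp k)) _ _ _
          fun y hy => by
          rw [keyExp_add hu (hok.small_tail y hy)]
          refine hP _ _ ?_ hp1
          rw [map_add, map_add]
          exact add_lt_add_right (hok.tail_lt y hy) _)) hred
      rw [evalPacked_merge, evalPacked_scale τ₀ hu _ _ hok.small_tail] at hmem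
      have hlead : (x.2 : MvPolynomial Gen R) * evalKey τ₀ u * evalElem τ₀ g
          ∈ multiplesSpan wRevLex A P := by
        refine mul_mem_multiplesSpan (hA g hg) _ fun s hs => ?_
        rw [evalKey, ← map_intCast (C : R →+* MvPolynomial Gen R), C_mul_monomial] at hs
        rw [Finset.mem_singleton.1 (support_monomial_subset hs), hok.degree_eq]
        exact hp1
      have := add_mem hlead hmem
      convert this using 1
      rw [evalPacked, hxu, evalKey_add τ₀ hu hok.small_lead, evalElem]
      push_cast
      ring

end Evaluation

/-! ### Soundness of the pair test -/

section Pairs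

-- unfolded on variables, these lead to computations with huge unary numbers
attribute [local irreducible] expo smallDigits

open MvPolynomial MonomialOrder

theorem quotExpo_digit (n a b : ℕ) : ∀ i < n,
    quotExpo n a b / 256 ^ i % 256 = a / 256 ^ i % 256 - b / 256 ^ i % 256 := by
  induction n generalizing a b with
  | zero => simp
  | succ n ih =>
    intro i hi
    have hs : quotExpo (n + 1) a b
        = (a % 256 - b % 256) + 256 * quotExpo n (a / 256) (b / 256) := rfl
    have hshift (c i : ℕ) : c / 256 ^ (i + 1) = c / 256 / 256 ^ i := by
      rw [Nat.div_div_eq_div_mul, pow_succ']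
    rw [hs]
    cases i with
    | zero => simp only [pow_zero, Nat.div_one]; omega
    | succ i =>
      rw [hshift, hshift, hshift, ← ih _ _ i (by omega)]
      congr 2
      omega

theorem keyExp_cofactorKey {g h : PackedElem} (hc : cofactorOk g h = true) :
    keyExp (cofactorKey g h) = keyExp h.1 - keyExp g.1 := by
  simp only [cofactorOk, Bool.and_eq_true, Nat.beq_eq] at hc
  ext i
  rw [Finsupp.tsub_apply, keyExp_apply, keyExp_apply, keyExp_apply, hc.1,
    quotExpo_digit 15 _ _ i.val i.isLt]

theorem small_cofactorKey {g h : PackedElem} (hc : cofactorOk g h = true) :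
    small (cofactorKey g h) = true := by
  simp only [cofactorOk, Bool.and_eq_true] at hc
  exact hc.2

theorem expoKey_mod (e : ℕ) : expoKey e % 256 = 0 := Nat.mul_mod_right 256 _

variable {R : Type*} [CommRing R] {τ₀ : R}

theorem evalKey_cofactorKey {g h : PackedElem} (hc : cofactorOk g h = true) :
    evalKey τ₀ (cofactorKey g h) = monomial (keyExp h.1 - keyExp g.1) 1 := by
  rw [evalKey, keyExp_cofactorKey hc, cofactorKey, expoKey_mod, pow_zero]

theorem evalPacked_spoly [Nontrivial R] {g h : PackedElem} (hg : ElemOk g) (hh : ElemOk h)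
    (hgh : cofactorOk g h = true) (hhg : cofactorOk h g = true) :
    evalPacked τ₀ (spoly g h) = sPair wRevLex (evalElem τ₀ g) (evalElem τ₀ h) := by
  have hlead : monomial (keyExp h.1 - keyExp g.1) 1 * monomial (keyExp g.1) 1
      = (monomial (keyExp g.1 - keyExp h.1) 1 * monomial (keyExp h.1) 1 : MvPolynomial Gen R) := by
    have : keyExp h.1 - keyExp g.1 + keyExp g.1 = keyExp g.1 - keyExp h.1 + keyExp h.1 := by
      ext i
      simp only [Finsupp.add_apply, Finsupp.tsub_apply]
      omega
    rw [monomial_mul, monomial_mul, this]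
  rw [spoly, evalPacked_merge, evalPacked_scale τ₀ (small_cofactorKey hgh) _ _ hg.small_tail,
    evalPacked_scale τ₀ (small_cofactorKey hhg) _ _ hh.small_tail, evalKey_cofactorKey hgh,
    evalKey_cofactorKey hhg, sPair, hg.degree_eq, hh.degree_eq,
    evalElem, evalElem, mul_add, mul_add, hg.evalKey_lead,
    hh.evalKey_lead, hlead]
  push_cast
  ring

theorem spoly_lt {g h : PackedElem} (hg : ElemOk g) (hh : ElemOk h)
    (hgh : cofactorOk g h = true) (hhg : cofactorOk h g = true) :
    ∀ x ∈ spoly g h, keyExp x.1 ≺[wRevLex] keyExp h.1 - keyExp g.1 + keyExp g.1 := by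
  refine forall_mem_merge (P := fun k => keyExp k ≺[wRevLex] keyExp h.1 - keyExp g.1 + keyExp g.1)
    _ _ (forall_mem_scale (P := fun k =>
      keyExp k ≺[wRevLex] keyExp h.1 - keyExp g.1 + keyExp g.1) _ _ _ fun x hx => ?_)
    (forall_mem_scale (P := fun k =>
      keyExp k ≺[wRevLex] keyExp h.1 - keyExp g.1 + keyExp g.1) _ _ _ fun x hx => ?_)
  · rw [keyExp_add (small_cofactorKey hgh) (hg.small_tail x hx), keyExp_cofactorKey hgh, map_add,
      map_add]
    exact add_lt_add_right (hg.tail_lt x hx) _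
  · have hsum : keyExp h.1 - keyExp g.1 + keyExp g.1 = keyExp g.1 - keyExp h.1 + keyExp h.1 := by
      ext i
      simp only [Finsupp.add_apply, Finsupp.tsub_apply]
      omega
    rw [keyExp_add (small_cofactorKey hhg) (hh.small_tail x hx), keyExp_cofactorKey hhg, hsum,
      map_add, map_add]
    exact add_lt_add_right (hh.tail_lt x hx) _

theorem digit_le_of_smallDigits_sub {q a : ℕ} (ha : ∀ i < 15, a / 256 ^ i % 256 < 128) (hle : a ≤ q)
    (h : smallDigits (q - a) = true) : ∀ i < 15, a / 256 ^ i % 256 ≤ q / 256 ^ i % 256 := by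
  intro i hi
  have := digit_add 15 (q - a) a (digit_lt_of_smallDigits _ h) ha i hi
  rw [Nat.sub_add_cancel hle] at this
  omega

theorem ElemOk.digit_lt {g : PackedElem} (hg : ElemOk g) :
    ∀ i < 15, expo g.1 / 256 ^ i % 256 < 128 := by
  have := hg.small_lead
  simp only [small, Bool.and_eq_true] at this
  exact digit_lt_of_smallDigits _ this.1

theorem exists_of_redundant {q l : ℕ} {qs : List (ℕ × ℕ)} (h : redundant q l qs = true) :
    ∃ x ∈ qs, x.1 ≤ q ∧ smallDigits (q - x.1) = true ∧ (x.1 < q ∨ x.2 < l) := by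
  induction qs with
  | nil => exact absurd h Bool.false_ne_true
  | cons x qs ih =>
    have h' : ((Nat.ble x.1 q && smallDigits (q - x.1) && (Nat.blt x.1 q || Nat.blt x.2 l)) ||
      redundant q l qs) = true := h
    simp only [Bool.or_eq_true, Bool.and_eq_true, Nat.blt_eq, Nat.ble_eq] at h'
    rcases h' with h' | h'
    · exact ⟨x, by simp, h'.1.1, h'.1.2, h'.2⟩
    · obtain ⟨y, hy, h''⟩ := ih h'
      exact ⟨y, List.mem_cons_of_mem _ hy, h''⟩

theorem mem_quotients {g : PackedElem} {t : List PackedElem} {x : ℕ × ℕ}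
    (hx : x ∈ quotients g t) : ∃ h ∈ t, x = (quotExpo 15 (expo h.1) (expo g.1), h.1) := by
  induction t with
  | nil => exact absurd hx List.not_mem_nil
  | cons h t ih =>
    have hx' : x ∈ (quotExpo 15 (expo h.1) (expo g.1), h.1) :: quotients g t := hx
    rcases List.mem_cons.1 hx' with rfl | hx'
    · exact ⟨h, by simp, rfl⟩
    · obtain ⟨k, hk, h'⟩ := ih hx'
      exact ⟨k, List.mem_cons_of_mem _ hk, h'⟩

theorem pairOk_of_pairsOkWith {gs : List PackedElem} {g : PackedElem} {qs : List (ℕ × ℕ)}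
    {t : List PackedElem} (h : pairsOkWith gs g qs t = true) :
    ∀ k ∈ t, pairOk gs g k qs = true := by
  induction t with
  | nil => simp
  | cons k t ih =>
    have h' : (pairOk gs g k qs && pairsOkWith gs g qs t) = true := h
    rw [Bool.and_eq_true] at h'
    exact List.forall_mem_cons.2 ⟨h'.1, ih h'.2⟩

/-- A redundant pair `(g, h)` points to a pair `(g, k)` whose cofactor divides that of `(g, h)`;
this ends at a pair that resolves, since the pair of the digits of the cofactor and the key of the
leading monomial decreases lexicographically. -/
theorem resolves_of_pairOk [Nontrivial R] {gs : List PackedElem} (hgs : ∀ g ∈ gs, ElemOk g)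
    {A : List (MvPolynomial Gen R)} (hA : ∀ g ∈ gs, evalElem τ₀ g ∈ A) {g : PackedElem}
    (hg : g ∈ gs) {t : List PackedElem} (ht : ∀ h ∈ t, h ∈ gs)
    (hok : ∀ h ∈ t, pairOk gs g h (quotients g t) = true) (h : PackedElem) (hh : h ∈ t) :
    ∃ k ∈ t, keyExp k.1 - keyExp g.1 ≤ keyExp h.1 - keyExp g.1 ∧
      Resolves wRevLex A (evalElem τ₀ g) (evalElem τ₀ k) := by
  -- an opaque name for the measure, lest it be evaluated on variables
  obtain ⟨f, hf⟩ : ∃ f : PackedElem → ℕ, ∀ h, f h = quotExpo 15 (expo h.1) (expo g.1) :=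
    ⟨_, fun _ => rfl⟩
  induction hq : toLex (f h, h.1) using WellFoundedLT.induction generalizing h with
  | ind q ih =>
  subst hq
  have hp := hok h hh
  rw [pairOk, Bool.or_eq_true, Bool.or_eq_true, Bool.and_eq_true, Bool.and_eq_true] at hp
  rcases hp with (hp | hp) | hp
  · obtain ⟨x, hx, hle, hsm, hlt⟩ := exists_of_redundant hp
    obtain ⟨k, hk, rfl⟩ := mem_quotients hx
    rw [← hf, ← hf] at hle
    rw [← hf, ← hf] at hlt
    rw [← hf, ← hf] at hsm
    have hlex : toLex (f k, k.1) < toLex (f h, h.1) := by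
      rw [Prod.Lex.lt_iff]
      rcases lt_or_eq_of_le hle with h1 | h1
      · exact Or.inl h1
      · exact Or.inr ⟨h1, hlt.resolve_left (fun h2 => h2.ne h1)⟩
    obtain ⟨k', hk', hle', hres⟩ := ih _ hlex k hk rfl
    refine ⟨k', hk', hle'.trans fun i => ?_, hres⟩
    have hdig : ∀ i < 15, f k / 256 ^ i % 256 < 128 := by
      intro i hi
      rw [hf, quotExpo_digit 15 _ _ i hi]
      have := (hgs k (ht k hk)).digit_lt i hi
      omega
    have := digit_le_of_smallDigits_sub hdig hle hsm i.val i.isLt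
    rwa [hf, hf, quotExpo_digit 15 _ _ _ i.isLt, quotExpo_digit 15 _ _ _ i.isLt] at this
  · refine ⟨h, hh, le_rfl, resolves_of_coprime (hA g hg) (hA h (ht h hh)) ((hgs g hg).monic _)
      ((hgs h (ht h hh)).monic _) ?_⟩
    rw [(hgs g hg).degree_eq, (hgs h (ht h hh)).degree_eq]
    ext i
    rw [Finsupp.tsub_apply, keyExp_apply, keyExp_apply, ← quotExpo_digit 15 _ _ _ i.isLt,
      Nat.eq_of_beq_eq_true hp]
  · refine ⟨h, hh, le_rfl, ?_⟩
    have hgo := hgs g hg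
    have hho := hgs h (ht h hh)
    rw [Resolves, ← evalPacked_spoly hgo hho hp.1.1 hp.1.2, hgo.degree_eq, hho.degree_eq]
    exact evalPacked_mem_of_reduces hgs hA (fun a b hab hb => hab.trans hb) _
      (spoly_lt hgo hho hp.1.1 hp.1.2) hp.2

theorem pairsResolve_of_pairsOk [Nontrivial R] {gs : List PackedElem} (hgs : ∀ g ∈ gs, ElemOk g)
    {A : List (MvPolynomial Gen R)} (hA : ∀ g ∈ gs, evalElem τ₀ g ∈ A) {t : List PackedElem}
    (ht : ∀ h ∈ t, h ∈ gs) (h : pairsOk gs t = true) :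
    PairsResolve wRevLex A (t.map (evalElem τ₀)) := by
  induction t with
  | nil => trivial
  | cons g t ih =>
    have h' : (pairsOkWith gs g (quotients g t) t && pairsOk gs t) = true := h
    rw [Bool.and_eq_true] at h'
    rw [List.forall_mem_cons] at ht
    refine ⟨?_, ih ht.2 h'.2⟩
    intro p hp
    obtain ⟨k, hk, rfl⟩ := List.mem_map.1 hp
    obtain ⟨k', hk', hle, hres⟩ := resolves_of_pairOk hgs hA ht.1 ht.2
      (pairOk_of_pairsOkWith h'.1) k hk
    refine ⟨_, List.mem_map_of_mem hk', ?_, hres⟩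
    rwa [(hgs g ht.1).degree_eq, (hgs k (ht.2 k hk)).degree_eq, (hgs k' (ht.2 k' hk')).degree_eq]

theorem multiplesSpan_le_span {A : List (MvPolynomial Gen R)} {I : Ideal (MvPolynomial Gen R)}
    (hA : ∀ g ∈ A, g ∈ I) {P : (Gen →₀ ℕ) → Prop} {p : MvPolynomial Gen R}
    (hp : p ∈ multiplesSpan wRevLex A P) : p ∈ I := by
  induction hp using Submodule.span_induction with
  | mem p hp =>
    obtain ⟨g, hg, u, -, rfl⟩ := hp
    exact Ideal.mul_mem_left _ _ (hA g hg)
  | zero => exact zero_mem _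
  | add x y _ _ hx hy => exact add_mem hx hy
  | smul c x _ hx => rw [smul_eq_C_mul]; exact Ideal.mul_mem_left _ _ hx

theorem evalPacked_mem_ideal_of_reduces [Nontrivial R] {gs : List PackedElem}
    (hgs : ∀ g ∈ gs, ElemOk g) {I : Ideal (MvPolynomial Gen R)}
    (hI : ∀ g ∈ gs, evalElem τ₀ g ∈ I) (n : ℕ) {p : Packed} (h : reduces gs n p = true) :
    evalPacked τ₀ p ∈ I :=
  multiplesSpan_le_span (A := gs.map (evalElem τ₀)) (fun p hp => by
    obtain ⟨g, hg, rfl⟩ := List.mem_map.1 hp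
    exact hI g hg)
    (evalPacked_mem_of_reduces hgs (fun g hg => List.mem_map_of_mem hg) (P := fun _ => True)
      (fun _ _ _ _ => trivial) n (fun _ _ => trivial) h)

end Pairs

/-! ### Polynomials given by words -/

section Symbols

open MvPolynomial

variable {R : Type*} [CommRing R] (τ₀ : R)

/-- The `i`-th symbol; the symbol with number 15 is `τ`. -/
noncomputable def varPoly (i : ℕ) : MvPolynomial Gen R :=
  if h : i < 15 then X ⟨i, h⟩ else C τ₀

/-- The product of the symbols in a word. -/
noncomputable def evalWord : List ℕ → MvPolynomial Gen R
  | [] => 1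
  | i :: l => varPoly τ₀ i * evalWord l

/-- The sum of the given multiples of words. -/
noncomputable def evalTerms : List (ℤ × List ℕ) → MvPolynomial Gen R
  | [] => 0
  | x :: s => (x.1 : MvPolynomial Gen R) * evalWord τ₀ x.2 + evalTerms s

/-- Whether a word consists of numbers of symbols and is short enough to be packed without carries.
-/
def wordOk : List ℕ → Bool
  | [] => true
  | i :: l => Nat.blt i 16 && small (varKey i) && small (monKey l) && wordOk l

theorem expo_varKey : ∀ i j : Fin 15,
    expo (varKey i.val) / 256 ^ j.val % 256 = if i = j then 1 else 0 := by
  decide +kernel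

theorem varKey_mod : ∀ i : Fin 15, varKey i.val % 256 = 0 := by
  decide +kernel

theorem expo_one : expo 1 = 0 := by decide +kernel

theorem expo_zero : expo 0 = 0 := by decide +kernel

theorem varKey_fifteen : varKey 15 = 1 := by decide +kernel

attribute [local irreducible] expo smallDigits varKey

theorem evalKey_varKey (i : Fin 15) : evalKey τ₀ (varKey i.val) = X i := by
  have : keyExp (varKey i.val) = Finsupp.single i 1 := by
    ext j
    rw [keyExp_apply, expo_varKey, Finsupp.single_apply]
  rw [evalKey, varKey_mod, pow_zero, this]
  rfl

theorem evalKey_of_expo_eq_zero {k : ℕ} (h : expo k = 0) :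
    evalKey τ₀ k = C (τ₀ ^ (k % 256)) := by
  have : keyExp k = 0 := by
    ext j
    rw [keyExp_apply, h, Nat.zero_div, Nat.zero_mod, Finsupp.zero_apply]
  rw [evalKey, this, ← C_apply]

theorem evalKey_tau : evalKey τ₀ 1 = C τ₀ := by
  rw [evalKey_of_expo_eq_zero τ₀ expo_one, Nat.one_mod, pow_one]

theorem evalKey_monKey {l : List ℕ} (h : wordOk l = true) :
    evalKey τ₀ (monKey l) = evalWord τ₀ l := by
  induction l with
  | nil =>
    change evalKey τ₀ 0 = 1
    rw [evalKey_of_expo_eq_zero τ₀ expo_zero, Nat.zero_mod, pow_zero, C_1]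
  | cons i l ih =>
    simp only [wordOk, Bool.and_eq_true, Nat.blt_eq] at h
    have hc : monKey (i :: l) = varKey i + monKey l := rfl
    rw [hc, evalKey_add τ₀ h.1.1.2 h.1.2, ih h.2, evalWord, varPoly]
    congr 1
    split_ifs with hi
    · exact evalKey_varKey τ₀ ⟨i, hi⟩
    · obtain rfl : i = 15 := by omega
      rw [varKey_fifteen, evalKey_tau]

theorem evalPacked_packTerms {s : List (ℤ × List ℕ)} (h : ∀ x ∈ s, wordOk x.2 = true) :
    evalPacked τ₀ (packTerms s) = evalTerms τ₀ s := by
  induction s with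
  | nil => rfl
  | cons x s ih =>
    rw [List.forall_mem_cons] at h
    change _ * evalKey τ₀ (monKey x.2) + evalPacked τ₀ (packTerms s) = _
    rw [ih h.2, evalKey_monKey τ₀ h.1, evalTerms]

/-- Whether the first coefficient is `1` and all words can be packed. -/
def elemDataOk : List (ℤ × List ℕ) → Bool
  | [] => false
  | x :: s => x.1 == 1 && (x :: s).all fun y => wordOk y.2

theorem evalElem_packElem {s : List (ℤ × List ℕ)} (h : elemDataOk s = true) :
    evalElem τ₀ (packElem s) = evalTerms τ₀ s := by
  cases s with
  | nil => exact absurd h Bool.false_ne_true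
  | cons x s =>
    simp only [elemDataOk, Bool.and_eq_true, List.all_eq_true, beq_iff_eq] at h
    obtain ⟨h1, h2⟩ := h
    rw [List.forall_mem_cons] at h2
    change evalKey τ₀ (monKey x.2) + evalPacked τ₀ (packTerms s) = _
    rw [evalKey_monKey τ₀ h2.1, evalPacked_packTerms τ₀ h2.2, evalTerms, h1]
    push_cast
    ring

theorem map_evalTerms {R' : Type*} [CommRing R'] (φ : R →+* R') (s : List (ℤ × List ℕ)) :
    map φ (evalTerms τ₀ s) = evalTerms (φ τ₀) s := by
  have hv (i : ℕ) : map φ (varPoly τ₀ i) = varPoly (φ τ₀) i := by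
    unfold varPoly
    split_ifs
    · rw [map_X]
    · rw [map_C]
  have hw (l : List ℕ) : map φ (evalWord τ₀ l) = evalWord (φ τ₀) l := by
    induction l with
    | nil => exact map_one _
    | cons i l ih => rw [evalWord, evalWord, map_mul, hv, ih]
  induction s with
  | nil => exact map_zero _
  | cons x s ih => rw [evalTerms, evalTerms, map_add, map_mul, map_intCast, hw, ih]

theorem gData_ok : gData.all elemDataOk = true := by decide +kernel

theorem casimirData_ok : (casimirData.all fun x => wordOk x.2) = true := by decide +kernel

end Symbols

/-! ### Specialization of the noncommutative polynomials at `q = 1` -/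

section Specialization

/-- The scalar `t^{1/2} + t^{-1/2}`. -/
noncomputable def tauRt : Rt := LaurentPolynomial.T 2 + LaurentPolynomial.T (-2)

/-- Specialization `q^{1/4} = 1` to commuting variables. -/
noncomputable def atQOneComm : FreeAlg →+* MvPolynomial Gen Rt :=
  (MvPolynomial.map atQOne).comp
    (FreeAlgebra.lift Rqt (MvPolynomial.X : Gen → MvPolynomial Gen Rqt)).toRingHom

open MvPolynomial in
theorem atQOneComm_smul (c : Rqt) (x : FreeAlg) :
    atQOneComm (c • x) = C (atQOne c) * atQOneComm x := by
  change map atQOne (FreeAlgebra.lift Rqt X (c • x)) = _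
  rw [map_smul, smul_eq_C_mul, map_mul, map_C]
  rfl

theorem atQOneComm_ι (i : Gen) : atQOneComm (FreeAlgebra.ι Rqt i) = MvPolynomial.X i := by
  change MvPolynomial.map atQOne (FreeAlgebra.lift Rqt MvPolynomial.X (FreeAlgebra.ι Rqt i)) = _
  rw [FreeAlgebra.lift_ι_apply, MvPolynomial.map_X]

theorem atQOne_q (n : ℤ) : atQOne (q n) = 1 := by
  simp [atQOne, q]

theorem atQOne_t (n : ℤ) : atQOne (t n) = LaurentPolynomial.T n := by
  simp [atQOne, t]

open LaurentPolynomial in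
theorem tauRt_eq : (T (-2) * (1 + T 4) : Rt) = tauRt := by
  rw [mul_add, mul_one, ← T_add, tauRt, add_comm]
  norm_num

open LaurentPolynomial in
theorem tauRt_sq_eq : (T (-4) * (T 4 + 1) * (1 + T 4) : Rt) = tauRt ^ 2 := by
  rw [← tauRt_eq, show (-4 : ℤ) = -2 + -2 by norm_num, T_add]
  ring

set_option maxHeartbeats 4000000 in
set_option maxRecDepth 10000 in
/-- The data list the commutative images of the `g_i` at `q = 1`. -/
theorem forall_atQOneComm_eq_evalTerms :
    List.Forall₂ (fun g s => atQOneComm g = evalTerms tauRt s)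
      [g1, g2, g3, g4, g5, g6, g7, g8, g9, g10, g11, g12, g13, g14, g15, g16, g17, g18, g19, g20,
        g21, g22, g23, g24, g25, g26, g27, g28, g29, g30, g31, g32, g33, g34, g35, g36, g37, g38,
        g39, g40, g41, g42, g43, g44, g45, g46, g47, g48, g49, g50, g51, g52, g53, g54, g55, g56,
        g57, g58, g59, g60, g61] gData := by
  unfold gData
  simp only [List.forall₂_cons, List.forall₂_nil_left_iff, and_true]
  and_intros
  all_goals
    simp only [g1, g2, g3, g4, g5, g6, g7, g8, g9, g10, g11, g12, g13, g14, g15, g16, g17, g18, g19,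
      g20, g21, g22, g23, g24, g25, g26, g27, g28, g29, g30, g31, g32, g33, g34, g35, g36, g37, g38,
      g39, g40, g41, g42, g43, g44, g45, g46, g47, g48, g49, g50, g51, g52, g53, g54, g55, g56, g57,
      g58, g59, g60, g61, O1, O2, O3, O4, O5, O6, O12, O23, O34, O45, O56, O61, O123, O234, O345,
      map_sub, map_add, map_mul, map_pow, map_one, map_ofNat, atQOneComm_smul, atQOneComm_ι,
      atQOne_q, atQOne_t, one_mul, mul_one, sub_self, zero_add, tauRt_eq, tauRt_sq_eq]
    simp only [evalTerms, evalWord, varPoly, o1, o2, o3, o4, o5, o6, o12, o23, o34, o45, o56, o61,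
      o123, o234, o345, τ]
    simp
    ring

end Specialization

/-! ### The defining relations in terms of the `g_i` -/

section Relations

open MvPolynomial

/-- The polynomial `g_k` at `q = 1`, given by its list of terms. -/
noncomputable def nthPoly (k : ℕ) : MvPolynomial Gen Rt := evalTerms tauRt (gData.getD (k - 1) [])

theorem tau_eq : tau = C tauRt := rfl

set_option maxHeartbeats 4000000 in
set_option maxRecDepth 10000 in
theorem jRelatorA_eq : jRelatorA 0 = -nthPoly 4 ∧ jRelatorA 1 = -nthPoly 3 ∧
    jRelatorA 2 = -nthPoly 1 ∧ jRelatorA 3 = -nthPoly 2 ∧ jRelatorA 4 = -nthPoly 6 ∧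
    jRelatorA 5 = -nthPoly 5 := by
  refine ⟨?_, ?_, ?_, ?_, ?_, ?_⟩
  all_goals
    simp [jRelatorA, v1, v2, v3, gen1, gen2, gen3, tau_eq, nthPoly, gData, evalTerms,
      evalWord, varPoly, o1, o2, o3, o4, o5, o6, o12, o23, o34, o45, o56, o61, o123, o234, o345, τ]
    ring

set_option maxHeartbeats 4000000 in
set_option maxRecDepth 10000 in
theorem jRelatorB_eq : jRelatorB 0 = nthPoly 12 ∧ jRelatorB 1 = nthPoly 10 ∧
    jRelatorB 2 = nthPoly 14 ∧ jRelatorB 3 = nthPoly 13 ∧ jRelatorB 4 = nthPoly 11 ∧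
    jRelatorB 5 = nthPoly 15 := by
  refine ⟨?_, ?_, ?_, ?_, ?_, ?_⟩
  all_goals
    simp [jRelatorB, v1, v2, v3, gen1, gen2, gen3, tau_eq, nthPoly, gData, evalTerms,
      evalWord, varPoly, o1, o2, o3, o4, o5, o6, o12, o23, o34, o45, o56, o61, o123, o234, o345, τ]
    ring

set_option maxHeartbeats 4000000 in
set_option maxRecDepth 10000 in
/-- The elements `g_7`, `g_8`, `g_9` arise as differences of relators divided by `τ`. -/
theorem jRelatorC_eq : jRelatorC 0 = nthPoly 21 ∧ jRelatorC 4 = nthPoly 19 ∧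
    jRelatorC 5 = nthPoly 20 ∧ jRelatorC 3 = nthPoly 21 + tau * nthPoly 7 ∧
    jRelatorC 1 = nthPoly 19 + tau * nthPoly 9 ∧ jRelatorC 2 = nthPoly 20 + tau * nthPoly 8 := by
  refine ⟨?_, ?_, ?_, ?_, ?_, ?_⟩
  all_goals
    simp [jRelatorC, v1, v2, v3, gen1, gen2, gen3, tau_eq, nthPoly, gData, evalTerms,
      evalWord, varPoly, o1, o2, o3, o4, o5, o6, o12, o23, o34, o45, o56, o61, o123, o234, o345, τ]
    ring

theorem two_mul_casimirRelator : 2 * casimirRelator = evalTerms tauRt casimirData := by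
  have h : 2 * half = 1 := by
    rw [half, show (2 : MvPolynomial Gen Rt) = C (LaurentPolynomial.C 2) by
      rw [map_ofNat, map_ofNat], ← C_mul, ← map_mul]
    norm_num
  have h' : 2 * casimirRelator = 2 * (v3 0 * v3 1 * v3 2
      - (v1 0 * v1 3 * v3 2 + v1 1 * v1 4 * v3 0 + v1 2 * v1 5 * v3 1)
      - (v1 0 * v1 2 * v1 4 + v1 1 * v1 3 * v1 5) + tau ^ 3)
      + 1 * tau * (v1 0 * v1 5 * v2 5 + v1 1 * v1 0 * v2 0 + v1 2 * v1 1 * v2 1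
      + v1 3 * v1 2 * v2 2 + v1 4 * v1 3 * v2 3 + v1 5 * v1 4 * v2 4
      - (v2 0 ^ 2 + v2 1 ^ 2 + v2 2 ^ 2 + v2 3 ^ 2 + v2 4 ^ 2 + v2 5 ^ 2)) := by
    rw [← h, casimirRelator]
    ring
  rw [h']
  simp [v1, v2, v3, gen1, gen2, gen3, tau_eq, casimirData, evalTerms, evalWord, varPoly,
    o1, o2, o3, o4, o5, o6, o12, o23, o34, o45, o56, o61, o123, o234, o345, τ]
  ring

end Relations

/-! ### Equality of the ideals -/

section Ideal

open MvPolynomial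

theorem elemOk_of_mem_gElems {g : PackedElem} (hg : g ∈ gElems) : ElemOk g :=
  .of_elemOk (List.all_eq_true.1 gElems_ok g hg)

/-- For `k > 61` the element is `1`. -/
theorem elemOk_nthElem (k : ℕ) : ElemOk (nthElem k) := by
  rw [nthElem, List.getD_eq_getElem?_getD]
  rcases h : gElems[k - 1]? with _ | g
  · exact .of_elemOk (by decide +kernel)
  · exact elemOk_of_mem_gElems (List.mem_of_getElem? h)

theorem length_gElems : gElems.length = 61 := List.length_map _

variable {R : Type*} [CommRing R]

theorem map_nthPoly (φ : Rt →+* R) {k : ℕ} (hk : k - 1 < 61) :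
    map φ (nthPoly k) = evalElem (φ tauRt) (nthElem k) := by
  have hl : gData.length = 61 := rfl
  rw [nthPoly, map_evalTerms, nthElem, gElems, List.getD_eq_getElem _ _ (hk.trans_eq hl.symm),
    List.getD_eq_getElem _ _ (by rwa [List.length_map, hl]), List.getElem_map,
    evalElem_packElem _ (List.all_eq_true.1 gData_ok _ (List.getElem_mem _))]

-- unfolded on variables, this leads to computations with huge unary numbers
attribute [local irreducible] small

variable {τ₀ : R} {I : Ideal (MvPolynomial Gen R)}

theorem ElemOk.evalPacked_scale {g : PackedElem} (hg : ElemOk g) {u : ℕ} (hu : small u = true)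
    (c : ℤ) : evalPacked τ₀ (scale u c ((g.1, 1) :: g.2))
      = (c : MvPolynomial Gen R) * evalKey τ₀ u * evalElem τ₀ g := by
  rw [GenusTwo.evalPacked_scale τ₀ hu _ _ (List.forall_mem_cons.2 ⟨hg.small_lead, hg.small_tail⟩),
    evalPacked, Int.cast_one, one_mul, evalElem]

theorem evalElem_mem_of_stepOk [Nontrivial R] (hτ : IsUnit τ₀) {known : List ℕ}
    (hI : ∀ k ∈ known, evalElem τ₀ (nthElem k) ∈ I) {s : ℕ × ℕ × ℕ × ℕ × ℤ}
    (h : stepOk known s = true) : evalElem τ₀ (nthElem s.1) ∈ I := by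
  obtain ⟨k, a, b, e, c⟩ := s
  simp only [stepOk, Bool.and_eq_true, List.elem_iff, Nat.ble_eq, Nat.beq_eq] at h
  obtain ⟨⟨⟨⟨⟨⟨ha, hb⟩, hab⟩, hba⟩, he⟩, hc⟩, hred⟩ := h
  have hmem := evalPacked_mem_ideal_of_reduces (τ₀ := τ₀) (gs := known.map nthElem)
    (fun g hg => by
      obtain ⟨k, -, rfl⟩ := List.mem_map.1 hg
      exact elemOk_nthElem k) (I := I) (fun g hg => by
      obtain ⟨k, hk, rfl⟩ := List.mem_map.1 hg
      exact hI k hk) _ hred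
  have hesmall : small e = true := by
    interval_cases e <;> decide +kernel
  have heval : evalKey τ₀ e = C (τ₀ ^ e) := by
    interval_cases e
    · rw [evalKey_of_expo_eq_zero τ₀ expo_zero]
    · rw [evalKey_of_expo_eq_zero τ₀ expo_one]
  rw [evalPacked_merge, evalPacked_spoly (elemOk_nthElem a) (elemOk_nthElem b) hab hba,
    (elemOk_nthElem k).evalPacked_scale hesmall, heval] at hmem
  have hmul : ((-c : ℤ) : MvPolynomial Gen R) * C (τ₀ ^ e) * evalElem τ₀ (nthElem k) ∈ I := by
    refine (I.add_mem_iff_right (I.sub_mem ?_ ?_)).1 hmem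
    · exact I.mul_mem_left _ (hI a ha)
    · exact I.mul_mem_left _ (hI b hb)
  have hu : IsUnit (((-c : ℤ) : MvPolynomial Gen R) * C (τ₀ ^ e)) :=
    (((Int.isUnit_iff_natAbs_eq.2 hc).neg).map (Int.castRingHom _)).mul ((hτ.pow e).map C)
  exact (I.unit_mul_mem_iff_mem hu).1 hmul

theorem evalElem_mem_of_stepsOk [Nontrivial R] (hτ : IsUnit τ₀) {known : List ℕ}
    (hI : ∀ k ∈ known, evalElem τ₀ (nthElem k) ∈ I) {ss : List (ℕ × ℕ × ℕ × ℕ × ℤ)}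
    (h : stepsOk known ss = true) :
    ∀ k ∈ known ++ ss.map Prod.fst, evalElem τ₀ (nthElem k) ∈ I := by
  induction ss generalizing known with
  | nil => simpa using hI
  | cons s ss ih =>
    simp only [stepsOk, Bool.and_eq_true] at h
    have hs := evalElem_mem_of_stepOk hτ hI h.1
    have := ih (known := known ++ [s.1]) (by
      intro k hk
      rcases List.mem_append.1 hk with hk | hk
      · exact hI k hk
      · rwa [List.mem_singleton.1 hk]) h.2
    simpa using this

theorem mem_derived : ∀ k < 61, k + 1 ∈ known₁ ++ [49] ++ steps₂.map Prod.fst := by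
  decide

theorem mem_known₁ : ∀ k ∈ known₁, 1 ≤ k ∧ k ≤ 61 := by
  decide

/-- The `g_k` that come directly from the `J`-relators. -/
theorem evalElem_known₀_mem {φ : Rt →+* R} (hτ : IsUnit (φ tauRt))
    (hI : ∀ p ∈ relators, map φ p ∈ I) {k : ℕ} (hk : k ∈ known₀) :
    evalElem (φ tauRt) (nthElem k) ∈ I := by
  obtain ⟨a0, a1, a2, a3, a4, a5⟩ := jRelatorA_eq
  obtain ⟨b0, b1, b2, b3, b4, b5⟩ := jRelatorB_eq
  obtain ⟨c0, c4, c5, c3, c1, c2⟩ := jRelatorC_eq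
  have hA (i : Fin 6) : map φ (jRelatorA i) ∈ I := hI _ (.inl (.inl (.inl ⟨i, rfl⟩)))
  have hB (i : Fin 6) : map φ (jRelatorB i) ∈ I := hI _ (.inl (.inl (.inr ⟨i, rfl⟩)))
  have hC (i : Fin 6) : map φ (jRelatorC i) ∈ I := hI _ (.inl (.inr ⟨i, rfl⟩))
  have hu : IsUnit (map φ tau) := by
    rw [tau_eq, map_C]
    exact hτ.map C
  have hneg {k : ℕ} {p : MvPolynomial Gen Rt} (hp : p = -nthPoly k) (hm : map φ p ∈ I) :
      map φ (nthPoly k) ∈ I := by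
    rwa [hp, map_neg, neg_mem_iff] at hm
  have heq {k : ℕ} {p : MvPolynomial Gen Rt} (hp : p = nthPoly k) (hm : map φ p ∈ I) :
      map φ (nthPoly k) ∈ I := hp ▸ hm
  have hsub {j k : ℕ} {p p' : MvPolynomial Gen Rt} (hp : p = nthPoly j)
      (hp' : p' = nthPoly j + tau * nthPoly k) (hm : map φ p ∈ I) (hm' : map φ p' ∈ I) :
      map φ (nthPoly k) ∈ I := by
    rw [hp', map_add, map_mul, ← hp] at hm'
    exact (I.unit_mul_mem_iff_mem hu).1 ((I.add_mem_iff_right hm).1 hm')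
  rw [← map_nthPoly φ (by revert k; decide)]
  simp only [known₀, List.mem_cons, List.not_mem_nil, or_false] at hk
  rcases hk with rfl | rfl | rfl | rfl | rfl | rfl | rfl | rfl | rfl | rfl | rfl | rfl | rfl | rfl |
    rfl | rfl | rfl | rfl
  exacts [hneg a2 (hA 2), hneg a3 (hA 3), hneg a1 (hA 1), hneg a0 (hA 0), hneg a5 (hA 5),
    hneg a4 (hA 4), hsub c0 c3 (hC 0) (hC 3), hsub c5 c2 (hC 5) (hC 2), hsub c4 c1 (hC 4) (hC 1),
    heq b1 (hB 1), heq b4 (hB 4), heq b0 (hB 0), heq b3 (hB 3), heq b2 (hB 2), heq b5 (hB 5),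
    heq c4 (hC 4), heq c5 (hC 5), heq c0 (hC 0)]

/-- Given the `J`-relations, the Casimir relation amounts to `g₄₉`. -/
theorem casimir_mem_iff [Nontrivial R] {φ : Rt →+* R} (hτ : IsUnit (φ tauRt))
    (hI : ∀ k ∈ known₁, evalElem (φ tauRt) (nthElem k) ∈ I) :
    map φ casimirRelator ∈ I ↔ evalElem (φ tauRt) (nthElem 49) ∈ I := by
  have hmem := evalPacked_mem_ideal_of_reduces (τ₀ := φ tauRt) (gs := known₁.map nthElem)
    (fun g hg => by
      obtain ⟨k, -, rfl⟩ := List.mem_map.1 hg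
      exact elemOk_nthElem k) (I := I) (fun g hg => by
      obtain ⟨k, hk, rfl⟩ := List.mem_map.1 hg
      exact hI k hk) _ casimir_ok
  have h2 : IsUnit (2 : MvPolynomial Gen R) := by
    have : IsUnit (LaurentPolynomial.C (2 : ℂ)) := (IsUnit.mk0 _ two_ne_zero).map _
    simpa only [map_ofNat] using (this.map φ).map (C : R →+* MvPolynomial Gen R)
  rw [evalPacked_merge, (elemOk_nthElem 49).evalPacked_scale (by decide +kernel),
    evalPacked_packTerms _ (List.all_eq_true.1 casimirData_ok), ← map_evalTerms,
    ← two_mul_casimirRelator, map_mul, map_ofNat, evalKey_tau, Int.cast_ofNat] at hmem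
  rw [← I.unit_mul_mem_iff_mem h2,
    ← I.unit_mul_mem_iff_mem (h2.mul (hτ.map C)) (x := evalElem (φ tauRt) (nthElem 49))]
  exact ⟨fun h => (I.add_mem_iff_right h).1 hmem, fun h => (I.add_mem_iff_left h).1 hmem⟩

theorem evalElem_nthElem_mem [Nontrivial R] {φ : Rt →+* R} (hτ : IsUnit (φ tauRt))
    (hI : ∀ p ∈ relators, map φ p ∈ I) :
    ∀ k < 61, evalElem (φ tauRt) (nthElem (k + 1)) ∈ I := by
  have h₁ := evalElem_mem_of_stepsOk hτ (fun k hk => evalElem_known₀_mem hτ hI hk) steps₁_ok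
  have h49 := (casimir_mem_iff hτ h₁).1 (hI _ (.inr rfl))
  have h₂ := evalElem_mem_of_stepsOk hτ (known := known₁ ++ [49]) (fun k hk => by
    rcases List.mem_append.1 hk with hk | hk
    · exact h₁ k hk
    · rwa [List.mem_singleton.1 hk]) steps₂_ok
  exact fun k hk => h₂ _ (mem_derived k hk)

theorem map_relator_mem [Nontrivial R] {φ : Rt →+* R} (hτ : IsUnit (φ tauRt))
    (hI : ∀ k < 61, evalElem (φ tauRt) (nthElem (k + 1)) ∈ I) :
    ∀ p ∈ relators, map φ p ∈ I := by
  have hI' (k : ℕ) (hk : k < 61) : map φ (nthPoly (k + 1)) ∈ I := by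
    rw [map_nthPoly φ hk]
    exact hI k hk
  obtain ⟨a0, a1, a2, a3, a4, a5⟩ := jRelatorA_eq
  obtain ⟨b0, b1, b2, b3, b4, b5⟩ := jRelatorB_eq
  obtain ⟨c0, c4, c5, c3, c1, c2⟩ := jRelatorC_eq
  rintro p (((⟨i, rfl⟩ | ⟨i, rfl⟩) | ⟨i, rfl⟩) | rfl)
  · fin_cases i
    all_goals
      simp only [Fin.zero_eta, Fin.mk_one, Fin.reduceFinMk, a0, a1, a2, a3, a4, a5,
        map_neg, neg_mem_iff]
    all_goals exact hI' _ (by norm_num)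
  · fin_cases i
    all_goals
      simp only [Fin.zero_eta, Fin.mk_one, Fin.reduceFinMk, b0, b1, b2, b3, b4, b5]
    all_goals exact hI' _ (by norm_num)
  · fin_cases i
    all_goals
      simp only [Fin.zero_eta, Fin.mk_one, Fin.reduceFinMk, c0, c1, c2, c3, c4, c5,
        map_add, map_mul]
    all_goals first
      | exact hI' _ (by norm_num)
      | exact I.add_mem (hI' _ (by norm_num)) (I.mul_mem_left _ (hI' _ (by norm_num)))
  · refine (casimir_mem_iff hτ fun k hk => ?_).2 (hI 48 (by norm_num))
    have := mem_known₁ k hk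
    rw [← Nat.sub_add_cancel this.1]
    exact hI _ (by omega)

/-- The relators and the `g_i` generate the same ideal wherever `τ` is a unit. -/
theorem span_relators [Nontrivial R] {φ : Rt →+* R} (hτ : IsUnit (φ tauRt)) :
    Ideal.span (map φ '' relators)
      = Ideal.span {p | p ∈ gElems.reverse.map (evalElem (φ tauRt))} := by
  apply le_antisymm <;> rw [Ideal.span_le]
  · rintro _ ⟨p, hp, rfl⟩
    refine map_relator_mem hτ (fun k hk => Ideal.subset_span ?_) p hp
    refine List.mem_map.2 ⟨_, List.mem_reverse.2 ?_, rfl⟩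
    rw [nthElem, Nat.add_sub_cancel, List.getD_eq_getElem _ _ (by rwa [length_gElems])]
    exact List.getElem_mem _
  · intro p hp
    obtain ⟨g, hg, rfl⟩ := List.mem_map.1 hp
    obtain ⟨k, hk, rfl⟩ := List.mem_iff_getElem.1 (List.mem_reverse.1 hg)
    have := evalElem_nthElem_mem hτ (I := Ideal.span (map φ '' relators))
      (fun p hp => Ideal.subset_span ⟨p, hp, rfl⟩) k (by rwa [length_gElems] at hk)
    rwa [nthElem, Nat.add_sub_cancel, List.getD_eq_getElem _ _ hk] at this

end Ideal

/-! ### The three coefficient rings -/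

section Conclusion

open MvPolynomial

/-- The polynomials `g_i` at `q = 1`, in reversed order, with `t^{1/2} + t^{-1/2}` specialized to
`τ₀`. -/
noncomputable def gPolys {R : Type*} [CommRing R] (τ₀ : R) : List (MvPolynomial Gen R) :=
  gElems.reverse.map (evalElem τ₀)

set_option maxRecDepth 10000 in
/-- The specialization of `g_i` depends only on that of `t^{1/2} + t^{-1/2}`. -/
theorem map_gQOne {R : Type*} [CommRing R] (φ : Rt →+* R) (i : Fin 61) :
    map φ (gQOne i) = evalElem (φ tauRt) (gElems[i.val]'(i.isLt.trans_eq length_gElems.symm)) := by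
  have h := (List.forall₂_iff_get.1 forall_atQOneComm_eq_evalTerms).2 i.val i.isLt i.isLt
  have hq : [g1, g2, g3, g4, g5, g6, g7, g8, g9, g10, g11, g12, g13, g14, g15, g16, g17, g18, g19,
      g20, g21, g22, g23, g24, g25, g26, g27, g28, g29, g30, g31, g32, g33, g34, g35, g36, g37,
      g38, g39, g40, g41, g42, g43, g44, g45, g46, g47, g48, g49, g50, g51, g52, g53, g54, g55,
      g56, g57, g58, g59, g60, g61].get ⟨i.val, i.isLt⟩ = qGroebner i := by
    fin_cases i <;> rfl
  rw [hq] at h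
  change gQOne i = _ at h
  have hk := map_nthPoly φ (k := i.val + 1) i.isLt
  rw [nthPoly, nthElem, Nat.add_sub_cancel, List.getD_eq_getElem _ _ i.isLt,
    List.getD_eq_getElem _ _ (i.isLt.trans_eq length_gElems.symm)] at hk
  rw [h, ← hk]
  rfl

theorem range_map_gQOne {R : Type*} [CommRing R] (φ : Rt →+* R) :
    Set.range (fun i => map φ (gQOne i)) = {p | p ∈ gPolys (φ tauRt)} := by
  ext p
  constructor
  · rintro ⟨i, rfl⟩
    exact List.mem_map.2 ⟨_, List.mem_reverse.2 (List.getElem_mem _), (map_gQOne φ i).symm⟩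
  · intro hp
    obtain ⟨g, hg, rfl⟩ := List.mem_map.1 hp
    obtain ⟨k, hk, rfl⟩ := List.mem_iff_getElem.1 (List.mem_reverse.1 hg)
    exact ⟨⟨k, hk.trans_eq length_gElems⟩, map_gQOne φ _⟩

variable {R : Type*} [CommRing R] [Nontrivial R] (φ : Rt →+* R)

theorem degree_map_gQOne (i : Fin 61) :
    wRevLex.degree (map φ (gQOne i))
      = keyExp (gElems[i.val]'(i.isLt.trans_eq length_gElems.symm)).1 := by
  rw [map_gQOne]
  exact (elemOk_of_mem_gElems (List.getElem_mem _)).degree_eq _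

theorem monic_of_mem_gPolys (τ₀ : R) : ∀ p ∈ gPolys τ₀, wRevLex.Monic p := by
  intro p hp
  obtain ⟨g, hg, rfl⟩ := List.mem_map.1 hp
  exact (elemOk_of_mem_gElems (List.mem_reverse.1 hg)).monic _

theorem pairsResolve_gPolys (τ₀ : R) : PairsResolve wRevLex (gPolys τ₀) (gPolys τ₀) :=
  pairsResolve_of_pairsOk (gs := gElems) (fun _ => elemOk_of_mem_gElems)
    (fun _ hg => List.mem_map.2 ⟨_, List.mem_reverse.2 hg, rfl⟩) (fun _ => List.mem_reverse.1)
    pairsOk_gElems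

theorem mem_standardMonomials_iff (s : Gen →₀ ℕ) :
    s ∈ standardMonomials ↔ ∀ p ∈ gPolys (φ tauRt), ¬ wRevLex.degree p ≤ s := by
  have h : (∀ p ∈ gPolys (φ tauRt), ¬ wRevLex.degree p ≤ s)
      ↔ ∀ p ∈ Set.range fun i => map φ (gQOne i), ¬ wRevLex.degree p ≤ s := by
    rw [range_map_gQOne]
    rfl
  rw [h, Set.forall_mem_range]
  refine forall_congr' fun i => ?_
  rw [degree_map_gQOne φ i, ← degree_map_gQOne toKt i]
  rfl

theorem isUnit_toKt_tauRt : IsUnit (toKt tauRt) := by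
  rw [isUnit_iff_ne_zero]
  intro h
  have h4 : (RatFunc.X : Kt) ^ 4 + 1 = 0 := by
    have hX : (RatFunc.X : Kt) ≠ 0 := RatFunc.X_ne_zero
    have : toKt tauRt = RatFunc.X ^ (2 : ℤ) + RatFunc.X ^ (-2 : ℤ) := by
      simp [toKt, tauRt]
    rw [this] at h
    field_simp at h
    simpa using h
  have hp : (Polynomial.X ^ 4 + 1 : Polynomial ℂ) ≠ 0 :=
    (Polynomial.monic_X_pow_add_C (1 : ℂ) four_ne_zero).ne_zero
  apply hp
  apply RatFunc.algebraMap_injective ℂ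
  simpa using h4

theorem atOne_tauRt : atOne tauRt = 2 := by
  simp [atOne, tauRt]
  norm_num

theorem isUnit_atOne_tauRt : IsUnit (atOne tauRt) := by
  rw [atOne_tauRt]
  exact IsUnit.mk0 _ two_ne_zero

theorem idealT_eq_span : idealT = Ideal.span {p | p ∈ gPolys (toKt tauRt)} :=
  span_relators isUnit_toKt_tauRt

theorem idealOne_eq_span : idealOne = Ideal.span {p | p ∈ gPolys (atOne tauRt)} :=
  span_relators isUnit_atOne_tauRt

/-- The ideal of `ℂ[t^{±1/4}][O₁, …, O₃₄₅]` generated by the `g_i` at `q = 1`. The `g_i` are used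
rather than the relators because the passage from the relators to the `g_i` divides by `τ`, which is
not a unit of `ℂ[t^{±1/4}]`. -/
noncomputable def idealRt : Ideal (MvPolynomial Gen Rt) := Ideal.span {p | p ∈ gPolys tauRt}

theorem map_idealRt {R : Type*} [CommRing R] (φ : Rt →+* R) :
    idealRt.map (map φ) = Ideal.span {p | p ∈ gPolys (φ tauRt)} := by
  have h := range_map_gQOne (RingHom.id Rt)
  simp only [map_id, RingHom.id_apply] at h
  rw [idealRt, ← h, ← range_map_gQOne φ, Ideal.map_span, ← Set.range_comp]
  rfl

end Conclusion

end GenusTwo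

open GenusTwo in
theorem mainTheorem2 :
    -- the elements `g_i` at `q = 1` and at `q = t = 1` are normalized Groebner bases
    ((∀ i, GenusTwo.wRevLex.Monic (GenusTwo.gT i)) ∧
      GenusTwo.IsGroebnerBasis GenusTwo.wRevLex (Set.range GenusTwo.gT) GenusTwo.idealT) ∧
    ((∀ i, GenusTwo.wRevLex.Monic (GenusTwo.gOne i)) ∧
      GenusTwo.IsGroebnerBasis GenusTwo.wRevLex (Set.range GenusTwo.gOne) GenusTwo.idealOne) ∧
    -- with the same leading monomials
    (∀ i, GenusTwo.wRevLex.degree (GenusTwo.gT i) = GenusTwo.wRevLex.degree (GenusTwo.gOne i)) ∧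
    -- a common monomial basis, with structure constants in `ℂ[t^{±1/4}]` that specialize
    (∃ (bT : Module.Basis GenusTwo.standardMonomials GenusTwo.Kt GenusTwo.AlgT)
      (bOne : Module.Basis GenusTwo.standardMonomials ℂ GenusTwo.AlgOne),
      (∀ m, bT m = Ideal.Quotient.mk GenusTwo.idealT (MvPolynomial.monomial m.1 1)) ∧
      (∀ m, bOne m = Ideal.Quotient.mk GenusTwo.idealOne (MvPolynomial.monomial m.1 1)) ∧
      ∃ c : GenusTwo.standardMonomials → GenusTwo.standardMonomials →
          GenusTwo.standardMonomials → GenusTwo.Rt,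
        (∀ b₁ b₂ b₃, bT.repr (bT b₁ * bT b₂) b₃ = GenusTwo.toKt (c b₁ b₂ b₃)) ∧
        (∀ b₁ b₂ b₃, bOne.repr (bOne b₁ * bOne b₂) b₃ = GenusTwo.atOne (c b₁ b₂ b₃))) ∧
    -- `A_{q=1,t}` is a flat deformation of `A_{q=t=1}`
    GenusTwo.IsFlatDeformation
      (fun i : GenusTwo.Gen => Ideal.Quotient.mk GenusTwo.idealT (MvPolynomial.X i))
      (fun i : GenusTwo.Gen => Ideal.Quotient.mk GenusTwo.idealOne (MvPolynomial.X i)) := by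
  have hgT : Set.range gT = {p | p ∈ gPolys (toKt tauRt)} := range_map_gQOne toKt
  have hgOne : Set.range gOne = {p | p ∈ gPolys (atOne tauRt)} := range_map_gQOne atOne
  obtain ⟨bT, hbT⟩ := exists_standard_basis (monic_of_mem_gPolys _) (pairsResolve_gPolys _)
    (mem_standardMonomials_iff toKt) idealT_eq_span
  obtain ⟨bOne, hbOne⟩ := exists_standard_basis (monic_of_mem_gPolys _) (pairsResolve_gPolys _)
    (mem_standardMonomials_iff atOne) idealOne_eq_span
  obtain ⟨b, hb⟩ := exists_standard_basis (I := idealRt) (monic_of_mem_gPolys _)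
    (pairsResolve_gPolys _) (mem_standardMonomials_iff (RingHom.id Rt)) rfl
  have hmT : idealRt.map (MvPolynomial.map toKt) = idealT :=
    (map_idealRt toKt).trans idealT_eq_span.symm
  have hmOne : idealRt.map (MvPolynomial.map atOne) = idealOne :=
    (map_idealRt atOne).trans idealOne_eq_span.symm
  refine ⟨⟨fun i => ?_, ?_⟩, ⟨fun i => ?_, ?_⟩, fun i => ?_, ⟨bT, bOne, hbT, hbOne,
    fun b₁ b₂ b₃ => b.repr (b b₁ * b b₂) b₃, repr_mul_eq_map toKt hmT.le b hb bT hbT,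
    repr_mul_eq_map atOne hmOne.le b hb bOne hbOne⟩, ?_⟩
  · exact monic_of_mem_gPolys _ _ (hgT.subset ⟨i, rfl⟩)
  · rw [hgT, idealT_eq_span]
    exact isGroebnerBasis_of_pairsResolve (monic_of_mem_gPolys _) (pairsResolve_gPolys _)
  · exact monic_of_mem_gPolys _ _ (hgOne.subset ⟨i, rfl⟩)
  · rw [hgOne, idealOne_eq_span]
    exact isGroebnerBasis_of_pairsResolve (monic_of_mem_gPolys _) (pairsResolve_gPolys _)
  · exact (degree_map_gQOne toKt i).trans (degree_map_gQOne atOne i).symm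
  -- the quotient by `idealRt` is flat because it is free on the standard monomials
  · refine ⟨MvPolynomial Gen Rt ⧸ idealRt, inferInstance, inferInstance,
      fun i => Ideal.Quotient.mk idealRt (MvPolynomial.X i), ?_, ?_, ?_, ?_⟩
    · have h : Set.range (fun i => Ideal.Quotient.mk idealRt (MvPolynomial.X i))
          = Ideal.Quotient.mkₐ Rt idealRt '' Set.range MvPolynomial.X := by
        rw [← Set.range_comp]
        rfl
      rw [h, ← AlgHom.map_adjoin, MvPolynomial.adjoin_range_X, Algebra.map_top,
        AlgHom.range_eq_top]
      exact Ideal.Quotient.mkₐ_surjective _ _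
    · have := Module.Free.of_basis b
      infer_instance
    · let : Algebra Rt Kt := toKt.toAlgebra
      exact exists_baseChange_algEquiv idealRt hmT
    · let : Algebra Rt ℂ := atOne.toAlgebra
      exact exists_baseChange_algEquiv idealRt hmOne
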